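/- For an entire function $f$ put $f^*(z)=\overline{f(\bar z)}$. Let $\mathcal{HB}$ be the class of entire functions $E$ with $|E(\bar z)|<|E(z)|$ whenever $\operatorname{Im} z>0$. For $E\in\mathcal{HB}$, the de Branges space $\mathcal H(E)$ is the set of all entire $f$ with $\|f\|_E^2:=\int_{\mathbb R}|f(t)/E(t)|^2\,dt<\infty$ such that $f/E$ and $f^*/E$ are of bounded type in the open upper half-plane (quotients of two bounded analytic functions, with denominator not identically zero) and have nonpositive mean type there, the mean type of $g$ being $\limsup_{y\to+\infty} y^{-1}\log|g(iy)|$. Its reproducing kernel is $$K_E(w,z)=\frac{\overline{E(w)}E(z)-E(\bar w)E^*(z)}{2\pi i(\bar w-z)},$$ extended continuously to $z=\bar w$. For $E\in\mathcal{HB}$ without real zeros, a phase function of $E$ is a continuous strictly increasing $\varphi_E:\mathbb R\to\mathbb R$ with $E(x)=|E(x)|e^{-i\varphi_E(x)}$ for all $x\in\mathbb R$; it is unique up to an additive constant in $2\pi\mathbb Z$. Let $E_0,E,F\in\mathcal{HB}$ have no real zeros. Assume that 1. $\mathcal H(E_0)=\mathcal H(E)$, that is, the two spaces coincide as sets and their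 norms are equivalent; 2. there is $C>0$ with $\varphi_F'(x)\le C\,\varphi_E'(x)$ for all $x\in\mathbb R$; 3. there are $a,b>0$ with $a\le K_{E_0}(x,x)\le b$ for all $x\in\mathbb R$. Then all zeros of $EF+E^*F^*$ are real, and its zero set $\Lambda$ is a (non-normalized) sampling sequence for $\mathcal H(E_0)$: there are constants $A,B>0$ such that for all $f\in\mathcal H(E_0)$ $$A\|f\|_{E_0}^2\le\sum_{\lambda\in\Lambda}|f(\lambda)|^2\le B\|f\|_{E_0}^2 .$$ -/

import Mathlib

open Filter Topology MeasureTheory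
open scoped ComplexConjugate

noncomputable section

namespace DeBranges

/-- The function `f*`, given by `f*(z) = conj (f (conj z))`. -/
def sharp (f : ℂ → ℂ) (z : ℂ) : ℂ := conj (f (conj z))

/-- The Hermite-Biehler class: entire functions `E` with `|E(conj z)| < |E(z)|` on the open
upper half-plane. -/
structure IsHermiteBiehler (E : ℂ → ℂ) : Prop where
  entire : Differentiable ℂ E
  norm_lt : ∀ z : ℂ, 0 < z.im → ‖E (conj z)‖ < ‖E z‖

/-- The open upper half-plane, as a subset of `ℂ`. -/
def upperHalf : Set ℂ := {z : ℂ | 0 < z.im}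

/-- `f` is analytic in the open upper half-plane and of bounded type there: it is a quotient
`p / q` of two bounded analytic functions, with `q` not identically zero. -/
def IsBoundedType (f : ℂ → ℂ) : Prop :=
  DifferentiableOn ℂ f upperHalf ∧
    ∃ p q : ℂ → ℂ, DifferentiableOn ℂ p upperHalf ∧ DifferentiableOn ℂ q upperHalf ∧
      (∃ M : ℝ, ∀ z ∈ upperHalf, ‖p z‖ ≤ M) ∧ (∃ M : ℝ, ∀ z ∈ upperHalf, ‖q z‖ ≤ M) ∧
      (∃ z ∈ upperHalf, q z ≠ 0) ∧ ∀ z ∈ upperHalf, f z * q z = p z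

/-- The mean type `limsup_{y → +∞} log |f(iy)| / y`, in `[-∞, +∞]`, with `log 0 = -∞`. -/
def meanType (f : ℂ → ℂ) : EReal :=
  limsup (fun y : ℝ => ENNReal.log ‖f (Complex.I * (y : ℂ))‖ₑ / (y : EReal)) atTop

/-- The squared norm `∫_ℝ |f(t) / E(t)|² dt`. -/
def normSq (E f : ℂ → ℂ) : ℝ := ∫ t : ℝ, ‖f (t : ℂ) / E (t : ℂ)‖ ^ 2

/-- The de Branges space `H(E)`, as a set of entire functions. -/
def space (E : ℂ → ℂ) : Set (ℂ → ℂ) :=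
  {f | Differentiable ℂ f ∧
    Integrable (fun t : ℝ => ‖f (t : ℂ) / E (t : ℂ)‖ ^ 2) ∧
    (IsBoundedType (fun z => f z / E z) ∧ meanType (fun z => f z / E z) ≤ 0) ∧
    (IsBoundedType (fun z => sharp f z / E z) ∧ meanType (fun z => sharp f z / E z) ≤ 0)}

/-- `H(E₁) = H(E₂)`: the two spaces coincide as sets and their norms are equivalent. -/
def SameSpace (E₁ E₂ : ℂ → ℂ) : Prop :=
  space E₁ = space E₂ ∧
    ∃ a b : ℝ, 0 < a ∧ 0 < b ∧
      ∀ f ∈ space E₁, a * normSq E₁ f ≤ normSq E₂ f ∧ normSq E₂ f ≤ b * normSq E₁ f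

/-- The reproducing kernel
`K_E(w, z) = (conj E(w) E(z) - E(conj w) E*(z)) / (2 π i (conj w - z))`,
extended by its limit to the removable singularity `z = conj w`. -/
def kernel (E : ℂ → ℂ) (w z : ℂ) : ℂ :=
  if z = conj w then
    -deriv (fun u => conj (E w) * E u - E (conj w) * sharp E u) z / (2 * Real.pi * Complex.I)
  else
    (conj (E w) * E z - E (conj w) * sharp E z) / (2 * Real.pi * Complex.I * (conj w - z))

/-- `φ` is a phase function of `E`: it is continuous and strictly increasing, and
`E(x) = |E(x)| exp(-i φ(x))` for all real `x`. -/
structure IsPhaseFunction (E : ℂ → ℂ) (φ : ℝ → ℝ) : Prop where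
  continuous : Continuous φ
  strictMono : StrictMono φ
  eq_norm_mul_exp : ∀ x : ℝ, E x = (‖E x‖ : ℂ) * Complex.exp (-(Complex.I * (φ x : ℂ)))

/-- The family `(s n)` of real points is a (non-normalized) sampling sequence for `H(E)`. -/
def IsSamplingSequence (E : ℂ → ℂ) {ι : Type*} (s : ι → ℝ) : Prop :=
  ∃ A B : ℝ, 0 < A ∧ 0 < B ∧ ∀ f ∈ space E,
    Summable (fun n => ‖f (s n : ℂ)‖ ^ 2) ∧
      A * normSq E f ≤ ∑' n, ‖f (s n : ℂ)‖ ^ 2 ∧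
      ∑' n, ‖f (s n : ℂ)‖ ^ 2 ≤ B * normSq E f

end DeBranges

end

/-! Put `G = E F` and `A = G + G*` (the function `realPart G`). `G` is again Hermite-Biehler without
real zeros, so `|G*| < |G|` above the real axis and `A` has only real zeros. At a real zero `x` of
`A` one has `conj (G x) = -G x`, so `K_G(x, ·)` is a constant multiple of `A(z)/(z - x)`. Hence the
kernels of `H(G)` at distinct zeros of `A` are orthogonal. What is orthogonal to all of them in
`H(G)` vanishes on the zero set of `A`, and a Liouville argument
(`IsRegularHB.eq_const_mul_realPart`) shows that it is a multiple of `A`.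

Multiplication by `F` is an isometry of `H(E)` into `H(G)`, so Bessel's inequality for the
normalized kernels bounds `∑ |f(x)|² |F(x)|² / K_G(x,x)` from above by the squared norm of `f` in
`H(E)`. A lower bound can fail only if `A` itself lies in `H(G)`. In that case
`exists_orthogonal_inner_realPart_ne_zero` gives an explicit vector of `L²(ℝ)` orthogonal to the
image of `H(E)` but not to `A / G`. The image then makes a positive angle with the missing
direction, and `exists_le_tsum_norm_inner_sq` turns the angle into a lower frame bound.

The weights are harmless: on the diagonal `K_G(x,x) = |E|² |F|² (φ_E' + φ_F') / π`, so the
comparison of phases makes `K_G(x,x)` comparable to `|F(x)|² K_E(x,x)` (`kernel_mul_self_bounds`).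
The equivalence of norms makes `K_E(x,x)` comparable to `K_{E₀}(x,x)`
(`IsRegularHB.kernel_self_le`), which is bounded above and below.

The rest is the foundation of de Branges spaces. `IsBoundedType.isHardy` converts bounded type,
nonpositive mean type and square integrability into the pointwise bound `|h(z)|² Im z ≤ C`. From
that bound follow Cauchy's formula by contour integration, the reproducing property at real points
and the completeness of the space. -/

namespace DeBranges

/-! ### Quotients of bounded analytic functions in the unit disc. -/

section DiscEstimates

/-- Maximum modulus principle with boundary values understood as upper limits. -/
theorem norm_le_of_eventually_frontier {D : Set ℂ} (hDo : IsOpen D) (hDb : Bornology.IsBounded D)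
    {f : ℂ → ℂ} (hf : DifferentiableOn ℂ f D) {C : ℝ}
    (h : ∀ ζ ∈ frontier D, ∀ᶠ z in 𝓝[D] ζ, ‖f z‖ ≤ C) {z : ℂ} (hz : z ∈ D) : ‖f z‖ ≤ C := by
  -- A superlevel set above `C` cannot accumulate at the frontier, where `‖f‖ ≤ C` nearby, so it is
  -- closed in `ℂ` and not only in `D`. The set where the maximum is attained is then clopen in `ℂ`,
  -- nonempty and bounded, which is absurd.
  have hclosed : ∀ c, C < ‖f c‖ → IsClosed {x | x ∈ D ∧ ‖f c‖ ≤ ‖f x‖} := by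
    intro c hc
    refine isClosed_of_closure_subset fun x hx => ?_
    have hfr := mem_closure_iff_frequently.1 hx
    have hxD : x ∈ D := by
      by_contra hxD
      have hxf : x ∈ frontier D := by
        rw [frontier, hDo.interior_eq]
        exact ⟨closure_mono (fun y hy => hy.1) hx, hxD⟩
      have := eventually_nhdsWithin_iff.1 (h x hxf)
      obtain ⟨y, hy, hy'⟩ := (hfr.and_eventually this).exists
      linarith [hy.2, hy' hy.1]
    refine ⟨hxD, ?_⟩
    by_contra! hlt
    have hcont : ContinuousAt f x := (hf.differentiableAt (hDo.mem_nhds hxD)).continuousAt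
    obtain ⟨y, hy, hy'⟩ := (hfr.and_eventually (hcont.norm.eventually (gt_mem_nhds hlt))).exists
    exact absurd hy.2 (not_le.2 hy')
  by_contra! hzC
  have hK : IsCompact {x | x ∈ D ∧ ‖f z‖ ≤ ‖f x‖} :=
    Metric.isCompact_of_isClosed_isBounded (hclosed z hzC) (hDb.subset fun x hx => hx.1)
  obtain ⟨c, hc, hmax⟩ := hK.exists_isMaxOn ⟨z, hz, le_rfl⟩
    (f := fun x => ‖f x‖) (hf.continuousOn.norm.mono fun x hx => hx.1)
  have hmaxD : ∀ x ∈ D, ‖f x‖ ≤ ‖f c‖ := by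
    intro x hx
    rcases le_total ‖f z‖ ‖f x‖ with hle | hle
    · exact hmax ⟨hx, hle⟩
    · exact hle.trans hc.2
  have hcl := hclosed c (hzC.trans_le hc.2)
  have hop : IsOpen {x | x ∈ D ∧ ‖f c‖ ≤ ‖f x‖} := by
    rw [isOpen_iff_mem_nhds]
    rintro x ⟨hxD, hx⟩
    have hev := hDo.mem_nhds hxD
    have h1 : ∀ᶠ y in 𝓝 x, DifferentiableAt ℂ f y := hf.eventually_differentiableAt hev
    have hlm : IsLocalMax (norm ∘ f) x := by
      filter_upwards [hev] with y hy
      exact (hmaxD y hy).trans hx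
    filter_upwards [hev, Complex.norm_eventually_eq_of_isLocalMax h1 hlm] with y hy hy'
    exact ⟨hy, by rw [hy']; exact hx⟩
  rcases isClopen_iff.1 ⟨hcl, hop⟩ with h0 | h0
  · exact (h0 ▸ (⟨hc.1, le_rfl⟩ : c ∈ {x | x ∈ D ∧ ‖f c‖ ≤ ‖f x‖}) : c ∈ (∅ : Set ℂ))
  · exact NormedSpace.unbounded_univ ℂ ℂ (h0 ▸ hDb.subset fun x hx => hx.1)

theorem norm_one_sub_conj_mul_sq_sub (w z : ℂ) :
    ‖1 - conj w * z‖ ^ 2 - ‖z - w‖ ^ 2 = (1 - ‖w‖ ^ 2) * (1 - ‖z‖ ^ 2) := by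
  simp only [Complex.sq_norm, Complex.normSq_apply, Complex.sub_re, Complex.sub_im, Complex.mul_re,
    Complex.mul_im, Complex.conj_re, Complex.conj_im, Complex.one_re, Complex.one_im]
  ring

theorem one_sub_conj_mul_ne_zero {w z : ℂ} (hw : ‖w‖ < 1) (hz : ‖z‖ ≤ 1) :
    1 - conj w * z ≠ 0 := by
  intro h
  have h1 : ‖conj w * z‖ = 1 := by rw [← sub_eq_zero.1 h]; simp
  rw [norm_mul, Complex.norm_conj] at h1
  nlinarith [norm_nonneg w, norm_nonneg z]

theorem norm_sub_lt_norm_one_sub_conj_mul {w z : ℂ} (hw : ‖w‖ < 1) (hz : ‖z‖ < 1) :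
    ‖z - w‖ < ‖1 - conj w * z‖ := by
  have h := norm_one_sub_conj_mul_sq_sub w z
  have h1 : 0 < (1 - ‖w‖ ^ 2) * (1 - ‖z‖ ^ 2) := by
    apply mul_pos <;> nlinarith [norm_nonneg w, norm_nonneg z]
  exact lt_of_pow_lt_pow_left₀ 2 (norm_nonneg _) (by linarith)

/-- Schwarz lemma at a zero `w` of a self-map of the disc. -/
theorem norm_mul_norm_one_sub_conj_mul_le {χ : ℂ → ℂ} {w z : ℂ}
    (hχ : DifferentiableOn ℂ χ (Metric.ball 0 1)) (hb : ∀ z ∈ Metric.ball (0 : ℂ) 1, ‖χ z‖ ≤ 1)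
    (hw : ‖w‖ < 1) (hχw : χ w = 0) (hz : ‖z‖ < 1) :
    ‖χ z‖ * ‖1 - conj w * z‖ ≤ ‖z - w‖ := by
  have hw' : ‖-w‖ < 1 := by simpa using hw
  have key : ∀ u : ℂ, ‖u‖ < 1 → ‖(u + w) / (1 + conj w * u)‖ < 1 := by
    intro u hu
    have h1 := norm_sub_lt_norm_one_sub_conj_mul hw' hu
    simp only [map_neg, sub_neg_eq_add, neg_mul] at h1
    rw [norm_div, div_lt_one ((norm_nonneg _).trans_lt h1)]
    exact h1
  have hne : ∀ u : ℂ, ‖u‖ < 1 → 1 + conj w * u ≠ 0 := by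
    intro u hu
    have h1 := one_sub_conj_mul_ne_zero hw' hu.le
    simpa only [map_neg, sub_neg_eq_add, neg_mul] using h1
  have hmaps : ∀ u ∈ Metric.ball (0 : ℂ) 1, (u + w) / (1 + conj w * u) ∈ Metric.ball (0 : ℂ) 1 := by
    intro u hu
    simp only [Metric.mem_ball, dist_zero_right] at hu ⊢
    exact key u hu
  have hcomp : DifferentiableOn ℂ (fun u => χ ((u + w) / (1 + conj w * u))) (Metric.ball 0 1) := by
    refine hχ.comp (DifferentiableOn.div (by fun_prop) (by fun_prop) ?_) hmaps
    intro u hu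
    exact hne u (by simpa using hu)
  have hmain := Complex.norm_le_norm_of_mapsTo_ball (R := 1)
    (z := (z - w) / (1 - conj w * z)) hcomp
    (fun u hu => by simpa using hb _ (hmaps u hu)) (by simpa using hχw) (by
      have h1 := norm_sub_lt_norm_one_sub_conj_mul hw hz
      rw [norm_div, div_lt_one ((norm_nonneg _).trans_lt h1)]
      exact h1)
  have hz1 := one_sub_conj_mul_ne_zero hw hz.le
  have hww : (1 : ℂ) - conj w * w ≠ 0 := one_sub_conj_mul_ne_zero hw hw.le
  have hinv : ((z - w) / (1 - conj w * z) + w) / (1 + conj w * ((z - w) / (1 - conj w * z))) = z := by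
    generalize conj w = v at hz1 hww ⊢
    have e1 : (z - w) / (1 - v * z) + w = z * (1 - v * w) / (1 - v * z) := by
      rw [div_add' _ _ _ hz1]; ring
    have e2 : 1 + v * ((z - w) / (1 - v * z)) = (1 - v * w) / (1 - v * z) := by
      rw [mul_div_assoc', add_div' _ _ _ hz1]; ring
    rw [e1, e2, div_div_div_cancel_right₀ hz1, mul_div_assoc, div_self hww, mul_one]
  rw [hinv, norm_div, le_div_iff₀ (norm_pos_iff.2 hz1)] at hmain
  exact hmain

/-- Harnack's inequality for `-log ‖χ‖`, where `χ` has no zeros in the closed disc of radius `r`. -/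
theorem neg_log_norm_le_of_ne_zero {χ : ℂ → ℂ} {r : ℝ} (hr1 : r < 1)
    (hχ : DifferentiableOn ℂ χ (Metric.ball 0 1)) (hb : ∀ z ∈ Metric.ball (0 : ℂ) 1, ‖χ z‖ ≤ 1)
    (h0 : ∀ z ∈ Metric.closedBall (0 : ℂ) r, χ z ≠ 0) {a : ℂ} (ha : ‖a‖ < r) :
    -Real.log ‖χ a‖ ≤ (r + ‖a‖) / (r - ‖a‖) * -Real.log ‖χ 0‖ := by
  have hr : 0 < r := (norm_nonneg a).trans_lt ha
  have hsub : Metric.closedBall (0 : ℂ) r ⊆ Metric.ball 0 1 := Metric.closedBall_subset_ball hr1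
  have hharm : InnerProductSpace.HarmonicOnNhd (fun z => Real.log ‖χ z‖) (Metric.closedBall 0 r) :=
    fun z hz => AnalyticAt.harmonicAt_log_norm
      ((hχ.analyticOnNhd Metric.isOpen_ball) z (hsub hz)) (h0 z hz)
  have haball : a ∈ Metric.ball (0 : ℂ) r := by simpa using ha
  have h1 := hharm.circleAverage_re_herglotzRieszKernel_smul haball
  have h2 : Real.circleAverage (fun z => Real.log ‖χ z‖) 0 r = Real.log ‖χ 0‖ :=
    InnerProductSpace.HarmonicOnNhd.circleAverage_eq (by rwa [abs_of_pos hr])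
  set c := (r + ‖a‖) / (r - ‖a‖) with hc
  have hcont : ContinuousOn (fun z => Real.log ‖χ z‖) (Metric.sphere 0 |r|) := by
    rw [abs_of_pos hr]
    exact fun z hz => (hharm z (Metric.sphere_subset_closedBall hz)).1.continuousAt.continuousWithinAt
  -- The Poisson kernel is at most `c` on the circle. Since `log ‖χ‖ ≤ 0`, multiplying by it
  -- reverses the inequality, and the mean value property evaluates the average at the centre.
  have h3 : c * Real.log ‖χ 0‖ ≤ Real.log ‖χ a‖ := by
    rw [← h1, ← h2, ← smul_eq_mul, ← Real.circleAverage_fun_smul]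
    refine Real.circleAverage_mono (hcont.const_smul c).circleIntegrable' ?_ ?_
    · refine ContinuousOn.circleIntegrable' ?_
      refine ContinuousOn.smul ?_ hcont
      exact Complex.continuous_re.comp_continuousOn (continuousOn_herglotzRieszKernel_sphere haball)
    · intro z hz
      rw [abs_of_pos hr] at hz
      have hk := re_herglotzRieszKernel_le hz haball
      simp only [sub_zero] at hk
      have hlog : Real.log ‖χ z‖ ≤ 0 := Real.log_nonpos (norm_nonneg _)
        (hb z (hsub (Metric.sphere_subset_closedBall hz)))
      simp only [Pi.smul_apply', Function.comp_apply, herglotzRieszKernel_def, smul_eq_mul, sub_zero]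
      exact mul_le_mul_of_nonpos_right hk hlog
  linarith

theorem norm_le_of_forall_ne {g : ℂ → ℂ} {w : ℂ} {C : ℝ} {U : Set ℂ} (hU : IsOpen U) (hw : w ∈ U)
    (hg : ContinuousAt g w) (h : ∀ z ∈ U, z ≠ w → ‖g z‖ ≤ C) : ‖g w‖ ≤ C := by
  refine le_of_tendsto (x := 𝓝[≠] w) (hg.norm.tendsto.mono_left nhdsWithin_le_nhds) ?_
  filter_upwards [self_mem_nhdsWithin, nhdsWithin_le_nhds (hU.mem_nhds hw)] with z hz hz'
  exact h z hz' hz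

/-- Divide a zero `w` of a self-map of the disc out by a Blaschke factor. -/
theorem exists_div_blaschke {χ ψ : ℂ → ℂ} {w : ℂ}
    (hχ : DifferentiableOn ℂ χ (Metric.ball 0 1)) (hb : ∀ z ∈ Metric.ball (0 : ℂ) 1, ‖χ z‖ ≤ 1)
    (hψ : DifferentiableOn ℂ ψ (Metric.ball 0 1))
    (hψχ : ∀ z ∈ Metric.ball (0 : ℂ) 1, ‖ψ z * χ z‖ ≤ 1)
    (hw : ‖w‖ < 1) (hχw : χ w = 0) :
    ∃ χ₁ : ℂ → ℂ, DifferentiableOn ℂ χ₁ (Metric.ball 0 1) ∧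
      (∀ z ∈ Metric.ball (0 : ℂ) 1, ‖χ₁ z‖ ≤ 1) ∧
      (∀ z ∈ Metric.ball (0 : ℂ) 1, ‖ψ z * χ₁ z‖ ≤ 1) ∧ χ 0 = χ₁ 0 * (-w) := by
  have hwb : w ∈ Metric.ball (0 : ℂ) 1 := by simpa using hw
  have hnhds := Metric.isOpen_ball.mem_nhds hwb
  have hd : DifferentiableOn ℂ (fun z => dslope χ w z * (1 - conj w * z)) (Metric.ball 0 1) :=
    ((Complex.differentiableOn_dslope hnhds).2 hχ).mul (by fun_prop)
  have heq : ∀ z, z ≠ w → (dslope χ w z * (1 - conj w * z)) * (z - w) = χ z * (1 - conj w * z) := by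
    intro z hz
    have := sub_smul_dslope χ w z
    rw [hχw, sub_zero, smul_eq_mul] at this
    rw [← this]; ring
  refine ⟨fun z => dslope χ w z * (1 - conj w * z), hd, ?_, ?_, ?_⟩
  · have hne : ∀ z ∈ Metric.ball (0 : ℂ) 1, z ≠ w → ‖dslope χ w z * (1 - conj w * z)‖ ≤ 1 := by
      intro z hz hzw
      have h1 := norm_mul_norm_one_sub_conj_mul_le hχ hb hw hχw (z := z) (by simpa using hz)
      rw [← norm_mul, ← heq z hzw, norm_mul] at h1
      exact le_of_mul_le_mul_right (by linarith) (norm_pos_iff.2 (sub_ne_zero.2 hzw))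
    intro z hz
    by_cases hzw : z = w
    · subst hzw
      exact norm_le_of_forall_ne (g := fun z' => dslope χ z z' * (1 - conj z * z'))
        Metric.isOpen_ball hwb (hd.differentiableAt hnhds).continuousAt hne
    · exact hne z hz hzw
  -- The product `ψ χ` vanishes at `w` too, so the Schwarz lemma applies to it directly and its
  -- bound survives the division.
  · have hne : ∀ z ∈ Metric.ball (0 : ℂ) 1, z ≠ w →
        ‖ψ z * (dslope χ w z * (1 - conj w * z))‖ ≤ 1 := by
      intro z hz hzw
      have h1 := norm_mul_norm_one_sub_conj_mul_le (hψ.mul hχ) hψχ hw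
        (by simp [hχw]) (z := z) (by simpa using hz)
      rw [← norm_mul, Pi.mul_apply, mul_assoc, ← heq z hzw, ← mul_assoc, norm_mul] at h1
      exact le_of_mul_le_mul_right (by linarith) (norm_pos_iff.2 (sub_ne_zero.2 hzw))
    intro z hz
    by_cases hzw : z = w
    · subst hzw
      exact norm_le_of_forall_ne (g := fun z' => ψ z' * (dslope χ z z' * (1 - conj z * z')))
        Metric.isOpen_ball hwb ((hψ.mul hd).differentiableAt hnhds).continuousAt hne
    · exact hne z hz hzw
  · by_cases h0 : (0 : ℂ) = w
    · subst h0; simp [hχw]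
    · have := heq 0 h0
      simpa using this.symm

/-- Induction on the zeros of `χ` in the closed disc of radius `r`. Dividing out a zero `w` replaces
`‖χ 0‖` by `‖χ 0‖ / ‖w‖`, a gain of at least `1 / r`. As the value never exceeds one, `r ^ n < ‖χ
0‖` leaves room for fewer than `n` divisions. Once no zero is left, `log ‖ψ a‖ ≤ -log ‖χ a‖` and
Harnack's inequality applies. -/
theorem log_norm_le_of_mul_le_one_aux {ψ : ℂ → ℂ} {r : ℝ} (hr1 : r < 1)
    (hψ : DifferentiableOn ℂ ψ (Metric.ball 0 1)) {a : ℂ} (ha : ‖a‖ < r) (n : ℕ) :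
    ∀ χ : ℂ → ℂ, DifferentiableOn ℂ χ (Metric.ball 0 1) →
      (∀ z ∈ Metric.ball (0 : ℂ) 1, ‖χ z‖ ≤ 1) →
      (∀ z ∈ Metric.ball (0 : ℂ) 1, ‖ψ z * χ z‖ ≤ 1) → r ^ n < ‖χ 0‖ →
      Real.log ‖ψ a‖ ≤ (r + ‖a‖) / (r - ‖a‖) * -Real.log ‖χ 0‖ := by
  have hr : 0 < r := (norm_nonneg a).trans_lt ha
  have hc : 0 ≤ (r + ‖a‖) / (r - ‖a‖) :=
    div_nonneg (by positivity) (by linarith)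
  induction n with
  | zero =>
    intro χ _ hb _ h0
    have := hb 0 (by simp)
    simp only [pow_zero] at h0
    linarith
  | succ n ih =>
    intro χ hχ hb hψχ h0
    have hχ0 : 0 < ‖χ 0‖ := (by positivity : 0 < r ^ (n + 1)).trans h0
    by_cases hz : ∀ z ∈ Metric.closedBall (0 : ℂ) r, χ z ≠ 0
    · have h1 := neg_log_norm_le_of_ne_zero hr1 hχ hb hz ha
      have hab : a ∈ Metric.ball (0 : ℂ) 1 := by simpa using ha.trans hr1
      have h2 := hψχ a hab
      have h3 : 0 < ‖χ a‖ := norm_pos_iff.2 (hz a (by simpa using ha.le))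
      refine le_trans ?_ h1
      rcases (norm_nonneg (ψ a)).eq_or_lt with hψ0 | hψ0
      · rw [← hψ0, Real.log_zero, neg_nonneg]
        exact Real.log_nonpos (norm_nonneg _) (hb a hab)
      · have := Real.log_nonpos (by positivity) h2
        rw [norm_mul, Real.log_mul hψ0.ne' h3.ne'] at this
        linarith
    · push Not at hz
      obtain ⟨w, hw, hχw⟩ := hz
      have hwr : ‖w‖ ≤ r := by simpa using hw
      obtain ⟨χ₁, hd, hb₁, hψ₁, h01⟩ :=
        exists_div_blaschke hχ hb hψ hψχ (hwr.trans_lt hr1) hχw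
      have hn : ‖χ 0‖ = ‖χ₁ 0‖ * ‖w‖ := by rw [h01, norm_mul, norm_neg]
      have hn1 : ‖χ 0‖ ≤ ‖χ₁ 0‖ * r := by rw [hn]; gcongr
      have hlt : r ^ n < ‖χ₁ 0‖ := by
        have : r ^ n * r < ‖χ₁ 0‖ * r := by rw [← pow_succ]; linarith
        exact lt_of_mul_lt_mul_right this hr.le
      refine (ih χ₁ hd hb₁ hψ₁ hlt).trans (mul_le_mul_of_nonneg_left ?_ hc)
      rw [neg_le_neg_iff]
      refine Real.log_le_log hχ0 (hn1.trans ?_)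
      nlinarith [norm_nonneg (χ₁ 0)]

/-- A quotient `ψ` of two functions bounded by one in the disc, with denominator `χ`, satisfies a
Poisson-type bound. -/
theorem log_norm_le_of_mul_le_one {ψ χ : ℂ → ℂ}
    (hψ : DifferentiableOn ℂ ψ (Metric.ball 0 1)) (hχ : DifferentiableOn ℂ χ (Metric.ball 0 1))
    (hb : ∀ z ∈ Metric.ball (0 : ℂ) 1, ‖χ z‖ ≤ 1)
    (hψχ : ∀ z ∈ Metric.ball (0 : ℂ) 1, ‖ψ z * χ z‖ ≤ 1) (h0 : χ 0 ≠ 0) {a : ℂ} (ha : ‖a‖ < 1) :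
    Real.log ‖ψ a‖ ≤ (1 + ‖a‖) / (1 - ‖a‖) * -Real.log ‖χ 0‖ := by
  have hlim : Tendsto (fun r : ℝ => (r + ‖a‖) / (r - ‖a‖) * -Real.log ‖χ 0‖) (𝓝[<] 1)
      (𝓝 ((1 + ‖a‖) / (1 - ‖a‖) * -Real.log ‖χ 0‖)) := by
    refine Tendsto.mono_left (ContinuousAt.tendsto ?_) nhdsWithin_le_nhds
    exact ((continuousAt_id.add continuousAt_const).div
      (continuousAt_id.sub continuousAt_const) (sub_pos.2 ha).ne').mul continuousAt_const
  refine ge_of_tendsto hlim ?_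
  filter_upwards [self_mem_nhdsWithin, nhdsWithin_le_nhds (lt_mem_nhds ha)] with r hr1 har
  obtain ⟨n, hn⟩ := exists_pow_lt_of_lt_one (norm_pos_iff.2 h0) hr1
  exact log_norm_le_of_mul_le_one_aux hr1 hψ har n χ hχ hb hψχ hn

end DiscEstimates


/-! ### Transfer to the upper half-plane, and Phragmén-Lindelöf principles. -/

section HalfPlaneEstimates

theorem isOpen_upperHalf : IsOpen upperHalf := isOpen_lt continuous_const Complex.continuous_im

/-- The conformal map of the unit disc onto the upper half-plane with `0 ↦ z₀`. -/
noncomputable def ofDisc (z₀ ζ : ℂ) : ℂ := (z₀ - ζ * conj z₀) / (1 - ζ)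

theorem one_sub_ne_zero {ζ : ℂ} (hζ : ‖ζ‖ < 1) : 1 - ζ ≠ 0 := by
  intro h
  rw [← sub_eq_zero.1 h] at hζ
  simp at hζ

theorem ofDisc_mem {z₀ ζ : ℂ} (h₀ : 0 < z₀.im) (hζ : ‖ζ‖ < 1) : ofDisc z₀ ζ ∈ upperHalf := by
  have h1 := one_sub_ne_zero hζ
  have h2 : 0 < Complex.normSq (1 - ζ) := Complex.normSq_pos.2 h1
  have h3 : Complex.normSq ζ < 1 := by
    rw [← Complex.sq_norm]; nlinarith [norm_nonneg ζ]
  have h4 : (ofDisc z₀ ζ).im = z₀.im * (1 - Complex.normSq ζ) / Complex.normSq (1 - ζ) := by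
    rw [ofDisc, Complex.div_im, div_sub_div_same]
    congr 1
    simp only [Complex.normSq_apply, Complex.sub_re, Complex.sub_im, Complex.mul_re, Complex.mul_im,
      Complex.conj_re, Complex.conj_im, Complex.one_re, Complex.one_im]
    ring
  change 0 < (ofDisc z₀ ζ).im
  rw [h4]
  exact div_pos (mul_pos h₀ (by linarith)) h2

theorem differentiableOn_ofDisc (z₀ : ℂ) : DifferentiableOn ℂ (ofDisc z₀) (Metric.ball 0 1) := by
  unfold ofDisc
  refine DifferentiableOn.div (by fun_prop) (by fun_prop) fun ζ hζ => ?_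
  exact one_sub_ne_zero (by simpa using hζ)

theorem sub_conj_ne_zero {z₀ z : ℂ} (h₀ : 0 < z₀.im) (hz : 0 ≤ z.im) : z - conj z₀ ≠ 0 := by
  intro h
  have := congrArg Complex.im h
  simp at this
  linarith

theorem ofDisc_div {z₀ z : ℂ} (h₀ : 0 < z₀.im) (hz : 0 < z.im) :
    ofDisc z₀ ((z - z₀) / (z - conj z₀)) = z := by
  have h1 := sub_conj_ne_zero h₀ hz.le
  have h2 : z₀ - conj z₀ ≠ 0 := sub_conj_ne_zero h₀ h₀.le
  rw [ofDisc]
  have e1 : z₀ - (z - z₀) / (z - conj z₀) * conj z₀ = z * (z₀ - conj z₀) / (z - conj z₀) := by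
    field_simp; ring
  have e2 : 1 - (z - z₀) / (z - conj z₀) = (z₀ - conj z₀) / (z - conj z₀) := by
    field_simp; ring
  rw [e1, e2, div_div_div_cancel_right₀ h1, mul_div_assoc, div_self h2, mul_one]

theorem one_sub_norm_sq_cayley {z₀ z : ℂ} (h₀ : 0 < z₀.im) (hz : 0 < z.im) :
    1 - ‖(z - z₀) / (z - conj z₀)‖ ^ 2 = 4 * z.im * z₀.im / ‖z - conj z₀‖ ^ 2 := by
  have h1 := sub_conj_ne_zero h₀ hz.le
  have h2 : 0 < ‖z - conj z₀‖ ^ 2 := by positivity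
  rw [norm_div, div_pow, eq_div_iff h2.ne', sub_mul, div_mul_cancel₀ _ h2.ne']
  simp only [Complex.sq_norm, Complex.normSq_apply, Complex.sub_re, Complex.sub_im,
    Complex.conj_re, Complex.conj_im]
  ring

theorem norm_sub_conj_sq_le (z₀ z : ℂ) :
    ‖z - conj z₀‖ ^ 2 ≤ 2 * (1 + ‖z₀‖ ^ 2) * (1 + ‖z‖ ^ 2) := by
  have h := norm_sub_le z (conj z₀)
  rw [Complex.norm_conj] at h
  nlinarith [norm_nonneg z, norm_nonneg z₀, norm_nonneg (z - conj z₀), sq_nonneg (‖z‖ - ‖z₀‖),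
    mul_nonneg (sq_nonneg ‖z‖) (sq_nonneg ‖z₀‖)]

theorem norm_cayley_lt_one {z₀ z : ℂ} (h₀ : 0 < z₀.im) (hz : 0 < z.im) :
    ‖(z - z₀) / (z - conj z₀)‖ < 1 := by
  have h := one_sub_norm_sq_cayley h₀ hz
  have h1 := sub_conj_ne_zero h₀ hz.le
  have : 0 < 4 * z.im * z₀.im / ‖z - conj z₀‖ ^ 2 := by positivity
  nlinarith [norm_nonneg ((z - z₀) / (z - conj z₀))]

theorem le_one_sub_norm_sq_cayley {z₀ z : ℂ} (h₀ : 0 < z₀.im) (hz : 0 < z.im) :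
    2 * z₀.im / (1 + ‖z₀‖ ^ 2) * (z.im / (1 + ‖z‖ ^ 2)) ≤
      1 - ‖(z - z₀) / (z - conj z₀)‖ ^ 2 := by
  have h1 := sub_conj_ne_zero h₀ hz.le
  rw [one_sub_norm_sq_cayley h₀ hz, div_mul_div_comm, div_le_div_iff₀ (by positivity) (by positivity)]
  have := norm_sub_conj_sq_le z₀ z
  have h2 : 0 < z.im * z₀.im := mul_pos hz h₀
  nlinarith

/-- A quotient of bounded analytic functions in the half-plane grows at most like
`exp (C (1 + |z|²) / Im z)`. -/
theorem exists_norm_le_exp_of_mul_bounded {H q : ℂ → ℂ} (hH : DifferentiableOn ℂ H upperHalf)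
    (hq : DifferentiableOn ℂ q upperHalf) {M₁ M₂ : ℝ} (hqM : ∀ z ∈ upperHalf, ‖q z‖ ≤ M₁)
    (hHq : ∀ z ∈ upperHalf, ‖H z * q z‖ ≤ M₂) (h0 : ∃ z ∈ upperHalf, q z ≠ 0) :
    ∃ C : ℝ, 0 ≤ C ∧ ∀ z ∈ upperHalf, ‖H z‖ ≤ Real.exp (C * ((1 + ‖z‖ ^ 2) / z.im)) := by
  -- The disc is centred at a point where `q` does not vanish, because the disc estimate needs a
  -- nonzero denominator at the origin.
  obtain ⟨z₀, hz₀, hq0⟩ := h0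
  have h₀ : 0 < z₀.im := hz₀
  obtain ⟨M, hM1, hM2, hM0⟩ : ∃ M : ℝ, M₁ ≤ M ∧ M₂ ≤ M ∧ 1 ≤ M :=
    ⟨max (max M₁ M₂) 1, (le_max_left _ _).trans (le_max_left _ _),
      (le_max_right _ _).trans (le_max_left _ _), le_max_right _ _⟩
  have hM : 0 < M := by linarith
  have hmem : Set.MapsTo (ofDisc z₀) (Metric.ball 0 1) upperHalf :=
    fun ζ hζ => ofDisc_mem h₀ (by simpa using hζ)
  have hψ : DifferentiableOn ℂ (fun ζ => H (ofDisc z₀ ζ)) (Metric.ball 0 1) :=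
    hH.comp (differentiableOn_ofDisc z₀) hmem
  have hχ : DifferentiableOn ℂ (fun ζ => q (ofDisc z₀ ζ) / M) (Metric.ball 0 1) :=
    (hq.comp (differentiableOn_ofDisc z₀) hmem).div_const _
  have hMn : ‖(M : ℂ)‖ = M := by simp [abs_of_pos hM]
  have hb : ∀ ζ ∈ Metric.ball (0 : ℂ) 1, ‖q (ofDisc z₀ ζ) / M‖ ≤ 1 := by
    intro ζ hζ
    rw [norm_div, hMn, div_le_one hM]
    exact (hqM _ (hmem hζ)).trans hM1
  have hbp : ∀ ζ ∈ Metric.ball (0 : ℂ) 1, ‖H (ofDisc z₀ ζ) * (q (ofDisc z₀ ζ) / M)‖ ≤ 1 := by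
    intro ζ hζ
    rw [← mul_div_assoc, norm_div, hMn, div_le_one hM]
    exact (hHq _ (hmem hζ)).trans hM2
  have hχ0 : q (ofDisc z₀ 0) / M ≠ 0 := by
    simpa [ofDisc, hM.ne'] using hq0
  set L := -Real.log ‖q (ofDisc z₀ 0) / M‖ with hL
  have hL0 : 0 ≤ L := neg_nonneg.2 (Real.log_nonpos (norm_nonneg _) (hb 0 (by simp)))
  refine ⟨2 * (1 + ‖z₀‖ ^ 2) * L / z₀.im, by positivity, fun z hz => ?_⟩
  have hzi : 0 < z.im := hz
  set a := (z - z₀) / (z - conj z₀) with ha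
  have ha1 : ‖a‖ < 1 := norm_cayley_lt_one h₀ hzi
  have hmain := log_norm_le_of_mul_le_one hψ hχ hb hbp hχ0 ha1
  simp only [ha, ofDisc_div h₀ hzi] at hmain
  rw [← ha, ← hL] at hmain
  refine (Real.le_exp_log _).trans (Real.exp_le_exp.2 (hmain.trans ?_))
  have hlow := le_one_sub_norm_sq_cayley h₀ hzi
  rw [← ha] at hlow
  have hk : 0 < 2 * z₀.im / (1 + ‖z₀‖ ^ 2) * (z.im / (1 + ‖z‖ ^ 2)) := by positivity
  have h1 : (1 + ‖a‖) / (1 - ‖a‖) ≤ 4 / (2 * z₀.im / (1 + ‖z₀‖ ^ 2) * (z.im / (1 + ‖z‖ ^ 2))) := by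
    rw [div_le_div_iff₀ (by linarith) hk]
    have h2 : (1 + ‖a‖) * (2 * z₀.im / (1 + ‖z₀‖ ^ 2) * (z.im / (1 + ‖z‖ ^ 2))) ≤
        (1 + ‖a‖) * (1 - ‖a‖ ^ 2) := by
      gcongr
    have h3 : (1 + ‖a‖) * (1 - ‖a‖ ^ 2) = (1 + ‖a‖) ^ 2 * (1 - ‖a‖) := by ring
    have h4 : (1 + ‖a‖) ^ 2 ≤ 4 := by nlinarith [norm_nonneg a]
    nlinarith
  calc (1 + ‖a‖) / (1 - ‖a‖) * L
      ≤ 4 / (2 * z₀.im / (1 + ‖z₀‖ ^ 2) * (z.im / (1 + ‖z‖ ^ 2))) * L := by gcongr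
    _ = 2 * (1 + ‖z₀‖ ^ 2) * L / z₀.im * ((1 + ‖z‖ ^ 2) / z.im) := by
        field_simp; ring

/-- Schwarz-Pick lower bound for `1 - ‖Θ‖`. -/
theorem exists_le_one_sub_norm {Θ : ℂ → ℂ} (hΘ : DifferentiableOn ℂ Θ upperHalf)
    (hb : ∀ z ∈ upperHalf, ‖Θ z‖ ≤ 1) (h0 : ∃ z ∈ upperHalf, ‖Θ z‖ < 1) :
    ∃ c : ℝ, 0 < c ∧ ∀ z ∈ upperHalf, c * (z.im / (1 + ‖z‖ ^ 2)) ≤ 1 - ‖Θ z‖ := by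
  obtain ⟨z₀, hz₀, hθ⟩ := h0
  have h₀ : 0 < z₀.im := hz₀
  set t := Θ z₀ with ht
  have hmem : Set.MapsTo (ofDisc z₀) (Metric.ball 0 1) upperHalf :=
    fun ζ hζ => ofDisc_mem h₀ (by simpa using hζ)
  have hd : DifferentiableOn ℂ (fun ζ => Θ (ofDisc z₀ ζ)) (Metric.ball 0 1) :=
    hΘ.comp (differentiableOn_ofDisc z₀) hmem
  have hβ : DifferentiableOn ℂ (fun ζ => (Θ (ofDisc z₀ ζ) - t) / (1 - conj t * Θ (ofDisc z₀ ζ)))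
      (Metric.ball 0 1) := by
    refine (hd.sub_const _).div ((hd.const_mul _).const_sub _) fun ζ hζ => ?_
    exact one_sub_conj_mul_ne_zero hθ (hb _ (hmem hζ))
  have hle : ∀ u : ℂ, ‖u‖ ≤ 1 → ‖(u - t) / (1 - conj t * u)‖ ≤ 1 := by
    intro u hu
    rw [norm_div, div_le_one (norm_pos_iff.2 (one_sub_conj_mul_ne_zero hθ hu))]
    have h := norm_one_sub_conj_mul_sq_sub t u
    have h1 : 0 ≤ (1 - ‖t‖ ^ 2) * (1 - ‖u‖ ^ 2) := by
      apply mul_nonneg <;> nlinarith [norm_nonneg t, norm_nonneg u]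
    exact le_of_sq_le_sq (by linarith) (norm_nonneg _)
  refine ⟨z₀.im / (1 + ‖z₀‖ ^ 2) * (1 - ‖t‖) ^ 2, by have : 0 < 1 - ‖t‖ := by linarith
                                                     positivity, fun z hz => ?_⟩
  have hzi : 0 < z.im := hz
  set a := (z - z₀) / (z - conj z₀) with ha
  have ha1 : ‖a‖ < 1 := norm_cayley_lt_one h₀ hzi
  have hs := Complex.norm_le_norm_of_mapsTo_ball (R := 1) (z := a) hβ
    (fun ζ hζ => by simpa using hle _ (hb _ (hmem hζ))) (by simp [ofDisc, ← ht]) ha1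
  simp only [ha, ofDisc_div h₀ hzi] at hs
  rw [← ha] at hs
  have hΘz := hb z hz
  have hne := norm_pos_iff.2 (one_sub_conj_mul_ne_zero hθ hΘz)
  rw [norm_div, div_le_iff₀ hne] at hs
  have hid := norm_one_sub_conj_mul_sq_sub t (Θ z)
  have hlow := le_one_sub_norm_sq_cayley h₀ hzi
  rw [← ha] at hlow
  have hge : 1 - ‖t‖ ≤ ‖1 - conj t * Θ z‖ := by
    have h1 := norm_sub_norm_le (1 : ℂ) (conj t * Θ z)
    rw [norm_mul, Complex.norm_conj, norm_one] at h1
    nlinarith [norm_nonneg t, norm_nonneg (Θ z)]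
  set k := 2 * z₀.im / (1 + ‖z₀‖ ^ 2) * (z.im / (1 + ‖z‖ ^ 2)) with hk
  have hk0 : 0 ≤ k := by positivity
  have h1 : k * (1 - ‖t‖) ^ 2 ≤ (1 - ‖t‖ ^ 2) * (1 - ‖Θ z‖ ^ 2) := by
    have e1 : (1 - ‖t‖) ^ 2 ≤ ‖1 - conj t * Θ z‖ ^ 2 := by
      have : 0 ≤ 1 - ‖t‖ := by linarith
      gcongr
    have e2 : ‖Θ z - t‖ ^ 2 ≤ (‖a‖ * ‖1 - conj t * Θ z‖) ^ 2 := by gcongr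
    have e3 : 0 ≤ 1 - ‖a‖ ^ 2 := hk0.trans hlow
    calc k * (1 - ‖t‖) ^ 2 ≤ (1 - ‖a‖ ^ 2) * ‖1 - conj t * Θ z‖ ^ 2 := by gcongr
      _ ≤ _ := by rw [← hid]; nlinarith
  have h2 : (1 - ‖t‖ ^ 2) * (1 - ‖Θ z‖ ^ 2) ≤ 2 * (1 - ‖Θ z‖) := by
    have e0 : 1 - ‖t‖ ^ 2 ≤ 1 := by nlinarith [norm_nonneg t]
    have e1 : 0 ≤ 1 - ‖Θ z‖ ^ 2 := by nlinarith [norm_nonneg (Θ z)]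
    have e2 : 1 - ‖Θ z‖ ^ 2 ≤ 2 * (1 - ‖Θ z‖) := by nlinarith [norm_nonneg (Θ z)]
    nlinarith
  have h3 : z₀.im / (1 + ‖z₀‖ ^ 2) * (1 - ‖t‖) ^ 2 * (z.im / (1 + ‖z‖ ^ 2)) =
      k * (1 - ‖t‖) ^ 2 / 2 := by rw [hk]; ring
  rw [h3]
  linarith

theorem re_I_div_sub_ofReal (z : ℂ) (r : ℝ) :
    (Complex.I / (z - r)).re = z.im / ‖z - r‖ ^ 2 := by
  rw [Complex.div_re, Complex.sq_norm]
  simp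

/-- Phragmén-Lindelöf in the half-plane with growth up to `exp (C (1 + |z|²) / Im z)`. -/
theorem norm_le_exp_im_of_boundary {H : ℂ → ℂ} (hH : DifferentiableOn ℂ H upperHalf) {C : ℝ}
    (hC : 0 ≤ C) (hgrowth : ∀ z ∈ upperHalf, ‖H z‖ ≤ Real.exp (C * ((1 + ‖z‖ ^ 2) / z.im)))
    (hbd : ∀ x : ℝ, ∀ᶠ z in 𝓝[upperHalf] (x : ℂ), ‖H z‖ ≤ 1) {z : ℂ} (hz : z ∈ upperHalf) :
    ‖H z‖ ≤ Real.exp (2 * C * z.im) := by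
  have hzi : 0 < z.im := hz
  have hstep : ∀ R : ℝ, ‖z‖ < R →
      ‖H z‖ ≤ Real.exp (C * (1 + R ^ 2) * (2 * z.im / (R - ‖z‖) ^ 2)) := by
    intro R hR
    have hR0 : 0 < R := (norm_nonneg z).trans_lt hR
    set K := C * (1 + R ^ 2) with hK
    have hK0 : 0 ≤ K := by positivity
    -- The real part of `W` is nonnegative in the half-plane and equals exactly `1 / Im ζ` on the
    -- semicircle `|ζ| = R`. The factor `exp (-K W)` with `K = C (1 + R²)` therefore cancels the
    -- allowed growth there.
    set W : ℂ → ℂ := fun u => Complex.I / (u - (R : ℝ)) + Complex.I / (u - (-R : ℝ)) with hW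
    have hWre : ∀ u : ℂ, (W u).re = u.im / ‖u - (R : ℝ)‖ ^ 2 + u.im / ‖u - (-R : ℝ)‖ ^ 2 := by
      intro u
      simp only [hW, Complex.add_re, re_I_div_sub_ofReal]
    set D := Metric.ball (0 : ℂ) R ∩ upperHalf with hD
    have hDo : IsOpen D := Metric.isOpen_ball.inter isOpen_upperHalf
    have hWd : ∀ u : ℂ, 0 < u.im → DifferentiableAt ℂ W u := by
      intro u hu
      have hne : ∀ r : ℝ, u - (r : ℂ) ≠ 0 := by
        intro r h
        have := congrArg Complex.im h
        simp at this
        linarith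
      have hd1 : ∀ r : ℝ, DifferentiableAt ℂ (fun u : ℂ => Complex.I / (u - (r : ℂ))) u := fun r =>
        (differentiableAt_const _).div (differentiableAt_id.sub_const _) (hne r)
      exact (hd1 R).add (hd1 (-R))
    set f : ℂ → ℂ := fun u => H u * Complex.exp (-(K * W u)) with hf
    have hfn : ∀ u, ‖f u‖ = ‖H u‖ * Real.exp (-(K * (W u).re)) := by
      intro u
      simp only [hf, norm_mul, Complex.norm_exp, Complex.neg_re, Complex.re_ofReal_mul]
    have hfd : ∀ u ∈ upperHalf, DifferentiableAt ℂ f u := by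
      intro u hu
      exact (hH.differentiableAt (isOpen_upperHalf.mem_nhds hu)).mul
        (((hWd u hu).const_mul _).neg.cexp)
    have hmax : ∀ η > 0, ‖f z‖ ≤ 1 + η := by
      intro η hη
      refine norm_le_of_eventually_frontier hDo
        (Metric.isBounded_ball.subset Set.inter_subset_left)
        (fun u hu => (hfd u hu.2).differentiableWithinAt) ?_ (z := z) ⟨by simpa using hR, hz⟩
      intro ζ hζ
      rw [frontier, hDo.interior_eq] at hζ
      have hζR : ‖ζ‖ ≤ R := by
        have := closure_mono (Set.inter_subset_left) hζ.1
        simpa using Metric.closure_ball_subset_closedBall this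
      have hζi : 0 ≤ ζ.im := by
        have h1 : closure upperHalf ⊆ {u : ℂ | 0 ≤ u.im} :=
          closure_minimal (fun u (hu : 0 < u.im) => hu.le)
            (isClosed_le continuous_const Complex.continuous_im)
        exact h1 (closure_mono (Set.inter_subset_right) hζ.1)
      -- The corners `±R` belong to the real case: the poles of `W` there do no harm, since only `Re
      -- W ≥ 0` and the boundary bound for `H` are used.
      rcases hζi.eq_or_lt with h0 | hpos
      · have hζe : ζ = (ζ.re : ℂ) := Complex.ext rfl (by simpa using h0.symm)
        rw [hζe]
        filter_upwards [nhdsWithin_mono _ (Set.inter_subset_right : D ⊆ upperHalf) (hbd ζ.re),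
          self_mem_nhdsWithin] with u hu huD
        have hu0 : 0 < u.im := huD.2
        have hre : 0 ≤ (W u).re := by rw [hWre]; positivity
        rw [hfn]
        calc ‖H u‖ * Real.exp (-(K * (W u).re)) ≤ 1 * 1 := by
              gcongr
              rw [Real.exp_le_one_iff]
              nlinarith [mul_nonneg hK0 hre]
          _ ≤ 1 + η := by linarith
      · have hζn : ‖ζ‖ = R := by
          refine le_antisymm hζR (not_lt.1 fun hlt => hζ.2 ⟨by simpa using hlt, hpos⟩)
        have hval : ‖f ζ‖ ≤ 1 := by
          have hq : ζ.re ^ 2 + ζ.im ^ 2 = R ^ 2 := by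
            rw [← hζn, Complex.sq_norm, Complex.normSq_apply]; ring
          have hWv : (W ζ).re = 1 / ζ.im := by
            have e1 : ‖ζ - (R : ℝ)‖ ^ 2 = 2 * R * (R - ζ.re) := by
              rw [Complex.sq_norm, Complex.normSq_apply]
              simp; nlinarith
            have e2 : ‖ζ - (-R : ℝ)‖ ^ 2 = 2 * R * (R + ζ.re) := by
              rw [Complex.sq_norm, Complex.normSq_apply]
              simp; nlinarith
            have p1 : R - ζ.re ≠ 0 := by
              intro h; nlinarith
            have p2 : R + ζ.re ≠ 0 := by
              intro h; nlinarith
            rw [hWre, e1, e2]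
            field_simp
            nlinarith
          have hg := hgrowth ζ hpos
          rw [hfn, hWv]
          calc ‖H ζ‖ * Real.exp (-(K * (1 / ζ.im)))
              ≤ Real.exp (C * ((1 + ‖ζ‖ ^ 2) / ζ.im)) * Real.exp (-(K * (1 / ζ.im))) := by gcongr
            _ = 1 := by
              rw [← Real.exp_add, hζn, hK, Real.exp_eq_one_iff]
              ring
        have hcont := (hfd ζ hpos).continuousAt.norm
        exact nhdsWithin_le_nhds ((hcont.eventually (gt_mem_nhds (by linarith : ‖f ζ‖ < 1 + η))).mono
          fun u hu => le_of_lt hu)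
    have hfz : ‖f z‖ ≤ 1 := le_of_forall_pos_le_add fun η hη => hmax η hη
    rw [hfn, Real.exp_neg, ← div_eq_mul_inv, div_le_one (Real.exp_pos _)] at hfz
    refine hfz.trans (Real.exp_le_exp.2 (mul_le_mul_of_nonneg_left ?_ hK0))
    have hd : 0 < R - ‖z‖ := by linarith
    have hlow : ∀ r : ℝ, |r| = R → z.im / ‖z - (r : ℝ)‖ ^ 2 ≤ z.im / (R - ‖z‖) ^ 2 := by
      intro r hr
      have h1 : R - ‖z‖ ≤ ‖z - (r : ℝ)‖ := by
        have := norm_sub_norm_le (r : ℂ) z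
        rw [norm_sub_rev, Complex.norm_real, Real.norm_eq_abs, hr] at this
        exact this
      gcongr
    rw [hWre]
    have h1 := hlow R (abs_of_pos hR0)
    have h2 := hlow (-R) (by rw [abs_neg, abs_of_pos hR0])
    have h3 : 2 * z.im / (R - ‖z‖) ^ 2 = z.im / (R - ‖z‖) ^ 2 + z.im / (R - ‖z‖) ^ 2 := by ring
    rw [h3]
    exact add_le_add h1 h2
  -- The limit `R → ∞`, written in `s = 1 / R` so that the bound becomes continuous at `0`.
  have hlim : Tendsto (fun s : ℝ => Real.exp (C * (s ^ 2 + 1) * (2 * z.im / (1 - ‖z‖ * s) ^ 2)))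
      (𝓝[>] 0) (𝓝 (Real.exp (2 * C * z.im))) := by
    have hc : ContinuousAt
        (fun s : ℝ => Real.exp (C * (s ^ 2 + 1) * (2 * z.im / (1 - ‖z‖ * s) ^ 2))) 0 := by
      refine Real.continuous_exp.continuousAt.comp (ContinuousAt.mul (by fun_prop) ?_)
      exact ContinuousAt.div (by fun_prop) (by fun_prop) (by simp)
    have h := hc.tendsto.mono_left (nhdsWithin_le_nhds (s := Set.Ioi 0))
    convert h using 3
    simp; ring
  refine ge_of_tendsto hlim ?_
  have hsmall : ∀ᶠ s : ℝ in 𝓝[>] 0, s * ‖z‖ < 1 := by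
    refine nhdsWithin_le_nhds (ContinuousAt.eventually_lt (f := fun s : ℝ => s * ‖z‖) (by fun_prop)
      continuousAt_const (by simp))
  filter_upwards [self_mem_nhdsWithin, hsmall] with s (hs : 0 < s) hsz
  have h := hstep s⁻¹ (by rw [← one_div, lt_div_iff₀ hs]; linarith)
  have h1 : 1 - ‖z‖ * s ≠ 0 := by nlinarith
  have h2 : s⁻¹ - ‖z‖ = (1 - ‖z‖ * s) / s := by field_simp
  have h3 : C * (1 + s⁻¹ ^ 2) * (2 * z.im / (s⁻¹ - ‖z‖) ^ 2) =
      C * (s ^ 2 + 1) * (2 * z.im / (1 - ‖z‖ * s) ^ 2) := by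
    rw [h2]; field_simp
  rwa [h3] at h

/-- The mean type removes the exponential. For `s > 0` the function `H(i(w + s)) exp(-s w)` on the
right half-plane is at most `exp(B s)` on the imaginary axis by the growth bound at height `s`. It
is bounded on the positive axis by the mean type hypothesis with `ε = s`. Phragmén-Lindelöf gives
`exp(B s)` throughout, and `s → 0` finishes. -/
theorem norm_le_one_of_exp_im {H : ℂ → ℂ} (hH : DifferentiableOn ℂ H upperHalf) {B : ℝ}
    (hB : 0 ≤ B) (hgrowth : ∀ z ∈ upperHalf, ‖H z‖ ≤ Real.exp (B * z.im))
    (hmt : ∀ ε > 0, ∀ᶠ y : ℝ in atTop, ‖H (Complex.I * y)‖ ≤ Real.exp (ε * y))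
    {z : ℂ} (hz : z ∈ upperHalf) : ‖H z‖ ≤ 1 := by
  have hzi : 0 < z.im := hz
  have hstep : ∀ s : ℝ, 0 < s → s < z.im → ‖H z‖ ≤ Real.exp (B * s + s * (z.im - s)) := by
    intro s hs hsz
    set f : ℂ → ℂ := fun w => H (Complex.I * (w + s)) * Complex.exp (-(s * w)) with hf
    have him : ∀ w : ℂ, (Complex.I * (w + s)).im = w.re + s := by intro w; simp
    have hfn : ∀ w, ‖f w‖ = ‖H (Complex.I * (w + s))‖ * Real.exp (-(s * w.re)) := by
      intro w
      simp only [hf, norm_mul, Complex.norm_exp, Complex.neg_re, Complex.re_ofReal_mul]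
    have hmem : ∀ w : ℂ, 0 ≤ w.re → Complex.I * (w + s) ∈ upperHalf := by
      intro w hw
      change 0 < (Complex.I * (w + s)).im
      rw [him]; linarith
    have hd : ∀ w : ℂ, 0 ≤ w.re → DifferentiableAt ℂ f w := by
      intro w hw
      refine DifferentiableAt.mul ?_ (by fun_prop)
      exact DifferentiableAt.comp (g := H) w
        (hH.differentiableAt (isOpen_upperHalf.mem_nhds (hmem w hw)))
        (by fun_prop : DifferentiableAt ℂ (fun w : ℂ => Complex.I * (w + s)) w)
    have hdc : DiffContOnCl ℂ f {w | 0 < w.re} := by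
      refine ⟨fun w (hw : 0 < w.re) => (hd w hw.le).differentiableWithinAt, fun w hw => ?_⟩
      rw [Complex.closure_setOfPred_lt_re] at hw
      exact (hd w hw).continuousAt.continuousWithinAt
    have hPL := PhragmenLindelof.right_half_plane_of_bounded_on_real (C := Real.exp (B * s)) hdc
      ⟨1, by norm_num, B, ?_⟩ ?_ ?_ (z := -Complex.I * z - s) ?_
    · rw [hfn] at hPL
      have e1 : Complex.I * (-Complex.I * z - s + s) = z := by
        rw [sub_add_cancel, ← mul_assoc]; simp
      have e2 : (-Complex.I * z - s).re = z.im - s := by simp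
      rw [e1, e2, Real.exp_neg, ← div_eq_mul_inv, div_le_iff₀ (Real.exp_pos _), ← Real.exp_add] at hPL
      exact hPL
    · refine Asymptotics.IsBigO.of_bound (Real.exp (B * s)) ?_
      refine eventually_inf_principal.2 (Eventually.of_forall fun w (hw : 0 < w.re) => ?_)
      rw [hfn, Real.rpow_one, Real.norm_eq_abs, Real.abs_exp, ← Real.exp_add]
      have h1 := hgrowth _ (hmem w hw.le)
      rw [him] at h1
      calc _ ≤ Real.exp (B * (w.re + s)) * 1 := by
            gcongr
            rw [Real.exp_le_one_iff]
            nlinarith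
        _ ≤ _ := by
            rw [mul_one, Real.exp_le_exp]
            have := Complex.re_le_norm w
            nlinarith
    · refine ⟨Real.exp (s * s), ?_⟩
      rw [eventually_map]
      have := (tendsto_atTop_add_const_right atTop s tendsto_id).eventually (hmt s hs)
      filter_upwards [this] with x hx
      rw [hfn]
      simp only [id, Complex.ofReal_add] at hx
      calc _ ≤ Real.exp (s * (x + s)) * Real.exp (-(s * x)) := by
            simp only [Complex.ofReal_re]; gcongr
        _ = Real.exp (s * s) := by rw [← Real.exp_add]; ring_nf
    · intro x
      rw [hfn]
      have h1 := hgrowth _ (hmem (x * Complex.I) (by simp))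
      rw [him] at h1
      simpa using h1
    · simp; linarith
  have hlim : Tendsto (fun s : ℝ => Real.exp (B * s + s * (z.im - s))) (𝓝[>] 0) (𝓝 1) := by
    have hc : ContinuousAt (fun s : ℝ => Real.exp (B * s + s * (z.im - s))) 0 := by fun_prop
    have h := hc.tendsto.mono_left (nhdsWithin_le_nhds (s := Set.Ioi 0))
    simpa using h
  refine ge_of_tendsto hlim ?_
  filter_upwards [self_mem_nhdsWithin, nhdsWithin_le_nhds (gt_mem_nhds hzi)] with s hs hsz
  exact hstep s hs hsz

end HalfPlaneEstimates


/-! ### From bounded type and mean type to a Hardy space bound. -/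

section BoundedType

/-- Functions analytic on the closed upper half-plane, square integrable on the real line, and
growing in the half-plane no faster than a function of the Hardy space `H²`. -/
structure IsHardy (h : ℂ → ℂ) : Prop where
  analyticAt : ∀ z : ℂ, 0 ≤ z.im → AnalyticAt ℂ h z
  integrable : Integrable (fun t : ℝ => ‖h t‖ ^ 2)
  bound : ∃ C : ℝ, ∀ z : ℂ, 0 < z.im → ‖h z‖ ^ 2 * z.im ≤ C

/-- The analytic function in the upper half-plane whose real part is `π` times the Poisson integral
of `m`. -/
noncomputable def schwarzIntegral (m : ℝ → ℝ) (z : ℂ) : ℂ :=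
  ∫ t : ℝ, (m t : ℂ) * (Complex.I / (z - t))

theorem im_le_norm_sub_ofReal (z : ℂ) (t : ℝ) : z.im ≤ ‖z - t‖ := by
  have := (le_abs_self _).trans (Complex.abs_im_le_norm (z - t))
  simpa using this

theorem sub_ofReal_ne_zero {z : ℂ} (hz : 0 < z.im) (t : ℝ) : z - (t : ℂ) ≠ 0 :=
  norm_pos_iff.1 (hz.trans_le (im_le_norm_sub_ofReal z t))

theorem norm_schwarz_integrand_le {m : ℝ → ℝ} (hm0 : ∀ t, 0 ≤ m t) {z : ℂ} (hz : 0 < z.im) (t : ℝ) :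
    ‖(m t : ℂ) * (Complex.I / (z - t))‖ ≤ m t * (1 / z.im) := by
  rw [norm_mul, norm_div, Complex.norm_I, Complex.norm_real, Real.norm_eq_abs, abs_of_nonneg (hm0 t)]
  have := im_le_norm_sub_ofReal z t
  have := hm0 t
  gcongr

theorem continuous_schwarz_integrand {m : ℝ → ℝ} (hmc : Continuous m) {z : ℂ} (hz : 0 < z.im) :
    Continuous fun t : ℝ => (m t : ℂ) * (Complex.I / (z - t)) :=
  (Complex.continuous_ofReal.comp hmc).mul
    (continuous_const.div (by fun_prop) fun t => sub_ofReal_ne_zero hz t)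

theorem integrable_schwarz {m : ℝ → ℝ} (hmc : Continuous m) (hm0 : ∀ t, 0 ≤ m t)
    (hmi : Integrable m) {z : ℂ} (hz : 0 < z.im) :
    Integrable fun t : ℝ => (m t : ℂ) * (Complex.I / (z - t)) :=
  (hmi.mul_const (1 / z.im)).mono' (continuous_schwarz_integrand hmc hz).aestronglyMeasurable
    (Eventually.of_forall fun t => norm_schwarz_integrand_le hm0 hz t)

theorem norm_schwarzIntegral_le {m : ℝ → ℝ} (hm0 : ∀ t, 0 ≤ m t)
    (hmi : Integrable m) {z : ℂ} (hz : 0 < z.im) :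
    ‖schwarzIntegral m z‖ ≤ (∫ t, m t) / z.im := by
  rw [div_eq_mul_one_div, ← integral_mul_const]
  exact norm_integral_le_of_norm_le (hmi.mul_const _)
    (Eventually.of_forall fun t => norm_schwarz_integrand_le hm0 hz t)

theorem differentiableOn_schwarzIntegral {m : ℝ → ℝ} (hmc : Continuous m) (hm0 : ∀ t, 0 ≤ m t)
    (hmi : Integrable m) : DifferentiableOn ℂ (schwarzIntegral m) upperHalf := by
  intro z₀ hz₀
  have h0 : 0 < z₀.im := hz₀
  have him : ∀ z ∈ Metric.ball z₀ (z₀.im / 2), z₀.im / 2 ≤ z.im := by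
    intro z hz
    have h1 := Complex.abs_im_le_norm (z - z₀)
    rw [Metric.mem_ball, dist_eq_norm] at hz
    have h2 := neg_abs_le (z - z₀).im
    rw [Complex.sub_im] at h1 h2
    linarith
  have key := hasDerivAt_integral_of_dominated_loc_of_deriv_le (𝕜 := ℂ) (μ := volume)
    (F := fun z (t : ℝ) => (m t : ℂ) * (Complex.I / (z - t)))
    (F' := fun z (t : ℝ) => (m t : ℂ) * (-Complex.I / (z - t) ^ 2))
    (x₀ := z₀) (s := Metric.ball z₀ (z₀.im / 2)) (bound := fun t => m t * (1 / (z₀.im / 2) ^ 2))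
    (Metric.ball_mem_nhds z₀ (by linarith)) ?_ (integrable_schwarz hmc hm0 hmi h0) ?_ ?_
    (hmi.mul_const _) ?_
  · exact key.2.differentiableAt.differentiableWithinAt
  · filter_upwards [Metric.ball_mem_nhds z₀ (by linarith : 0 < z₀.im / 2)] with z hz
    exact (continuous_schwarz_integrand hmc (by linarith [him z hz])).aestronglyMeasurable
  · exact ((Complex.continuous_ofReal.comp hmc).mul (continuous_const.div (by fun_prop)
      fun t => pow_ne_zero 2 (sub_ofReal_ne_zero h0 t))).aestronglyMeasurable
  · refine Eventually.of_forall fun t z hz => ?_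
    have h1 := (him z hz).trans (im_le_norm_sub_ofReal z t)
    have h2 := hm0 t
    rw [norm_mul, norm_div, norm_neg, Complex.norm_I, Complex.norm_real, Real.norm_eq_abs,
      abs_of_nonneg (hm0 t), norm_pow]
    gcongr
  · refine Eventually.of_forall fun t z hz => ?_
    have hz' : z - (t : ℂ) ≠ 0 := sub_ofReal_ne_zero (by linarith [him z hz]) t
    have := (((hasDerivAt_id z).sub_const (t : ℂ)).inv hz').const_mul Complex.I
    simpa [div_eq_mul_inv] using this.const_mul (m t : ℂ)

theorem re_schwarz_integrand (m : ℝ → ℝ) (z : ℂ) (t : ℝ) :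
    ((m t : ℂ) * (Complex.I / (z - t))).re = m t * (z.im / ‖z - t‖ ^ 2) := by
  rw [Complex.re_ofReal_mul, re_I_div_sub_ofReal]

theorem re_schwarzIntegral {m : ℝ → ℝ} (hmc : Continuous m) (hm0 : ∀ t, 0 ≤ m t)
    (hmi : Integrable m) {z : ℂ} (hz : 0 < z.im) :
    (schwarzIntegral m z).re = ∫ t : ℝ, m t * (z.im / ‖z - t‖ ^ 2) := by
  have := Complex.reCLM.integral_comp_comm (integrable_schwarz hmc hm0 hmi hz)
  simp only [Complex.reCLM_apply, re_schwarz_integrand] at this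
  exact this.symm

/-- On the interval `|t - Re z| ≤ Im z`, of length `2 Im z`, the kernel `Im z / |z - t|²` is at
least `1 / (2 Im z)`. This part of the integral already suffices, because the kernel has total mass
`π`. No approximate identity argument is needed to compare the integral with `m` near the boundary.
-/
theorem le_re_schwarzIntegral {m : ℝ → ℝ} (hmc : Continuous m) (hm0 : ∀ t, 0 ≤ m t)
    (hmi : Integrable m) {z : ℂ} (hz : 0 < z.im) {c : ℝ}
    (hc : ∀ t, |t - z.re| ≤ z.im → c ≤ m t) : c ≤ (schwarzIntegral m z).re := by
  have hi : Integrable fun t : ℝ => m t * (z.im / ‖z - t‖ ^ 2) := by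
    have := (integrable_schwarz hmc hm0 hmi hz).re
    simpa only [RCLike.re_to_complex, re_schwarz_integrand] using this
  have hnn : ∀ t : ℝ, 0 ≤ m t * (z.im / ‖z - t‖ ^ 2) := fun t => by
    have := hm0 t
    positivity
  rw [re_schwarzIntegral hmc hm0 hmi hz]
  rcases le_total c 0 with h0 | h0
  · exact h0.trans (integral_nonneg hnn)
  set S := Set.Icc (z.re - z.im) (z.re + z.im) with hS
  calc c = ∫ _ in S, c / (2 * z.im) := by
        rw [setIntegral_const, hS, Real.volume_real_Icc_of_le (by linarith), smul_eq_mul]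
        field_simp
        ring
    _ ≤ ∫ t in S, m t * (z.im / ‖z - t‖ ^ 2) := by
        refine setIntegral_mono_on (by simp [hS]) hi.integrableOn measurableSet_Icc fun t ht => ?_
        have ht1 : |t - z.re| ≤ z.im := by
          rw [abs_le]
          constructor <;> linarith [ht.1, ht.2]
        have h1 : ‖z - t‖ ^ 2 ≤ 2 * z.im ^ 2 := by
          have h2 := sq_le_sq' (abs_le.1 ht1).1 (abs_le.1 ht1).2
          rw [Complex.sq_norm, Complex.normSq_apply]
          simp only [Complex.sub_re, Complex.ofReal_re, Complex.sub_im, Complex.ofReal_im, sub_zero]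
          nlinarith
        have h3 : 0 < ‖z - t‖ := norm_pos_iff.2 (sub_ofReal_ne_zero hz t)
        have h4 : 1 / (2 * z.im) ≤ z.im / ‖z - t‖ ^ 2 := by
          rw [div_le_div_iff₀ (by positivity) (by positivity)]
          nlinarith
        rw [div_eq_mul_one_div]
        exact mul_le_mul (hc t ht1) h4 (by positivity) (hm0 t)
    _ ≤ _ := setIntegral_le_integral hi (Eventually.of_forall hnn)

theorem eventually_norm_le_exp_of_meanType_le {h : ℂ → ℂ} (hmt : meanType h ≤ 0) {ε : ℝ}
    (hε : 0 < ε) : ∀ᶠ y : ℝ in atTop, ‖h (Complex.I * y)‖ ≤ Real.exp (ε * y) := by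
  have hlt : meanType h < (ε : EReal) := hmt.trans_lt (by exact_mod_cast hε)
  filter_upwards [eventually_lt_of_limsup_lt hlt, eventually_gt_atTop 0] with y hy hy0
  have h1 : ENNReal.log ‖h (Complex.I * y)‖ₑ ≤ ((ε * y : ℝ) : EReal) := by
    rw [EReal.div_lt_iff (by exact_mod_cast hy0) (EReal.coe_ne_top y)] at hy
    exact_mod_cast hy.le
  rwa [← Real.log_exp (ε * y), ← ENNReal.log_ofReal_of_pos (Real.exp_pos _),
    ENNReal.log_le_log_iff, ← ofReal_norm, ENNReal.ofReal_le_ofReal_iff (Real.exp_pos _).le] at h1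

theorem meanType_le_zero_of_bounded {h : ℂ → ℂ} {C : ℝ} (hC : ∀ z ∈ upperHalf, ‖h z‖ ≤ C) :
    meanType h ≤ 0 := by
  refine le_of_forall_gt_imp_ge_of_dense fun a ha => ?_
  obtain ⟨r, hr0, hra⟩ := EReal.lt_iff_exists_real_btwn.1 ha
  have hr : 0 < r := by exact_mod_cast hr0
  refine le_trans (limsup_le_of_le (by isBoundedDefault) ?_) hra.le
  have hlim : Tendsto (fun y : ℝ => Real.exp (r * y)) atTop atTop :=
    Real.tendsto_exp_atTop.comp (tendsto_id.const_mul_atTop hr)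
  filter_upwards [hlim.eventually_ge_atTop C, eventually_gt_atTop 0] with y hy hy0
  have hyU : Complex.I * y ∈ upperHalf := by
    change 0 < (Complex.I * (y : ℂ)).im
    simpa using hy0
  rw [EReal.div_le_iff_le_mul (by exact_mod_cast hy0) (EReal.coe_ne_top y),
    ← EReal.coe_mul, mul_comm y r, ← Real.log_exp (r * y), ← ENNReal.log_ofReal_of_pos (Real.exp_pos _),
    ENNReal.log_le_log_iff, ← ofReal_norm]
  exact ENNReal.ofReal_le_ofReal ((hC _ hyU).trans hy)

/-- The pointwise estimate of the Hardy space for functions of bounded type and nonpositive mean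
type with square integrable boundary values. -/
theorem IsBoundedType.isHardy {h : ℂ → ℂ} (ha : ∀ z : ℂ, 0 ≤ z.im → AnalyticAt ℂ h z)
    (hi : Integrable (fun t : ℝ => ‖h t‖ ^ 2)) (hbt : IsBoundedType h) (hmt : meanType h ≤ 0) :
    IsHardy h := by
  have hd : ∀ z : ℂ, 0 ≤ z.im → DifferentiableAt ℂ h z := fun z hz => (ha z hz).differentiableAt
  obtain ⟨-, p, q, hp, hq, ⟨M₁, hM₁⟩, ⟨M₂, hM₂⟩, hq0, hpq⟩ := hbt
  set m : ℝ → ℝ := fun t => ‖h t‖ ^ 2 with hm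
  have hm0 : ∀ t, 0 ≤ m t := fun t => by positivity
  have hmc : Continuous m := by
    refine Continuous.pow (Continuous.norm ?_) 2
    exact continuous_iff_continuousAt.2 fun t =>
      ContinuousAt.comp (f := fun t : ℝ => (t : ℂ)) (hd t (by simp)).continuousAt
        Complex.continuous_ofReal.continuousAt
  set V := schwarzIntegral m with hV
  have hVd := differentiableOn_schwarzIntegral hmc hm0 hi
  have hVre : ∀ z ∈ upperHalf, 0 ≤ (V z).re := fun z hz =>
    le_re_schwarzIntegral hmc hm0 hi hz fun t _ => hm0 t
  -- The quotient `h² / (ε + V)` is shown to be bounded by one. Near a real `x`, continuity gives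
  -- `|h|² ≤ |h(x)|² + ε/2` and `Re V ≥ |h(x)|² - ε/2`. The summand `ε` absorbs both errors and
  -- keeps the denominator away from zero. Bounded type yields the growth bound and nonpositive mean
  -- type removes the remaining exponential.
  have hmain : ∀ ε : ℝ, 0 < ε → ∀ z ∈ upperHalf, ‖h z‖ ^ 2 ≤ ‖(ε : ℂ) + V z‖ := by
    intro ε hε
    have hlow : ∀ z ∈ upperHalf, ε + (V z).re ≤ ‖(ε : ℂ) + V z‖ := fun z hz => by
      simpa using Complex.re_le_norm ((ε : ℂ) + V z)
    have hpos : ∀ z ∈ upperHalf, ε ≤ ‖(ε : ℂ) + V z‖ := fun z hz => by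
      linarith [hlow z hz, hVre z hz]
    have hne : ∀ z ∈ upperHalf, (ε : ℂ) + V z ≠ 0 := fun z hz =>
      norm_pos_iff.1 (hε.trans_le (hpos z hz))
    set H : ℂ → ℂ := fun z => h z ^ 2 / ((ε : ℂ) + V z) with hH
    have hHn : ∀ z, ‖H z‖ = ‖h z‖ ^ 2 / ‖(ε : ℂ) + V z‖ := fun z => by
      rw [hH]; simp only [norm_div, norm_pow]
    have hHd : DifferentiableOn ℂ H upperHalf :=
      DifferentiableOn.div (fun z hz => ((hd z (le_of_lt hz)).pow 2).differentiableWithinAt)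
        (hVd.const_add _) hne
    obtain ⟨z₀, hz₀, hqz₀⟩ := hq0
    obtain ⟨C, hC0, hC⟩ := exists_norm_le_exp_of_mul_bounded hHd (hq.pow 2) (M₁ := M₂ ^ 2)
      (M₂ := M₁ ^ 2 / ε)
      (fun z hz => by
        have := hM₂ z hz
        rw [Pi.pow_apply, norm_pow]; gcongr)
      (fun z hz => by
        have h1 := hM₁ z hz
        have h2 := hpos z hz
        rw [Pi.pow_apply, hH]
        simp only
        rw [div_mul_eq_mul_div, ← mul_pow, hpq z hz, norm_div, norm_pow]
        gcongr) ⟨z₀, hz₀, by simpa using hqz₀⟩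
    have hbd : ∀ x : ℝ, ∀ᶠ z in 𝓝[upperHalf] (x : ℂ), ‖H z‖ ≤ 1 := by
      intro x
      have hη : 0 < ε / 2 := by linarith
      have hcont : ContinuousAt (fun z => ‖h z‖ ^ 2) (x : ℂ) :=
        ((hd x (by simp)).continuousAt.norm).pow 2
      have h1 : ∀ᶠ z in 𝓝 (x : ℂ), ‖h z‖ ^ 2 < ‖h x‖ ^ 2 + ε / 2 :=
        hcont.eventually (gt_mem_nhds (by linarith))
      obtain ⟨δ, hδ, hδm⟩ := Metric.continuousAt_iff.1 (hmc.continuousAt (x := x)) (ε / 2) hη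
      have h2 : Metric.ball (x : ℂ) (δ / 2) ∈ 𝓝 (x : ℂ) := Metric.ball_mem_nhds _ (by linarith)
      filter_upwards [nhdsWithin_le_nhds h1, nhdsWithin_le_nhds h2, self_mem_nhdsWithin]
        with z hz1 hz2 hzU
      rw [hHn, div_le_one (hε.trans_le (hpos z hzU))]
      refine le_trans ?_ (hlow z hzU)
      rw [Metric.mem_ball, dist_eq_norm] at hz2
      have hre : |z.re - x| < δ / 2 := by
        have := Complex.abs_re_le_norm (z - x)
        simp only [Complex.sub_re, Complex.ofReal_re] at this
        linarith
      have him : z.im < δ / 2 := (im_le_norm_sub_ofReal z x).trans_lt hz2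
      have h3 : ‖h x‖ ^ 2 - ε / 2 ≤ (V z).re := by
        refine le_re_schwarzIntegral hmc hm0 hi hzU fun t ht => ?_
        have h4 : dist t x < δ := by
          rw [Real.dist_eq]
          have := abs_sub_le t z.re x
          linarith
        have h5 := hδm h4
        rw [Real.dist_eq] at h5
        have := (abs_lt.1 h5).1
        simp only [hm] at this ⊢
        linarith
      linarith
    have hexp : ∀ z ∈ upperHalf, ‖H z‖ ≤ Real.exp (2 * C * z.im) := fun z hz =>
      norm_le_exp_im_of_boundary hHd hC0 hC hbd hz
    have hmtH : ∀ η > 0, ∀ᶠ y : ℝ in atTop, ‖H (Complex.I * y)‖ ≤ Real.exp (η * y) := by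
      intro η hη
      have h1 := eventually_norm_le_exp_of_meanType_le hmt (ε := η / 4) (by linarith)
      have h2 : ∀ᶠ y : ℝ in atTop, 1 / ε ≤ Real.exp (η / 2 * y) := by
        have : Tendsto (fun y : ℝ => Real.exp (η / 2 * y)) atTop atTop :=
          Real.tendsto_exp_atTop.comp (tendsto_id.const_mul_atTop (by linarith))
        exact this.eventually_ge_atTop _
      filter_upwards [h1, h2, eventually_gt_atTop 0] with y hy1 hy2 hy0
      have hyU : Complex.I * y ∈ upperHalf := by
        change 0 < (Complex.I * (y : ℂ)).im
        simpa using hy0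
      rw [hHn]
      have h3 := hpos _ hyU
      calc ‖h (Complex.I * y)‖ ^ 2 / ‖(ε : ℂ) + V (Complex.I * y)‖
          ≤ Real.exp (η / 4 * y) ^ 2 / ε := by gcongr
        _ = Real.exp (η / 2 * y) * (1 / ε) := by
            rw [← Real.exp_nat_mul, mul_one_div]
            congr 2
            push_cast; ring
        _ ≤ Real.exp (η / 2 * y) * Real.exp (η / 2 * y) := by gcongr
        _ = Real.exp (η * y) := by rw [← Real.exp_add]; ring_nf
    intro z hz
    have h1 := norm_le_one_of_exp_im hHd (by positivity) hexp hmtH hz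
    rwa [hHn, div_le_one (hε.trans_le (hpos z hz))] at h1
  refine ⟨ha, hi, ∫ t, m t, fun z hz => ?_⟩
  have hle : ‖h z‖ ^ 2 ≤ ‖V z‖ := by
    refine le_of_forall_pos_le_add fun ε hε => (hmain ε hε z hz).trans ?_
    refine (norm_add_le _ _).trans ?_
    rw [Complex.norm_real, Real.norm_eq_abs, abs_of_pos hε, add_comm]
  rw [← le_div_iff₀ hz]
  exact hle.trans (norm_schwarzIntegral_le hm0 hi hz)

end BoundedType


/-! ### Cauchy's theorem and integral formula for Hardy functions. -/

section CauchyFormula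

theorem AnalyticAt.dslope' {u : ℂ → ℂ} {w z : ℂ} (hw : AnalyticAt ℂ u w) (hz : AnalyticAt ℂ u z) :
    AnalyticAt ℂ (dslope u w) z := by
  rw [Complex.analyticAt_iff_eventually_differentiableAt] at *
  by_cases hzw : z = w
  · subst hzw
    have hS : {y | DifferentiableAt ℂ u y} ∈ 𝓝 z := hw
    obtain ⟨U, hU, hUo, hzU⟩ := _root_.mem_nhds_iff.1 hS
    have hd : DifferentiableOn ℂ (dslope u z) U :=
      (Complex.differentiableOn_dslope (hUo.mem_nhds hzU)).2
        fun y hy => (hU hy).differentiableWithinAt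
    exact hd.eventually_differentiableAt (hUo.mem_nhds hzU)
  · filter_upwards [hz, isOpen_ne.mem_nhds hzw] with y hy hyw
    exact (differentiableAt_dslope_of_ne hyw).2 hy

/-- Cauchy's theorem for the upper half-plane. -/
theorem integral_eq_zero_of_decay {k : ℂ → ℂ} (hd : ∀ z : ℂ, 0 ≤ z.im → DifferentiableAt ℂ k z)
    (hi : Integrable fun t : ℝ => k t) {C R₀ : ℝ}
    (hb : ∀ z : ℂ, 0 < z.im → R₀ ≤ ‖z‖ → ‖k z‖ ^ 2 * (‖z‖ ^ 2 * z.im) ≤ C) :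
    ∫ t : ℝ, k t = 0 := by
  set S := Real.sqrt (max C 0) with hS
  have hS0 : 0 ≤ S := Real.sqrt_nonneg _
  -- The singularity `(Im z) ^ (-1/2)` at the real axis is integrable along the vertical sides of
  -- the rectangle `[-R, R] × [0, R]`, so each of the three upper sides contributes `O(R ^ (-1/2))`.
  have hk : ∀ R : ℝ, 0 < R → R₀ ≤ R → ∀ z : ℂ, 0 < z.im → R ≤ ‖z‖ →
      ‖k z‖ ≤ S / R * z.im ^ (-(1 / 2) : ℝ) := by
    intro R hR hR0 z hz hRz
    have h1 := (hb z hz (hR0.trans hRz)).trans (le_max_left C 0)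
    have h2 : ‖k z‖ ^ 2 * (R ^ 2 * z.im) ≤ max C 0 := by
      refine le_trans ?_ h1
      gcongr
    rw [Real.rpow_neg hz.le, ← Real.sqrt_eq_rpow, ← div_eq_mul_inv, div_div, le_div_iff₀ (by positivity)]
    apply Real.le_sqrt_of_sq_le
    rwa [mul_pow, mul_pow, Real.sq_sqrt hz.le]
  have hstep : ∀ R : ℝ, 0 < R → R₀ ≤ R → ‖∫ t : ℝ in -R..R, k t‖ ≤ 6 * S * R ^ (-(1 / 2) : ℝ) := by
    intro R hR hR0
    have hrect := Complex.integral_boundary_rect_eq_zero_of_differentiableOn k (-R : ℝ)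
      ((R : ℂ) + R * Complex.I) (fun z hz => by
        refine (hd z ?_).differentiableWithinAt
        have h2 := hz.2
        simp only [Complex.ofReal_im, Complex.add_im, Complex.mul_I_im, Complex.ofReal_re, zero_add,
          Set.mem_preimage, Set.uIcc_of_le hR.le] at h2
        exact h2.1)
    simp only [Complex.ofReal_re, Complex.ofReal_im, Complex.add_re, Complex.mul_I_re, neg_zero,
      add_zero, Complex.add_im, Complex.mul_I_im, zero_add, Complex.ofReal_zero, zero_mul] at hrect
    have htop : ‖∫ x : ℝ in -R..R, k (x + R * Complex.I)‖ ≤ 2 * S * R ^ (-(1 / 2) : ℝ) := by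
      have := intervalIntegral.norm_integral_le_of_norm_le_const (a := -R) (b := R)
        (f := fun x : ℝ => k (x + R * Complex.I)) (C := S / R * R ^ (-(1 / 2) : ℝ)) fun x _ => by
          have him : ((x : ℂ) + R * Complex.I).im = R := by simp
          have := hk R hR hR0 (x + R * Complex.I) (by rw [him]; exact hR) (by
            have := (le_abs_self _).trans (Complex.abs_im_le_norm ((x : ℂ) + R * Complex.I))
            rwa [him] at this)
          rwa [him] at this
      refine this.trans (le_of_eq ?_)
      rw [abs_of_pos (by linarith)]
      field_simp; ring
    have hside : ∀ r : ℝ, |r| = R →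
        ‖∫ y : ℝ in (0 : ℝ)..R, k (r + y * Complex.I)‖ ≤ 2 * S * R ^ (-(1 / 2) : ℝ) := by
      intro r hr
      have hii : IntervalIntegrable (fun y : ℝ => S / R * y ^ (-(1 / 2) : ℝ)) volume 0 R :=
        (intervalIntegral.intervalIntegrable_rpow' (by norm_num)).const_mul _
      have := intervalIntegral.norm_integral_le_of_norm_le (f := fun y : ℝ => k (r + y * Complex.I))
        hR.le (Eventually.of_forall fun y hy => ?_) hii
      · refine this.trans (le_of_eq ?_)
        rw [intervalIntegral.integral_const_mul, integral_rpow (Or.inl (by norm_num))]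
        have h0 : (-(1 / 2) + 1 : ℝ) = 1 / 2 := by norm_num
        have h1 : (1 / 2 : ℝ) = -(1 / 2) + 1 := by norm_num
        rw [h0, Real.zero_rpow (by norm_num)]
        nth_rewrite 1 [h1]
        rw [Real.rpow_add hR, Real.rpow_one]
        field_simp; ring
      · have him : ((r : ℂ) + y * Complex.I).im = y := by simp
        have := hk R hR hR0 (r + y * Complex.I) (by rw [him]; exact hy.1) (by
            have := Complex.abs_re_le_norm ((r : ℂ) + y * Complex.I)
            simpa [hr] using this)
        rwa [him] at this
    have h1 := hside R (abs_of_pos hR)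
    have h2 := hside (-R) (by rw [abs_neg, abs_of_pos hR])
    have heq : (∫ t : ℝ in -R..R, k t) = (∫ x : ℝ in -R..R, k (x + R * Complex.I)) -
        Complex.I • (∫ y : ℝ in (0 : ℝ)..R, k (R + y * Complex.I)) +
        Complex.I • (∫ y : ℝ in (0 : ℝ)..R, k ((-R : ℝ) + y * Complex.I)) := by
      linear_combination hrect
    rw [heq]
    refine (norm_add_le _ _).trans ((add_le_add (norm_sub_le _ _) le_rfl).trans ?_)
    rw [norm_smul, norm_smul, Complex.norm_I, one_mul, one_mul]
    linarith
  have hl1 : Tendsto (fun R : ℝ => ∫ t : ℝ in -R..R, k t) atTop (𝓝 (∫ t : ℝ, k t)) :=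
    intervalIntegral_tendsto_integral hi tendsto_neg_atTop_atBot tendsto_id
  have hl2 : Tendsto (fun R : ℝ => 6 * S * R ^ (-(1 / 2) : ℝ)) atTop (𝓝 0) := by
    simpa using (tendsto_rpow_neg_atTop (by norm_num : (0 : ℝ) < 1 / 2)).const_mul (6 * S)
  refine tendsto_nhds_unique hl1 (squeeze_zero_norm' ?_ hl2)
  filter_upwards [eventually_gt_atTop 0, eventually_ge_atTop R₀] with R h1 h2
  exact hstep R h1 h2

theorem integrable_inv_one_add_sub_sq (x : ℝ) : Integrable fun t : ℝ => (1 + (t - x) ^ 2)⁻¹ :=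
  integrable_inv_one_add_sq.comp_sub_right x

theorem isCompact_closedBall_inter (w : ℂ) (r : ℝ) :
    IsCompact (Metric.closedBall w r ∩ {z : ℂ | 0 ≤ z.im}) :=
  (isCompact_closedBall w r).inter_right (isClosed_le continuous_const Complex.continuous_im)

theorem exists_norm_le_of_analyticAt {k : ℂ → ℂ} (hk : ∀ z : ℂ, 0 ≤ z.im → AnalyticAt ℂ k z)
    (w : ℂ) : ∃ M : ℝ, 0 ≤ M ∧ ∀ z : ℂ, 0 ≤ z.im → ‖z - w‖ ≤ 1 → ‖k z‖ ≤ M := by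
  obtain ⟨M, hM⟩ := (isCompact_closedBall_inter w 1).exists_bound_of_continuousOn (f := k)
    fun z hz => (hk z hz.2).continuousAt.continuousWithinAt
  refine ⟨max M 0, le_max_right _ _, fun z hz hzw => (hM z ⟨?_, hz⟩).trans (le_max_left _ _)⟩
  rwa [Metric.mem_closedBall, dist_eq_norm]

theorem continuous_comp_ofReal {k : ℂ → ℂ} (hk : ∀ z : ℂ, 0 ≤ z.im → AnalyticAt ℂ k z) :
    Continuous fun t : ℝ => k t :=
  continuous_iff_continuousAt.2 fun t =>
    ContinuousAt.comp (f := fun t : ℝ => (t : ℂ)) (hk t (by simp)).continuousAt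
      Complex.continuous_ofReal.continuousAt

theorem sq_sub_re_le (w : ℂ) (t : ℝ) : (t - w.re) ^ 2 ≤ ‖(t : ℂ) - w‖ ^ 2 := by
  rw [Complex.sq_norm, Complex.normSq_apply]
  simp only [Complex.sub_re, Complex.ofReal_re]
  nlinarith [mul_self_nonneg ((t : ℂ) - w).im]

/-- Analytic functions decaying like `1 / |z|` in the half-plane belong to the Hardy space. -/
theorem IsHardy.of_decay {h : ℂ → ℂ} (ha : ∀ z : ℂ, 0 ≤ z.im → AnalyticAt ℂ h z) (w : ℂ) {C : ℝ}
    (hC : ∀ z : ℂ, 0 ≤ z.im → ‖h z‖ * ‖z - w‖ ≤ C) : IsHardy h := by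
  obtain ⟨M, hM0, hM⟩ := exists_norm_le_of_analyticAt ha w
  have hkey : ∀ z : ℂ, 0 ≤ z.im → ‖h z‖ ^ 2 * (1 + ‖z - w‖ ^ 2) ≤ 2 * (M ^ 2 + C ^ 2) := by
    intro z hz
    have h1 := hC z hz
    have h2 : (‖h z‖ * ‖z - w‖) ^ 2 ≤ C ^ 2 := by gcongr
    rw [mul_pow] at h2
    rcases le_total ‖z - w‖ 1 with hle | hle
    · have h3 : ‖h z‖ ^ 2 ≤ M ^ 2 := by
        have := hM z hz hle
        gcongr
      nlinarith [sq_nonneg C]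
    · have h3 : ‖h z‖ ^ 2 ≤ ‖h z‖ ^ 2 * ‖z - w‖ ^ 2 :=
        le_mul_of_one_le_right (by positivity) (one_le_pow₀ hle)
      nlinarith [sq_nonneg M]
  refine ⟨ha, ?_, 2 * (M ^ 2 + C ^ 2) * (1 + |w.im|), fun z hz => ?_⟩
  · refine ((integrable_inv_one_add_sub_sq w.re).const_mul (2 * (M ^ 2 + C ^ 2))).mono'
      ((continuous_comp_ofReal ha).norm.pow 2).aestronglyMeasurable
      (Eventually.of_forall fun t => ?_)
    have h1 := hkey t (by simp)
    have h2 := sq_sub_re_le w t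
    rw [Real.norm_eq_abs, abs_of_nonneg (by positivity), ← div_eq_mul_inv,
      le_div_iff₀ (by positivity)]
    refine le_trans ?_ h1
    gcongr
  · have h1 := hkey z hz.le
    have h2 : z.im ≤ (1 + ‖z - w‖ ^ 2) * (1 + |w.im|) := by
      have h3 := (le_abs_self _).trans (Complex.abs_im_le_norm (z - w))
      rw [Complex.sub_im] at h3
      have h4 := le_abs_self w.im
      nlinarith [norm_nonneg (z - w), sq_nonneg (‖z - w‖ - 1), abs_nonneg w.im,
        mul_nonneg (sq_nonneg ‖z - w‖) (abs_nonneg w.im)]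
    calc ‖h z‖ ^ 2 * z.im ≤ ‖h z‖ ^ 2 * ((1 + ‖z - w‖ ^ 2) * (1 + |w.im|)) := by gcongr
      _ = ‖h z‖ ^ 2 * (1 + ‖z - w‖ ^ 2) * (1 + |w.im|) := by ring
      _ ≤ _ := by gcongr

theorem IsHardy.add {f g : ℂ → ℂ} (hf : IsHardy f) (hg : IsHardy g) :
    IsHardy fun z => f z + g z := by
  have hn : ∀ z, ‖f z + g z‖ ^ 2 ≤ 2 * ‖f z‖ ^ 2 + 2 * ‖g z‖ ^ 2 := fun z => by
    have := norm_add_le (f z) (g z)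
    nlinarith [norm_nonneg (f z + g z), sq_nonneg (‖f z‖ - ‖g z‖)]
  have ha : ∀ z : ℂ, 0 ≤ z.im → AnalyticAt ℂ (fun z => f z + g z) z :=
    fun z hz => (hf.analyticAt z hz).add (hg.analyticAt z hz)
  obtain ⟨C₁, h₁⟩ := hf.bound
  obtain ⟨C₂, h₂⟩ := hg.bound
  refine ⟨ha, ?_, 2 * C₁ + 2 * C₂, fun z hz => ?_⟩
  · refine ((hf.integrable.const_mul 2).add (hg.integrable.const_mul 2)).mono'
      ((continuous_comp_ofReal ha).norm.pow 2).aestronglyMeasurable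
      (Eventually.of_forall fun t => ?_)
    rw [Real.norm_eq_abs, abs_of_nonneg (by positivity)]
    exact hn t
  · nlinarith [hn z, h₁ z hz, h₂ z hz]

theorem IsHardy.const_mul {f : ℂ → ℂ} (hf : IsHardy f) (c : ℂ) : IsHardy fun z => c * f z := by
  obtain ⟨C, h⟩ := hf.bound
  refine ⟨fun z hz => analyticAt_const.mul (hf.analyticAt z hz), ?_, ‖c‖ ^ 2 * C, fun z hz => ?_⟩
  · simpa only [norm_mul, mul_pow] using hf.integrable.const_mul (‖c‖ ^ 2)
  · rw [norm_mul, mul_pow, mul_assoc]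
    exact mul_le_mul_of_nonneg_left (h z hz) (by positivity)

theorem IsHardy.congr {f g : ℂ → ℂ} (hf : IsHardy f) (h : ∀ z, f z = g z) : IsHardy g := by
  rwa [funext h] at hf

theorem IsHardy.sub {f g : ℂ → ℂ} (hf : IsHardy f) (hg : IsHardy g) :
    IsHardy fun z => f z - g z :=
  (hf.add (hg.const_mul (-1))).congr fun z => by ring

theorem isHardy_inv_sub_conj {w : ℂ} (hw : 0 < w.im) : IsHardy fun z => 1 / (z - conj w) := by
  have hne : ∀ z : ℂ, 0 ≤ z.im → z - conj w ≠ 0 := fun z hz => sub_conj_ne_zero hw hz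
  refine IsHardy.of_decay (fun z hz => analyticAt_const.div (by fun_prop) (hne z hz)) (conj w)
    (C := 1) fun z hz => ?_
  rw [norm_div, norm_one, one_div, inv_mul_cancel₀ (norm_ne_zero_iff.2 (hne z hz))]

/-- If `u` is a Hardy function and `k = u / (z - w)` is analytic, then the integral of `k` over the
real line vanishes. -/
theorem IsHardy.integral_div_eq_zero {u k : ℂ → ℂ} (hu : IsHardy u) {w : ℂ}
    (hk : ∀ z : ℂ, 0 ≤ z.im → AnalyticAt ℂ k z)
    (hku : ∀ z : ℂ, 0 ≤ z.im → z ≠ w → (z - w) * k z = u z) :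
    Integrable (fun t : ℝ => k t) ∧ ∫ t : ℝ, k t = 0 := by
  obtain ⟨M, hM0, hM⟩ := exists_norm_le_of_analyticAt hk w
  have hnk : ∀ z : ℂ, 0 ≤ z.im → z ≠ w → ‖z - w‖ * ‖k z‖ = ‖u z‖ := fun z hz hzw => by
    rw [← norm_mul, hku z hz hzw]
  have hi : Integrable fun t : ℝ => k t := by
    refine (hu.integrable.add ((integrable_inv_one_add_sub_sq w.re).const_mul
      (2 + (1 + (1 + |w.im|) ^ 2) * M))).mono' (continuous_comp_ofReal hk).aestronglyMeasurable
      (Eventually.of_forall fun t => ?_)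
    simp only [Pi.add_apply]
    have hden : (0 : ℝ) < 1 + (t - w.re) ^ 2 := by positivity
    have hsq := sq_sub_re_le w t
    rcases le_total ‖(t : ℂ) - w‖ 1 with hle | hle
    · have h1 := hM t (by simp) hle
      have h2 : 1 ≤ (1 + (1 + |w.im|) ^ 2) * (1 + (t - w.re) ^ 2)⁻¹ := by
        rw [← div_eq_mul_inv, one_le_div hden]
        nlinarith [abs_nonneg w.im, norm_nonneg ((t : ℂ) - w)]
      have h3 : M ≤ (1 + (1 + |w.im|) ^ 2) * M * (1 + (t - w.re) ^ 2)⁻¹ := by nlinarith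
      have h4 : 0 ≤ (1 + (t - w.re) ^ 2)⁻¹ := by positivity
      nlinarith [sq_nonneg ‖u t‖]
    · have htw : (t : ℂ) ≠ w := by
        intro h; rw [h, sub_self, norm_zero] at hle; linarith
      have h1 := hnk t (by simp) htw
      set d := ‖(t : ℂ) - w‖ with hd
      have h2 : 1 / d ^ 2 ≤ 2 * (1 + (t - w.re) ^ 2)⁻¹ := by
        rw [← div_eq_mul_inv, div_le_div_iff₀ (by positivity) hden]
        nlinarith
      have h3 : ‖k t‖ = ‖u t‖ * (1 / d) := by
        rw [← h1]; field_simp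
      have h4 : ‖u t‖ * (1 / d) ≤ ‖u t‖ ^ 2 + 1 / d ^ 2 := by
        have : 1 / d ^ 2 = (1 / d) ^ 2 := by rw [div_pow, one_pow]
        rw [this]
        nlinarith [sq_nonneg (‖u t‖ - 1 / d), norm_nonneg (u t), (by positivity : 0 ≤ 1 / d)]
      have h5 : 0 ≤ (1 + (1 + |w.im|) ^ 2) * M * (1 + (t - w.re) ^ 2)⁻¹ := by positivity
      rw [h3]
      nlinarith
  refine ⟨hi, ?_⟩
  -- For `‖z‖ ≥ 2 ‖w‖ + 1` one has `‖z‖ ≤ 2 ‖z - w‖`, so the bound for `u` passes to `k` with the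
  -- factor `4`.
  obtain ⟨C, hC⟩ := hu.bound
  refine integral_eq_zero_of_decay (fun z hz => (hk z hz).differentiableAt) hi (C := 4 * C)
    (R₀ := 2 * ‖w‖ + 1) fun z hz hzR => ?_
  have hlow : ‖z‖ ≤ 2 * ‖z - w‖ := by
    have := norm_sub_norm_le z w
    linarith
  have hzw : z ≠ w := by
    rintro rfl
    rw [sub_self, norm_zero] at hlow
    linarith [norm_nonneg z]
  have h1 := hnk z hz.le hzw
  calc ‖k z‖ ^ 2 * (‖z‖ ^ 2 * z.im) ≤ ‖k z‖ ^ 2 * ((2 * ‖z - w‖) ^ 2 * z.im) := by gcongr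
    _ = 4 * (‖u z‖ ^ 2 * z.im) := by rw [← h1]; ring
    _ ≤ 4 * C := by linarith [hC z hz]

theorem integral_one_div_sq_add_sq (x : ℝ) {v : ℝ} (hv : 0 < v) :
    ∫ t : ℝ, 1 / ((t - x) ^ 2 + v ^ 2) = Real.pi / v := by
  rw [integral_sub_right_eq_self (fun t : ℝ => 1 / (t ^ 2 + v ^ 2)) x]
  have h := Measure.integral_comp_mul_left (fun t : ℝ => 1 / (t ^ 2 + v ^ 2)) v
  have h2 : ∀ t : ℝ, 1 / ((v * t) ^ 2 + v ^ 2) = (1 / v ^ 2) * (1 + t ^ 2)⁻¹ := fun t => by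
    have : (0 : ℝ) < 1 + t ^ 2 := by positivity
    have : (0 : ℝ) < (v * t) ^ 2 + v ^ 2 := by positivity
    field_simp; ring
  simp only [h2, integral_const_mul, integral_univ_inv_one_add_sq, smul_eq_mul,
    abs_of_pos (inv_pos.2 hv)] at h
  field_simp at h
  field_simp
  linarith

theorem integrable_one_div_sq_add_sq (x : ℝ) {v : ℝ} (hv : 0 < v) :
    Integrable fun t : ℝ => 1 / ((t - x) ^ 2 + v ^ 2) := by
  by_contra h
  have h1 := integral_one_div_sq_add_sq x hv
  rw [integral_undef h] at h1
  exact absurd h1 (by positivity)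

theorem norm_ofReal_sub_sq (t : ℝ) (w : ℂ) :
    ‖(t : ℂ) - w‖ ^ 2 = (t - w.re) ^ 2 + w.im ^ 2 := by
  rw [Complex.sq_norm, Complex.normSq_apply]
  simp; ring

/-- Cauchy's integral formula for Hardy functions, with the Poisson kernel. -/
theorem IsHardy.integral_div_sub {h : ℂ → ℂ} (hh : IsHardy h) {w : ℂ} (hw : 0 < w.im) :
    Integrable (fun t : ℝ => h t / (t - w)) ∧
      ∫ t : ℝ, h t / (t - w) = 2 * Real.pi * Complex.I * h w := by
  have hne : ∀ t : ℝ, (t : ℂ) - w ≠ 0 := fun t => by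
    rw [← neg_sub]; exact neg_ne_zero.2 (sub_ofReal_ne_zero hw t)
  -- A multiple of `1 / (z - conj w)` is subtracted to create a zero at `w`. What it adds back to
  -- the integrand is a Poisson kernel, whose integral produces the value at `w`.
  have hu : IsHardy fun z => h z - h w * (w - conj w) * (1 / (z - conj w)) :=
    hh.sub ((isHardy_inv_sub_conj hw).const_mul _)
  set u : ℂ → ℂ := fun z => h z - h w * (w - conj w) * (1 / (z - conj w)) with hu'
  have hww : w - conj w ≠ 0 := sub_conj_ne_zero hw hw.le
  have huw : u w = 0 := by
    simp only [hu']; field_simp; simp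
  obtain ⟨hi, h0⟩ := hu.integral_div_eq_zero (k := dslope u w) (w := w)
    (fun z hz => AnalyticAt.dslope' (hu.analyticAt w hw.le) (hu.analyticAt z hz))
    (fun z _ _ => sub_smul_dslope_of_zero huw z)
  have hpt : ∀ t : ℝ, h t / (t - w) = dslope u w t +
      h w * (2 * w.im * Complex.I) * ((1 / ((t - w.re) ^ 2 + w.im ^ 2) : ℝ) : ℂ) := by
    intro t
    have h1 : ((t : ℂ) - w) * dslope u w t = u t := sub_smul_dslope_of_zero huw (t : ℂ)
    have h2 : (((t - w.re) ^ 2 + w.im ^ 2 : ℝ) : ℂ) = (t - w) * (t - conj w) := by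
      rw [← norm_ofReal_sub_sq, ← Complex.normSq_eq_norm_sq, ← Complex.mul_conj]; simp
    have h3 : (t : ℂ) - conj w ≠ 0 := sub_conj_ne_zero hw (by simp)
    have h4 : w - conj w = 2 * w.im * Complex.I := by
      apply Complex.ext <;> simp; ring
    rw [Complex.ofReal_div, h2, div_eq_iff (hne t), add_mul, mul_comm _ ((t : ℂ) - w), h1, hu', ← h4]
    have := hne t
    field_simp
    simp
  have hi2 : Integrable fun t : ℝ => ((1 / ((t - w.re) ^ 2 + w.im ^ 2) : ℝ) : ℂ) :=
    (integrable_one_div_sq_add_sq w.re hw).ofReal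
  refine ⟨?_, ?_⟩
  · simp only [hpt]
    exact hi.add (hi2.const_mul _)
  · simp only [hpt]
    rw [integral_add hi (hi2.const_mul _), h0, integral_const_mul, zero_add]
    have : (∫ t : ℝ, ((1 / ((t - w.re) ^ 2 + w.im ^ 2) : ℝ) : ℂ)) = ((Real.pi / w.im : ℝ) : ℂ) := by
      rw [← integral_one_div_sq_add_sq w.re hw]
      exact integral_ofReal
    rw [this]
    have : (w.im : ℂ) ≠ 0 := by exact_mod_cast hw.ne'
    push_cast
    field_simp

/-- Cauchy's formula together with the weighted inequality `p q ≤ (a/2) p² + q²/(2a)`, with `a = 1 /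
(|h(w)| Im w)` chosen so that the kernel term uses only a quarter of the left side. The anonymous
constant of `IsHardy.bound` becomes the squared norm, which is what makes the bound stable under
limits. -/
theorem IsHardy.norm_sq_mul_im_le {h : ℂ → ℂ} (hh : IsHardy h) {w : ℂ} (hw : 0 < w.im) :
    ‖h w‖ ^ 2 * w.im ≤ ∫ t : ℝ, ‖h t‖ ^ 2 := by
  have hN : 0 ≤ ∫ t : ℝ, ‖h t‖ ^ 2 := integral_nonneg fun t => by positivity
  rcases (norm_nonneg (h w)).eq_or_lt with h0 | hpos
  · simpa [← h0] using hN
  set s := ‖h w‖ with hs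
  obtain ⟨-, hc⟩ := hh.integral_div_sub hw
  set a := 1 / (s * w.im) with ha
  have ha0 : 0 < a := by positivity
  have hpt : ∀ t : ℝ, ‖h t / (t - w)‖ ≤
      a / 2 * ‖h t‖ ^ 2 + 1 / (2 * a) * (1 / ((t - w.re) ^ 2 + w.im ^ 2)) := by
    intro t
    have hd : 0 < ‖(t : ℂ) - w‖ := by
      rw [norm_sub_rev]; exact norm_pos_iff.2 (sub_ofReal_ne_zero hw t)
    rw [← norm_ofReal_sub_sq, norm_div]
    set d := ‖(t : ℂ) - w‖
    have h1 : a / 2 * ‖h t‖ ^ 2 + 1 / (2 * a) * (1 / d ^ 2) - ‖h t‖ / d =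
        (a * ‖h t‖ - 1 / d) ^ 2 / (2 * a) := by field_simp; ring
    have h2 : 0 ≤ (a * ‖h t‖ - 1 / d) ^ 2 / (2 * a) := by positivity
    linarith
  have hi2 := integrable_one_div_sq_add_sq w.re hw
  have hle := norm_integral_le_of_norm_le ((hh.integrable.const_mul (a / 2)).add
    (hi2.const_mul (1 / (2 * a)))) (Eventually.of_forall hpt)
  simp only [Pi.add_apply] at hle
  rw [hc, integral_add (hh.integrable.const_mul _) (hi2.const_mul _), integral_const_mul,
    integral_const_mul, integral_one_div_sq_add_sq _ hw] at hle
  have hn : ‖2 * (Real.pi : ℂ) * Complex.I * h w‖ = 2 * Real.pi * s := by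
    rw [norm_mul, norm_mul, norm_mul, Complex.norm_I, Complex.norm_real, Real.norm_eq_abs,
      abs_of_pos Real.pi_pos]
    simp [hs]
  rw [hn, ha] at hle
  have h3 : 1 / (2 * (1 / (s * w.im))) * (Real.pi / w.im) = Real.pi * s / 2 := by field_simp
  rw [h3] at hle
  have h4 : 3 * Real.pi * s / 2 ≤ 1 / (s * w.im) / 2 * ∫ t : ℝ, ‖h t‖ ^ 2 := by linarith
  have h5 : 1 / (s * w.im) / 2 * (∫ t : ℝ, ‖h t‖ ^ 2) = (∫ t : ℝ, ‖h t‖ ^ 2) / (2 * (s * w.im)) := by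
    field_simp
  rw [h5, le_div_iff₀ (by positivity)] at h4
  have hq : 0 ≤ s ^ 2 * w.im := by positivity
  nlinarith [Real.pi_gt_three]

end CauchyFormula


/-! ### De Branges spaces through Hardy functions, and the reproducing property at real points. -/

section ReproducingKernel

/-- Hermite-Biehler functions without real zeros, in the form used below. -/
structure IsRegularHB (G : ℂ → ℂ) : Prop where
  differentiable : Differentiable ℂ G
  ne_zero : ∀ z : ℂ, 0 ≤ z.im → G z ≠ 0
  norm_lt : ∀ z : ℂ, 0 < z.im → ‖sharp G z‖ < ‖G z‖

theorem IsHermiteBiehler.isRegularHB {G : ℂ → ℂ} (hG : IsHermiteBiehler G)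
    (h0 : ∀ x : ℝ, G x ≠ 0) : IsRegularHB G := by
  have hlt : ∀ z : ℂ, 0 < z.im → ‖sharp G z‖ < ‖G z‖ := fun z hz => by
    simpa only [sharp, Complex.norm_conj] using hG.norm_lt z hz
  refine ⟨hG.entire, fun z hz => ?_, hlt⟩
  rcases hz.eq_or_lt with h | h
  · have : z = (z.re : ℂ) := Complex.ext rfl (by simpa using h.symm)
    rw [this]; exact h0 _
  · exact norm_pos_iff.1 ((norm_nonneg _).trans_lt (hlt z h))

theorem sharp_sharp (f : ℂ → ℂ) : sharp (sharp f) = f := by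
  funext z; simp [sharp]

theorem sharp_ofReal (f : ℂ → ℂ) (x : ℝ) : sharp f x = conj (f x) := by
  simp [sharp]

theorem sharp_mul (f g : ℂ → ℂ) : sharp (fun z => f z * g z) = fun z => sharp f z * sharp g z := by
  funext z; simp [sharp]

theorem differentiable_sharp {f : ℂ → ℂ} (hf : Differentiable ℂ f) : Differentiable ℂ (sharp f) := by
  intro z
  have h := DifferentiableAt.conj_conj (hf (conj z))
  rw [Complex.conj_conj] at h
  exact h

theorem IsRegularHB.norm_sharp_le {G : ℂ → ℂ} (hG : IsRegularHB G) (z : ℂ) (hz : 0 ≤ z.im) :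
    ‖sharp G z‖ ≤ ‖G z‖ := by
  rcases hz.eq_or_lt with h | h
  · have : z = (z.re : ℂ) := Complex.ext rfl (by simpa using h.symm)
    rw [this, sharp_ofReal, Complex.norm_conj]
  · exact (hG.norm_lt z h).le

theorem IsRegularHB.analyticAt_div {G f : ℂ → ℂ} (hG : IsRegularHB G) (hf : Differentiable ℂ f)
    (z : ℂ) (hz : 0 ≤ z.im) : AnalyticAt ℂ (fun z => f z / G z) z :=
  (hf.analyticAt z).div (hG.differentiable.analyticAt z) (hG.ne_zero z hz)

/-- Elements of the de Branges space of `G`, described by Hardy-space conditions. -/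
structure MemDB (G g : ℂ → ℂ) : Prop where
  differentiable : Differentiable ℂ g
  left : IsHardy fun z => g z / G z
  right : IsHardy fun z => sharp g z / G z

theorem norm_sharp_div_ofReal (G g : ℂ → ℂ) (t : ℝ) :
    ‖sharp g t / G t‖ = ‖g t / G t‖ := by
  rw [norm_div, norm_div, sharp_ofReal, Complex.norm_conj]

/-- Only this inclusion is needed in general. The converse is used just for kernel functions, in
`IsRegularHB.kernel_mem_space`. -/
theorem IsRegularHB.memDB_of_mem_space {G f : ℂ → ℂ} (hG : IsRegularHB G) (hf : f ∈ space G) :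
    MemDB G f := by
  obtain ⟨hd, hi, ⟨hb₁, hm₁⟩, hb₂, hm₂⟩ := hf
  refine ⟨hd, hb₁.isHardy (hG.analyticAt_div hd) hi hm₁,
    hb₂.isHardy (hG.analyticAt_div (differentiable_sharp hd)) ?_ hm₂⟩
  simpa only [norm_sharp_div_ofReal] using hi

theorem MemDB.sharp {G g : ℂ → ℂ} (hg : MemDB G g) : MemDB G (sharp g) :=
  ⟨differentiable_sharp hg.differentiable, hg.right, by rw [sharp_sharp]; exact hg.left⟩

theorem MemDB.add {G f g : ℂ → ℂ} (hf : MemDB G f) (hg : MemDB G g) :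
    MemDB G fun z => f z + g z :=
  ⟨hf.differentiable.add hg.differentiable, (hf.left.add hg.left).congr fun z => by ring,
    (hf.right.add hg.right).congr fun z => by simp only [DeBranges.sharp, map_add]; ring⟩

theorem MemDB.const_mul {G f : ℂ → ℂ} (hf : MemDB G f) (c : ℂ) :
    MemDB G fun z => c * f z :=
  ⟨hf.differentiable.const_mul c, (hf.left.const_mul c).congr fun z => by ring,
    (hf.right.const_mul (conj c)).congr fun z => by simp only [DeBranges.sharp, map_mul]; ring⟩

theorem integral_two_I_mul_one_div_sq_add_one (x : ℝ) :
    ∫ t : ℝ, ((2 * Complex.I * ((1 / ((t - x) ^ 2 + 1 ^ 2) : ℝ) : ℂ))) = 2 * Real.pi * Complex.I := by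
  rw [integral_const_mul]
  have : (∫ t : ℝ, ((1 / ((t - x) ^ 2 + 1 ^ 2) : ℝ) : ℂ)) = ((Real.pi / 1 : ℝ) : ℂ) := by
    rw [← integral_one_div_sq_add_sq x one_pos]
    exact integral_ofReal
  rw [this]
  push_cast; ring

/-- The numerator of the reproducing kernel at a real point. -/
noncomputable def kernelNum (G : ℂ → ℂ) (x : ℝ) (z : ℂ) : ℂ :=
  conj (G x) * G z - G x * sharp G z

theorem kernelNum_self (G : ℂ → ℂ) (x : ℝ) : kernelNum G x x = 0 := by
  rw [kernelNum, sharp_ofReal, mul_comm, sub_self]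

/-- Written as a divided slope, the kernel is visibly entire and its diagonal value is a derivative,
so the case distinction in the definition disappears. -/
theorem kernel_ofReal (G : ℂ → ℂ) (x : ℝ) (z : ℂ) :
    kernel G x z = -dslope (kernelNum G x) x z / (2 * Real.pi * Complex.I) := by
  have hpi : (2 * (Real.pi : ℂ) * Complex.I) ≠ 0 := Complex.two_pi_I_ne_zero
  rw [kernel, Complex.conj_ofReal]
  by_cases h : z = (x : ℂ)
  · rw [if_pos h, h, dslope_same]
    rfl
  · have h1 : (x : ℂ) - z ≠ 0 := sub_ne_zero.2 (Ne.symm h)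
    have h2 := sub_smul_dslope_of_zero (kernelNum_self G x) z
    rw [smul_eq_mul] at h2
    rw [if_neg h, div_eq_div_iff (mul_ne_zero hpi h1) hpi]
    change kernelNum G x z * _ = _
    rw [← h2]; ring

theorem differentiable_kernelNum {G : ℂ → ℂ} (hG : Differentiable ℂ G) (x : ℝ) :
    Differentiable ℂ (kernelNum G x) :=
  (hG.const_mul _).sub ((differentiable_sharp hG).const_mul _)

theorem differentiable_kernel {G : ℂ → ℂ} (hG : Differentiable ℂ G) (x : ℝ) :
    Differentiable ℂ (kernel G x) := by
  have h : Differentiable ℂ (dslope (kernelNum G x) x) := fun z =>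
    (AnalyticAt.dslope' ((differentiable_kernelNum hG x).analyticAt _)
      ((differentiable_kernelNum hG x).analyticAt z)).differentiableAt
  have h2 : kernel G x = fun z => -dslope (kernelNum G x) x z / (2 * Real.pi * Complex.I) :=
    funext fun z => kernel_ofReal G x z
  rw [h2]
  exact h.neg.div_const _

theorem kernel_mul (G : ℂ → ℂ) (x : ℝ) (z : ℂ) :
    kernel G x z * (2 * Real.pi * Complex.I * (x - z)) = kernelNum G x z := by
  have h2 := sub_smul_dslope_of_zero (kernelNum_self G x) z
  rw [smul_eq_mul] at h2
  rw [kernel_ofReal, ← h2, ← mul_assoc, div_mul_cancel₀ _ Complex.two_pi_I_ne_zero]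
  ring

theorem sharp_kernelNum (G : ℂ → ℂ) (x : ℝ) (z : ℂ) :
    sharp (kernelNum G x) z = -kernelNum G x z := by
  simp only [sharp, kernelNum, map_sub, map_mul, Complex.conj_conj]
  ring

/-- For a real base point the kernel is real on the real axis, so the two half-plane conditions on
it coincide. -/
theorem sharp_kernel {G : ℂ → ℂ} (hG : Differentiable ℂ G) (x : ℝ) :
    sharp (kernel G x) = kernel G x := by
  refine Continuous.ext_on (dense_compl_singleton (x : ℂ))
    (differentiable_sharp (differentiable_kernel hG x)).continuous
    (differentiable_kernel hG x).continuous fun z hz => ?_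
  have h1 : (x : ℂ) - z ≠ 0 := sub_ne_zero.2 (Ne.symm hz)
  have h2 : (2 * (Real.pi : ℂ) * Complex.I * (x - z)) ≠ 0 := mul_ne_zero Complex.two_pi_I_ne_zero h1
  apply mul_right_cancel₀ h2
  rw [kernel_mul]
  have h3 := congrArg conj (kernel_mul G x (conj z))
  have h4 := sharp_kernelNum G x z
  simp only [sharp] at h4
  rw [h4] at h3
  simp only [map_mul, map_sub, Complex.conj_conj, Complex.conj_ofReal, Complex.conj_I,
    map_ofNat] at h3
  simp only [sharp]
  linear_combination -h3

theorem IsRegularHB.norm_kernel_div_mul_le {G : ℂ → ℂ} (hG : IsRegularHB G) (x : ℝ) (z : ℂ)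
    (hz : 0 ≤ z.im) : ‖kernel G x z / G z‖ * ‖z - x‖ ≤ ‖G x‖ := by
  have h0 : 0 < ‖G z‖ := norm_pos_iff.2 (hG.ne_zero z hz)
  have h1 := congrArg norm (kernel_mul G x z)
  have h2 : ‖kernelNum G x z‖ ≤ 2 * ‖G x‖ * ‖G z‖ := by
    refine (norm_sub_le _ _).trans ?_
    rw [norm_mul, norm_mul, Complex.norm_conj]
    have := hG.norm_sharp_le z hz
    nlinarith [norm_nonneg (G x)]
  rw [norm_mul, norm_mul, norm_sub_rev, norm_mul, norm_mul, Complex.norm_I, Complex.norm_real,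
    Real.norm_eq_abs, abs_of_pos Real.pi_pos] at h1
  simp only [Complex.norm_ofNat, mul_one] at h1
  rw [norm_div, div_mul_eq_mul_div, div_le_iff₀ h0]
  have := Real.pi_gt_three
  have h3 : 0 ≤ ‖kernel G x z‖ * ‖z - x‖ := by positivity
  nlinarith

theorem IsRegularHB.memDB_kernel {G : ℂ → ℂ} (hG : IsRegularHB G) (x : ℝ) :
    MemDB G (kernel G x) := by
  have h : IsHardy fun z => kernel G x z / G z :=
    IsHardy.of_decay (hG.analyticAt_div (differentiable_kernel hG.differentiable x)) x
      (hG.norm_kernel_div_mul_le x)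
  exact ⟨differentiable_kernel hG.differentiable x, h, by rwa [sharp_kernel hG.differentiable]⟩

/-- The equivalence of norms is assumed on `space` and will be tested on kernels. The quotient by
`G` is bounded, near `x` by compactness and elsewhere by decay, so it has bounded type with
denominator `1`. -/
theorem IsRegularHB.kernel_mem_space {G : ℂ → ℂ} (hG : IsRegularHB G) (x : ℝ) :
    kernel G x ∈ space G := by
  have hdb := hG.memDB_kernel x
  obtain ⟨M, hM0, hM⟩ := exists_norm_le_of_analyticAt hdb.left.analyticAt x
  have hbd : ∀ z ∈ upperHalf, ‖kernel G x z / G z‖ ≤ max M ‖G x‖ := by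
    intro z (hz : 0 < z.im)
    rcases le_total ‖z - x‖ 1 with h | h
    · exact (hM z hz.le h).trans (le_max_left _ _)
    · refine le_trans ?_ ((hG.norm_kernel_div_mul_le x z hz.le).trans (le_max_right _ _))
      exact le_mul_of_one_le_right (norm_nonneg _) h
  have hd : DifferentiableOn ℂ (fun z => kernel G x z / G z) upperHalf := fun z hz =>
    (hdb.left.analyticAt z (le_of_lt hz)).differentiableAt.differentiableWithinAt
  have hbt : IsBoundedType (fun z => kernel G x z / G z) ∧
      meanType (fun z => kernel G x z / G z) ≤ 0 :=
    ⟨⟨hd, fun z => kernel G x z / G z, fun _ => 1, hd, differentiableOn_const _,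
      ⟨_, hbd⟩, ⟨1, fun z _ => by simp⟩, ⟨Complex.I, by simp [upperHalf], one_ne_zero⟩,
      fun z _ => mul_one _⟩, meanType_le_zero_of_bounded hbd⟩
  exact ⟨hdb.differentiable, hdb.left.integrable, hbt, by rwa [sharp_kernel hG.differentiable]⟩

/-- The reproducing property at real points. -/
theorem IsRegularHB.integral_conj_kernel_mul {G g : ℂ → ℂ} (hG : IsRegularHB G) (hg : MemDB G g)
    (x : ℝ) : ∫ t : ℝ, conj (kernel G x t / G t) * (g t / G t) = g x := by
  have hGx : G x ≠ 0 := hG.ne_zero x (by simp)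
  have hne : ∀ z : ℂ, 0 ≤ z.im → z - x + Complex.I ≠ 0 := by
    intro z hz h
    have := congrArg Complex.im h
    simp at this
    linarith
  -- The integrand is `1 / (2πi (t - x))` times `G(x) g / G - conj (G(x)) g / conj G`. The first
  -- term extends analytically above the axis and the second is the conjugate of such a function.
  -- Each alone has a pole at `x`, removed by subtracting `g(x) i / (t - x + i)` and its conjugate
  -- counterpart. The two corrections combine to a Poisson kernel for the point `x + i`, which
  -- yields `g(x)`.
  have hb : IsHardy fun z => Complex.I / (z - x + Complex.I) := by
    refine ((isHardy_inv_sub_conj (w := x + Complex.I) (by simp)).const_mul Complex.I).congr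
      fun z => ?_
    have : z - conj ((x : ℂ) + Complex.I) = z - x + Complex.I := by simp; ring
    rw [this, mul_one_div]
  have hu₁ : IsHardy fun z => G x * (g z / G z) - g x * (Complex.I / (z - x + Complex.I)) :=
    (hg.left.const_mul _).sub (hb.const_mul _)
  have hu₂ : IsHardy fun z => G x * (sharp g z / G z) -
      conj (g x) * (Complex.I / (z - x + Complex.I)) :=
    (hg.right.const_mul _).sub (hb.const_mul _)
  set u₁ : ℂ → ℂ := fun z => G x * (g z / G z) - g x * (Complex.I / (z - x + Complex.I)) with hu₁'
  set u₂ : ℂ → ℂ := fun z => G x * (sharp g z / G z) -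
      conj (g x) * (Complex.I / (z - x + Complex.I)) with hu₂'
  have hz₁ : u₁ x = 0 := by
    simp only [hu₁', sub_self, zero_add, div_self Complex.I_ne_zero]
    field_simp; simp
  have hz₂ : u₂ x = 0 := by
    simp only [hu₂', sub_self, zero_add, div_self Complex.I_ne_zero, sharp_ofReal]
    field_simp; simp
  obtain ⟨hi₁, h₁⟩ := hu₁.integral_div_eq_zero (k := dslope u₁ x) (w := x)
    (fun z hz => AnalyticAt.dslope' (hu₁.analyticAt x (by simp)) (hu₁.analyticAt z hz))
    (fun z _ _ => sub_smul_dslope_of_zero hz₁ z)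
  obtain ⟨hi₂, h₂⟩ := hu₂.integral_div_eq_zero (k := dslope u₂ x) (w := x)
    (fun z hz => AnalyticAt.dslope' (hu₂.analyticAt x (by simp)) (hu₂.analyticAt z hz))
    (fun z _ _ => sub_smul_dslope_of_zero hz₂ z)
  have hi₂c : Integrable fun t : ℝ => conj (dslope u₂ x t) :=
    (Complex.conjLIE.integrable_comp_iff).2 hi₂
  have h₂c : ∫ t : ℝ, conj (dslope u₂ x t) = 0 := by
    rw [integral_conj, h₂, map_zero]
  have hi₃ : Integrable fun t : ℝ =>
      g x * (2 * Complex.I * ((1 / ((t - x) ^ 2 + 1 ^ 2) : ℝ) : ℂ)) :=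
    (((integrable_one_div_sq_add_sq x one_pos).ofReal).const_mul (2 * Complex.I)).const_mul (g x)
  have hae : (fun t : ℝ => conj (kernel G x t / G t) * (g t / G t)) =ᵐ[volume]
      fun t : ℝ => 1 / (2 * Real.pi * Complex.I) * (dslope u₁ x t - conj (dslope u₂ x t) +
        g x * (2 * Complex.I * ((1 / ((t - x) ^ 2 + 1 ^ 2) : ℝ) : ℂ))) := by
    have hx : ∀ᵐ t : ℝ, t ≠ x := by simp [ae_iff, measure_singleton]
    filter_upwards [hx] with t ht
    have hs : (t : ℂ) - x ≠ 0 := sub_ne_zero.2 (by exact_mod_cast ht)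
    have hA : G t ≠ 0 := hG.ne_zero t (by simp)
    have hB : conj (G t) ≠ 0 := (map_ne_zero _).2 hA
    have hsI : (t : ℂ) - x + Complex.I ≠ 0 := hne t (by simp)
    have hsI' : (t : ℂ) - x - Complex.I ≠ 0 := by
      have := (map_ne_zero (starRingEnd ℂ)).2 hsI
      simpa [sub_eq_add_neg] using this
    have e₁ : ((t : ℂ) - x) * dslope u₁ x t =
        G x * (g t / G t) - g x * (Complex.I / (t - x + Complex.I)) :=
      sub_smul_dslope_of_zero hz₁ (t : ℂ)
    have e₂ : ((t : ℂ) - x) * conj (dslope u₂ x t) =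
        conj (G x) * (g t / conj (G t)) + g x * (Complex.I / (t - x - Complex.I)) := by
      have h := congrArg conj (sub_smul_dslope_of_zero hz₂ (t : ℂ))
      simp only [hu₂', smul_eq_mul, map_mul, map_sub, map_div₀, map_add, Complex.conj_ofReal,
        Complex.conj_I, sharp_ofReal, Complex.conj_conj] at h
      rw [h]
      ring
    have e₃ : conj (kernel G x t) * (2 * Real.pi * Complex.I * (t - x)) =
        G x * conj (G t) - conj (G x) * G t := by
      have h := congrArg conj (kernel_mul G x (t : ℂ))
      simp only [kernelNum, map_mul, map_sub, Complex.conj_ofReal,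
        Complex.conj_I, sharp_ofReal, Complex.conj_conj, map_ofNat] at h
      rw [← h]; ring
    have e₄ : ((t : ℂ) - x) * (2 * Complex.I * ((1 / ((t - x) ^ 2 + 1 ^ 2) : ℝ) : ℂ)) =
        Complex.I / (t - x + Complex.I) + Complex.I / (t - x - Complex.I) := by
      have h : (((t - x) ^ 2 + 1 ^ 2 : ℝ) : ℂ) = (t - x + Complex.I) * (t - x - Complex.I) := by
        push_cast
        ring_nf
        rw [Complex.I_sq]; ring
      rw [Complex.ofReal_div, h]
      field_simp
      simp; ring
    apply mul_left_cancel₀ (mul_ne_zero Complex.two_pi_I_ne_zero hs)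
    calc 2 * Real.pi * Complex.I * (t - x) * (conj (kernel G x t / G t) * (g t / G t))
        = (conj (kernel G x t) * (2 * Real.pi * Complex.I * (t - x))) / conj (G t) *
            (g t / G t) := by rw [map_div₀]; ring
      _ = G x * (g t / G t) - conj (G x) * (g t / conj (G t)) := by
          rw [e₃]; field_simp
      _ = (t - x) * dslope u₁ x t - (t - x) * conj (dslope u₂ x t) + g x * ((t - x) *
            (2 * Complex.I * ((1 / ((t - x) ^ 2 + 1 ^ 2) : ℝ) : ℂ))) := by
          rw [e₁, e₂, e₄]; ring
      _ = _ := by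
          have := Complex.two_pi_I_ne_zero
          field_simp
  have hsub : Integrable fun t : ℝ => dslope u₁ x t - conj (dslope u₂ x t) := hi₁.sub hi₂c
  rw [integral_congr_ae hae, integral_const_mul, integral_add hsub hi₃,
    integral_sub hi₁ hi₂c, h₁, h₂c, integral_const_mul, integral_two_I_mul_one_div_sq_add_one]
  field_simp
  simp

end ReproducingKernel


/-! ### Growth estimates for entire functions. -/

section Entire

/-- On the circle `ρ² = z conj z`, so `z² - ρ² = z (z - conj z)`. This polynomial is a multiplier
that compensates a blow-up at the real axis while staying large near the centre. -/
theorem norm_sq_sub_sq_of_norm_eq {z : ℂ} {ρ : ℝ} (hz : ‖z‖ = ρ) :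
    ‖z ^ 2 - (ρ : ℂ) ^ 2‖ = 2 * ρ * |z.im| := by
  have h1 : (ρ : ℂ) ^ 2 = z * conj z := by
    rw [Complex.mul_conj, Complex.normSq_eq_norm_sq, hz]; push_cast; rfl
  have h2 : z - conj z = 2 * z.im * Complex.I := by
    apply Complex.ext <;> simp; ring
  rw [h1, sq, ← mul_sub, h2, norm_mul, hz]
  simp; ring

/-- Bounds on a circle which blow up near the real axis can still be transferred inside. -/
theorem norm_sq_mul_le_of_sphere {u : ℂ → ℂ} (hu : Differentiable ℂ u) {ρ B : ℝ} (hρ : 0 < ρ)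
    (p : ℕ) (h : ∀ z : ℂ, ‖z‖ = ρ → ‖u z‖ ^ 2 * ((2 * ρ * |z.im|) ^ p) ^ 2 ≤ B) {z : ℂ}
    (hz : ‖z‖ ≤ ρ / 2) : ‖u z‖ ^ 2 * ((3 * ρ ^ 2 / 4) ^ p) ^ 2 ≤ B := by
  have hB : 0 ≤ B := le_trans (by positivity) (h ρ (by simp [abs_of_pos hρ]))
  have hd : Differentiable ℂ fun z => u z * (z ^ 2 - (ρ : ℂ) ^ 2) ^ p := by fun_prop
  have h1 := Complex.norm_le_of_forall_mem_frontier_norm_le (U := Metric.ball 0 ρ)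
    Metric.isBounded_ball hd.diffContOnCl (C := Real.sqrt B) (fun w hw => ?_) (z := z)
    (subset_closure (by simp; linarith))
  · have h2 : 3 * ρ ^ 2 / 4 ≤ ‖z ^ 2 - (ρ : ℂ) ^ 2‖ := by
      have h3 := norm_sub_norm_le ((ρ : ℂ) ^ 2) (z ^ 2)
      rw [norm_sub_rev, norm_pow, norm_pow, Complex.norm_real, Real.norm_eq_abs, sq_abs] at h3
      nlinarith [norm_nonneg z]
    have h3 := Real.sq_sqrt hB
    calc ‖u z‖ ^ 2 * ((3 * ρ ^ 2 / 4) ^ p) ^ 2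
        ≤ ‖u z‖ ^ 2 * (‖z ^ 2 - (ρ : ℂ) ^ 2‖ ^ p) ^ 2 := by gcongr
      _ = ‖u z * (z ^ 2 - (ρ : ℂ) ^ 2) ^ p‖ ^ 2 := by rw [norm_mul, norm_pow, mul_pow]
      _ ≤ Real.sqrt B ^ 2 := by gcongr
      _ = B := h3
  · rw [frontier_ball _ hρ.ne'] at hw
    have hw' : ‖w‖ = ρ := by simpa using hw
    apply Real.le_sqrt_of_sq_le
    rw [norm_mul, norm_pow, mul_pow, norm_sq_sub_sq_of_norm_eq hw']
    exact h w hw'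

/-- An entire function `u` with `‖u‖² ≤ K ρ` on discs of large radius `ρ / 2` is constant. -/
theorem eq_const_of_norm_sq_le {u : ℂ → ℂ} (hu : Differentiable ℂ u) {K : ℝ}
    (h : ∀ ρ : ℝ, 1 ≤ ρ → ∀ z : ℂ, ‖z‖ ≤ ρ / 2 → ‖u z‖ ^ 2 ≤ K * ρ) (z : ℂ) : u z = u 0 := by
  have hK : 0 ≤ K := by
    have := h 1 le_rfl 0 (by simp)
    nlinarith [sq_nonneg ‖u 0‖]
  refine is_const_of_deriv_eq_zero hu (fun w => ?_) z 0
  have hlim : Tendsto (fun ρ : ℝ => Real.sqrt K * 4 * ρ ^ (-(1 / 2) : ℝ)) atTop (𝓝 0) := by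
    simpa using (tendsto_rpow_neg_atTop (by norm_num : (0 : ℝ) < 1 / 2)).const_mul (Real.sqrt K * 4)
  rw [← norm_le_zero_iff]
  refine ge_of_tendsto hlim ?_
  filter_upwards [eventually_ge_atTop 1, eventually_ge_atTop (4 * ‖w‖)] with ρ h1 h2
  have hρ : 0 < ρ := by linarith
  -- For `‖w‖ ≤ ρ / 4` the disc of radius `ρ / 4` about `w` stays in `‖z‖ ≤ ρ / 2`, and Cauchy's
  -- estimate gives `O(ρ ^ (-1/2))`.
  have hd := Complex.norm_deriv_le_of_forall_mem_sphere_norm_le (c := w) (R := ρ / 4)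
    (C := Real.sqrt (K * ρ)) (by linarith) hu.diffContOnCl fun y hy => by
      rw [mem_sphere_iff_norm] at hy
      apply Real.le_sqrt_of_sq_le
      refine h ρ h1 y ?_
      have := norm_add_le (y - w) w
      rw [sub_add_cancel] at this
      linarith
  refine hd.trans (le_of_eq ?_)
  have h3 : ρ ^ (-(1 / 2) : ℝ) = Real.sqrt ρ / ρ := by
    rw [Real.rpow_neg hρ.le, ← Real.sqrt_eq_rpow]
    have := Real.mul_self_sqrt hρ.le
    have h4 : Real.sqrt ρ ≠ 0 := (Real.sqrt_pos.2 hρ).ne'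
    field_simp
    linarith
  rw [h3, Real.sqrt_mul hK]
  field_simp

end Entire

/-! ### Bounded point evaluations and completeness. -/

section Completeness

theorem normSq_nonneg (G g : ℂ → ℂ) : 0 ≤ normSq G g :=
  integral_nonneg fun t => by positivity

theorem normSq_sharp (G g : ℂ → ℂ) : normSq G (sharp g) = normSq G g := by
  simp only [normSq, norm_sharp_div_ofReal]

theorem MemDB.norm_sq_mul_im_le {G g : ℂ → ℂ} (hg : MemDB G g) {z : ℂ} (hz : 0 < z.im) :
    ‖g z / G z‖ ^ 2 * z.im ≤ normSq G g :=
  hg.left.norm_sq_mul_im_le hz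

theorem norm_sharp_conj (g : ℂ → ℂ) (z : ℂ) : ‖sharp g (conj z)‖ = ‖g z‖ := by
  simp [sharp]

/-- The lower half-plane is reached by applying the upper bound to `g*`, which has the same norm. -/
theorem IsRegularHB.norm_sq_mul_abs_im_le {G g : ℂ → ℂ} (hG : IsRegularHB G) (hg : MemDB G g)
    {z : ℂ} {M : ℝ} (hM : ‖G z‖ ≤ M) (hM' : ‖G (conj z)‖ ≤ M) :
    ‖g z‖ ^ 2 * |z.im| ≤ M ^ 2 * normSq G g := by
  have key : ∀ g : ℂ → ℂ, MemDB G g → ∀ z : ℂ, 0 < z.im → ‖G z‖ ≤ M →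
      ‖g z‖ ^ 2 * z.im ≤ M ^ 2 * normSq G g := by
    intro g hg z hz hGM
    have h0 : G z ≠ 0 := hG.ne_zero z hz.le
    have h1 := hg.norm_sq_mul_im_le hz
    calc ‖g z‖ ^ 2 * z.im = ‖G z‖ ^ 2 * (‖g z / G z‖ ^ 2 * z.im) := by
          rw [norm_div]
          have := norm_ne_zero_iff.2 h0
          field_simp
      _ ≤ M ^ 2 * normSq G g := by
          gcongr
  rcases lt_trichotomy z.im 0 with h | h | h
  · have := key (sharp g) hg.sharp (conj z) (by simpa using h) hM'
    rw [norm_sharp_conj, normSq_sharp, Complex.conj_im] at this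
    rwa [abs_of_neg h]
  · rw [h, abs_zero, mul_zero]
    exact mul_nonneg (sq_nonneg M) (normSq_nonneg G g)
  · rw [abs_of_pos h]
    exact key g hg z h hM

/-- Point evaluations are bounded, locally uniformly. -/
theorem IsRegularHB.exists_norm_sq_le {G : ℂ → ℂ} (hG : IsRegularHB G) {R : ℝ} (hR : 0 < R) :
    ∃ C : ℝ, 0 ≤ C ∧ ∀ g, MemDB G g → ∀ z : ℂ, ‖z‖ ≤ R → ‖g z‖ ^ 2 ≤ C * normSq G g := by
  obtain ⟨M, hM⟩ := (isCompact_closedBall (0 : ℂ) (2 * R)).exists_bound_of_continuousOn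
    hG.differentiable.continuous.continuousOn
  refine ⟨4 * (2 * R) ^ 3 * M ^ 2 / (3 * (2 * R) ^ 2 / 4) ^ 2, by positivity, fun g hg z hz => ?_⟩
  have h := norm_sq_mul_le_of_sphere hg.differentiable (ρ := 2 * R)
    (B := 4 * (2 * R) ^ 3 * M ^ 2 * normSq G g) (by positivity) 1 (fun w hw => ?_) (z := z) (by linarith)
  · rw [pow_one] at h
    rw [div_mul_eq_mul_div, le_div_iff₀ (by positivity)]
    exact h
  · have h1 := hG.norm_sq_mul_abs_im_le hg (hM w (by simp [hw]))
      (hM (conj w) (by simp [hw]))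
    have h2 : |w.im| ≤ 2 * R := hw ▸ Complex.abs_im_le_norm w
    calc ‖g w‖ ^ 2 * ((2 * (2 * R) * |w.im|) ^ 1) ^ 2
        = 4 * (2 * R) ^ 2 * |w.im| * (‖g w‖ ^ 2 * |w.im|) := by ring
      _ ≤ 4 * (2 * R) ^ 2 * (2 * R) * (M ^ 2 * normSq G g) := by gcongr
      _ = _ := by ring

/-- The Hilbert space `L²(ℝ)`. -/
noncomputable abbrev L2R := Lp ℂ 2 (volume : Measure ℝ)

theorem IsHardy.memLp {h : ℂ → ℂ} (hh : IsHardy h) : MemLp (fun t : ℝ => h t) 2 volume :=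
  (memLp_two_iff_integrable_sq_norm
    (continuous_comp_ofReal hh.analyticAt).aestronglyMeasurable).2 hh.integrable

theorem inner_toLp {f g : ℝ → ℂ} (hf : MemLp f 2 volume) (hg : MemLp g 2 volume) :
    inner ℂ (hf.toLp f) (hg.toLp g) = ∫ t, conj (f t) * g t := by
  rw [L2.inner_def]
  refine integral_congr_ae ?_
  filter_upwards [hf.coeFn_toLp, hg.coeFn_toLp] with t h1 h2
  rw [h1, h2, RCLike.inner_apply, mul_comm]

theorem norm_toLp_sq {f : ℝ → ℂ} (hf : MemLp f 2 volume) :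
    ‖hf.toLp f‖ ^ 2 = ∫ t, ‖f t‖ ^ 2 := by
  have h := inner_self_eq_norm_sq_to_K (𝕜 := ℂ) (hf.toLp f)
  rw [inner_toLp] at h
  have h2 : ∀ t, conj (f t) * f t = ((‖f t‖ ^ 2 : ℝ) : ℂ) := fun t => by
    rw [mul_comm, Complex.mul_conj, Complex.normSq_eq_norm_sq]
  simp only [h2] at h
  have h3 : (∫ t, ((‖f t‖ ^ 2 : ℝ) : ℂ)) = ((∫ t, ‖f t‖ ^ 2 : ℝ) : ℂ) := integral_ofReal
  rw [h3] at h
  apply Complex.ofReal_injective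
  rw [h]
  simp

/-- The image of the de Branges space in `L²(ℝ)` under division by `G`. -/
noncomputable def dbSubmodule (G : ℂ → ℂ) : Submodule ℂ L2R where
  carrier := {k | (∃ g, MemDB G g ∧ k =ᵐ[volume] fun t : ℝ => g t / G t)}
  add_mem' := by
    rintro a b ⟨f, hf, haf⟩ ⟨g, hg, hbg⟩
    refine ⟨_, hf.add hg, ?_⟩
    filter_upwards [Lp.coeFn_add a b, haf, hbg] with t h1 h2 h3
    rw [h1, Pi.add_apply, h2, h3]; ring
  zero_mem' := by
    have h0 : IsHardy fun _ => (0 : ℂ) :=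
      IsHardy.of_decay (fun _ _ => analyticAt_const) 0 (C := 0) fun z _ => by simp
    refine ⟨fun _ => 0, ⟨differentiable_const _, h0.congr fun z => by simp,
      h0.congr fun z => by simp [sharp]⟩, ?_⟩
    filter_upwards [Lp.coeFn_zero ℂ 2 (volume : Measure ℝ)] with t h1
    rw [h1]; simp
  smul_mem' := by
    rintro c a ⟨f, hf, haf⟩
    refine ⟨_, hf.const_mul c, ?_⟩
    filter_upwards [Lp.coeFn_smul c a, haf] with t h1 h2
    rw [h1, Pi.smul_apply, h2, smul_eq_mul]; ring

theorem norm_sq_eq_normSq {G g : ℂ → ℂ} {k : L2R} (hk : k =ᵐ[volume] fun t : ℝ => g t / G t) :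
    ‖k‖ ^ 2 = normSq G g := by
  have h := norm_toLp_sq (Lp.memLp k)
  rw [Lp.toLp_coeFn] at h
  rw [h, normSq]
  refine integral_congr_ae ?_
  filter_upwards [hk] with t ht
  rw [ht]

/-- De Branges spaces are complete. -/
theorem IsRegularHB.isClosed_dbSubmodule {G : ℂ → ℂ} (hG : IsRegularHB G) :
    IsClosed (dbSubmodule G : Set L2R) := by
  refine IsSeqClosed.isClosed fun k k₀ hk hlim => ?_
  choose g hg hkg using hk
  have hdiff : ∀ n m, MemDB G (fun z => g n z + (-1) * g m z) ∧
      normSq G (fun z => g n z + (-1) * g m z) = ‖k n - k m‖ ^ 2 := by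
    intro n m
    refine ⟨(hg n).add ((hg m).const_mul (-1)), (norm_sq_eq_normSq ?_).symm⟩
    filter_upwards [Lp.coeFn_sub (k n) (k m), hkg n, hkg m] with t h1 h2 h3
    rw [h1, Pi.sub_apply, h2, h3]; ring
  have hcau : CauchySeq k := hlim.cauchySeq
  -- Locally uniform bounds for point evaluations turn an `L²` Cauchy sequence into a locally
  -- uniform Cauchy sequence of entire functions.
  have hucau : ∀ R : ℝ, 0 < R → UniformCauchySeqOn g atTop (Metric.ball 0 R) := by
    intro R hR
    obtain ⟨C, hC0, hC⟩ := hG.exists_norm_sq_le hR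
    rw [Metric.uniformCauchySeqOn_iff]
    intro ε hε
    obtain ⟨N, hN⟩ := Metric.cauchySeq_iff.1 hcau (ε / (Real.sqrt C + 1)) (by positivity)
    refine ⟨N, fun m hm n hn z hz => ?_⟩
    have h1 := hC _ (hdiff m n).1 z (by simpa using hz : ‖z‖ < R).le
    rw [(hdiff m n).2] at h1
    have h2 := hN m hm n hn
    rw [dist_eq_norm] at h2 ⊢
    have h3 : ‖g m z - g n z‖ ≤ Real.sqrt C * ‖k m - k n‖ := by
      refine abs_le_of_sq_le_sq' ?_ (by positivity) |>.2
      rw [mul_pow, Real.sq_sqrt hC0]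
      have h4 : g m z - g n z = g m z + (-1) * g n z := by ring
      rwa [h4]
    calc ‖g m z - g n z‖ ≤ Real.sqrt C * ‖k m - k n‖ := h3
      _ ≤ (Real.sqrt C) * (ε / (Real.sqrt C + 1)) := by gcongr
      _ < (Real.sqrt C + 1) * (ε / (Real.sqrt C + 1)) := by gcongr; linarith
      _ = ε := by field_simp
  have hpt : ∀ z, ∃ l, Tendsto (fun n => g n z) atTop (𝓝 l) := by
    intro z
    have h1 : z ∈ Metric.ball (0 : ℂ) (‖z‖ + 1) := by simp
    exact cauchySeq_tendsto_of_complete ((hucau _ (by positivity)).cauchySeq h1)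
  choose g₀ hg₀ using hpt
  have hunif : ∀ R : ℝ, 0 < R → TendstoUniformlyOn g g₀ atTop (Metric.ball 0 R) := fun R hR =>
    (hucau R hR).tendstoUniformlyOn_of_tendsto fun z _ => hg₀ z
  have hg₀d : Differentiable ℂ g₀ := by
    intro z
    have h1 : DifferentiableOn ℂ g₀ (Metric.ball 0 (‖z‖ + 1)) :=
      (hunif _ (by positivity)).tendstoLocallyUniformlyOn.differentiableOn
        (Eventually.of_forall fun n => (hg n).differentiable.differentiableOn) Metric.isOpen_ball
    exact h1.differentiableAt (Metric.isOpen_ball.mem_nhds (by simp))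
  have hae : k₀ =ᵐ[volume] fun t : ℝ => g₀ t / G t := by
    obtain ⟨ns, hns, hnsae⟩ := (tendstoInMeasure_of_tendsto_Lp hlim).exists_seq_tendsto_ae
    filter_upwards [hnsae, ae_all_iff.2 hkg] with t h1 h2
    refine tendsto_nhds_unique h1 ?_
    simp only [h2]
    exact ((hg₀ t).comp hns.tendsto_atTop).div_const _
  have hint : Integrable fun t : ℝ => ‖g₀ t / G t‖ ^ 2 := by
    have h1 := (memLp_two_iff_integrable_sq_norm (Lp.memLp k₀).1).1 (Lp.memLp k₀)
    refine h1.congr ?_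
    filter_upwards [hae] with t ht
    rw [ht]
  have hnorm : Tendsto (fun n => ‖k n‖ ^ 2) atTop (𝓝 (‖k₀‖ ^ 2)) := hlim.norm.pow 2
  -- The Hardy bound of each approximant has its own squared norm as constant, so it passes to the
  -- pointwise limit with constant `‖k₀‖²`.
  refine ⟨g₀, ⟨hg₀d, ⟨hG.analyticAt_div hg₀d, hint, ‖k₀‖ ^ 2, fun z hz => ?_⟩,
    ⟨hG.analyticAt_div (differentiable_sharp hg₀d), ?_, ‖k₀‖ ^ 2, fun z hz => ?_⟩⟩, hae⟩
  · refine le_of_tendsto_of_tendsto' ((((hg₀ z).div_const _).norm.pow 2).mul_const _) hnorm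
      fun n => ?_
    rw [norm_sq_eq_normSq (hkg n)]
    exact (hg n).norm_sq_mul_im_le hz
  · simpa only [norm_sharp_div_ofReal] using hint
  · have h1 : Tendsto (fun n => sharp (g n) z) atTop (𝓝 (sharp g₀ z)) :=
      (Complex.continuous_conj.tendsto _).comp (hg₀ (conj z))
    refine le_of_tendsto_of_tendsto' (((h1.div_const _).norm.pow 2).mul_const _) hnorm
      fun n => ?_
    rw [norm_sq_eq_normSq (hkg n), ← normSq_sharp]
    exact (hg n).sharp.norm_sq_mul_im_le hz

end Completeness


/-! ### Functions vanishing on the zero set of `G + G*`. -/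

section Liouville

/-- The real-on-the-real-axis function `G + G*`, up to a factor the function `A` of `G = A - iB`. -/
noncomputable def realPart (G : ℂ → ℂ) (z : ℂ) : ℂ := G z + sharp G z

theorem differentiable_realPart {G : ℂ → ℂ} (hG : Differentiable ℂ G) :
    Differentiable ℂ (realPart G) :=
  hG.add (differentiable_sharp hG)

theorem sharp_realPart (G : ℂ → ℂ) : sharp (realPart G) = realPart G := by
  funext z
  simp [sharp, realPart, add_comm]

theorem IsRegularHB.realPart_ne_zero {G : ℂ → ℂ} (hG : IsRegularHB G) {z : ℂ} (hz : z.im ≠ 0) :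
    realPart G z ≠ 0 := by
  have key : ∀ z : ℂ, 0 < z.im → realPart G z ≠ 0 := fun z hz h => by
    have h1 := hG.norm_lt z hz
    rw [eq_neg_of_add_eq_zero_left h, norm_neg] at h1
    exact lt_irrefl _ h1
  rcases hz.lt_or_gt with h | h
  · intro h0
    refine key (conj z) (by simpa using h) ?_
    rw [← sharp_realPart, sharp, Complex.conj_conj, h0, map_zero]
  · exact key z h

theorem IsRegularHB.analyticAt_theta {G : ℂ → ℂ} (hG : IsRegularHB G) (z : ℂ) (hz : 0 ≤ z.im) :
    AnalyticAt ℂ (fun z => sharp G z / G z) z :=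
  hG.analyticAt_div (differentiable_sharp hG.differentiable) z hz

theorem IsRegularHB.norm_theta_le {G : ℂ → ℂ} (hG : IsRegularHB G) (z : ℂ) (hz : 0 ≤ z.im) :
    ‖sharp G z / G z‖ ≤ 1 := by
  rw [norm_div]
  exact div_le_one_of_le₀ (hG.norm_sharp_le z hz) (norm_nonneg _)

theorem IsRegularHB.norm_theta_lt {G : ℂ → ℂ} (hG : IsRegularHB G) (z : ℂ) (hz : 0 < z.im) :
    ‖sharp G z / G z‖ < 1 := by
  rw [norm_div, div_lt_one (norm_pos_iff.2 (hG.ne_zero z hz.le))]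
  exact hG.norm_lt z hz

/-- Since `|G + G*| ≥ |G| (1 - |G*/G|)`, the Schwarz-Pick lower bound for the inner quotient `G*/G`
applies. -/
theorem IsRegularHB.exists_le_norm_realPart {G : ℂ → ℂ} (hG : IsRegularHB G) :
    ∃ c : ℝ, 0 < c ∧ ∀ z : ℂ, 0 < z.im →
      c * (z.im / (1 + ‖z‖ ^ 2)) * ‖G z‖ ≤ ‖realPart G z‖ := by
  obtain ⟨c, hc, h⟩ := exists_le_one_sub_norm (Θ := fun z => sharp G z / G z)
    (fun z hz => (hG.analyticAt_theta z (le_of_lt hz)).differentiableAt.differentiableWithinAt)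
    (fun z hz => hG.norm_theta_le z (le_of_lt hz))
    ⟨Complex.I, by simp [upperHalf], hG.norm_theta_lt _ (by simp)⟩
  refine ⟨c, hc, fun z hz => ?_⟩
  have h0 : 0 < ‖G z‖ := norm_pos_iff.2 (hG.ne_zero z hz.le)
  have h1 := norm_sub_norm_le (G z) (-sharp G z)
  rw [norm_neg, sub_neg_eq_add] at h1
  calc c * (z.im / (1 + ‖z‖ ^ 2)) * ‖G z‖ ≤ (1 - ‖sharp G z / G z‖) * ‖G z‖ := by
        gcongr; exact h z hz
    _ = ‖G z‖ - ‖sharp G z‖ := by rw [norm_div]; field_simp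
    _ ≤ _ := h1

/-- The quotient of an entire function by an entire function with simple zeros at which the
numerator vanishes. -/
theorem exists_differentiable_mul_eq {g A : ℂ → ℂ} (hg : Differentiable ℂ g)
    (hA : Differentiable ℂ A) (h0 : ∀ z, A z = 0 → g z = 0) (h1 : ∀ z, A z = 0 → deriv A z ≠ 0) :
    ∃ u : ℂ → ℂ, Differentiable ℂ u ∧ ∀ z, g z = u z * A z := by
  classical
  refine ⟨fun z => if A z = 0 then deriv g z / deriv A z else g z / A z, fun z₀ => ?_, fun z => ?_⟩
  · by_cases hz : A z₀ = 0
    · have hdA : AnalyticAt ℂ (dslope A z₀) z₀ := AnalyticAt.dslope' (hA.analyticAt _) (hA.analyticAt _)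
      have hdg : AnalyticAt ℂ (dslope g z₀) z₀ := AnalyticAt.dslope' (hg.analyticAt _) (hg.analyticAt _)
      have hne : dslope A z₀ z₀ ≠ 0 := by rw [dslope_same]; exact h1 z₀ hz
      refine (hdg.differentiableAt.div hdA.differentiableAt hne).congr_of_eventuallyEq ?_
      filter_upwards [hdA.continuousAt.eventually_ne hne] with z hz'
      by_cases hzz : z = z₀
      · subst hzz
        rw [Pi.div_apply, if_pos hz, dslope_same, dslope_same]
      · have hsub : z - z₀ ≠ 0 := sub_ne_zero.2 hzz
        have e1 := sub_smul_dslope_of_zero hz z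
        have e2 := sub_smul_dslope_of_zero (h0 z₀ hz) z
        rw [smul_eq_mul] at e1 e2
        rw [Pi.div_apply, if_neg, ← e1, ← e2, mul_div_mul_left _ _ hsub]
        rw [← e1]
        exact mul_ne_zero hsub hz'
    · refine ((hg z₀).div (hA z₀) hz).congr_of_eventuallyEq ?_
      filter_upwards [(hA z₀).continuousAt.eventually_ne hz] with z hz'
      rw [if_neg hz', Pi.div_apply]
  · by_cases hz : A z = 0
    · rw [hz, h0 z hz, mul_zero]
    · simp only [if_neg hz]
      rw [div_mul_cancel₀ _ hz]

/-- An element of the de Branges space vanishing at all zeros of `G + G*` is a multiple of it. -/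
theorem IsRegularHB.eq_const_mul_realPart {G g : ℂ → ℂ} (hG : IsRegularHB G) (hg : MemDB G g)
    (h1 : ∀ x : ℝ, realPart G x = 0 → deriv (realPart G) x ≠ 0)
    (h0 : ∀ x : ℝ, realPart G x = 0 → g x = 0) : ∃ c : ℂ, ∀ z, g z = c * realPart G z := by
  have hreal : ∀ z : ℂ, realPart G z = 0 → z = (z.re : ℂ) := fun z hz =>
    Complex.ext rfl (by
      by_contra h
      exact hG.realPart_ne_zero (by simpa using h) hz)
  obtain ⟨u, hu, hgu⟩ := exists_differentiable_mul_eq hg.differentiable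
    (differentiable_realPart hG.differentiable)
    (fun z hz => by have h := hreal z hz; rw [h] at hz; rw [h]; exact h0 _ hz)
    (fun z hz => by have h := hreal z hz; rw [h] at hz; rw [h]; exact h1 _ hz)
  obtain ⟨c, hc, hAc⟩ := hG.exists_le_norm_realPart
  set N := normSq G g with hN
  have hN0 : 0 ≤ N := normSq_nonneg G g
  -- Dividing by `G + G*` costs the factor `(1 + |z|²) / Im z`, squared, on top of the Hardy bound.
  -- This explains the powers `3` and `2`. The statement is quantified over `g` and `u` so that it
  -- also serves `g*` and `u*`.
  have key : ∀ g u : ℂ → ℂ, MemDB G g → normSq G g = N → (∀ z, g z = u z * realPart G z) →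
      ∀ z : ℂ, 0 < z.im → ‖u z‖ ^ 2 * z.im ^ 3 ≤ N / c ^ 2 * (1 + ‖z‖ ^ 2) ^ 2 := by
    intro g u hg hgN hgu z hz
    have hGz : 0 < ‖G z‖ := norm_pos_iff.2 (hG.ne_zero z hz.le)
    have e1 := hg.norm_sq_mul_im_le hz
    rw [hgN, norm_div, hgu z, norm_mul] at e1
    have hD : 0 < 1 + ‖z‖ ^ 2 := by positivity
    have e2 : (c * (z.im / (1 + ‖z‖ ^ 2))) * ‖u z‖ ≤ ‖u z‖ * ‖realPart G z‖ / ‖G z‖ := by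
      rw [le_div_iff₀ hGz]
      have := hAc z hz
      nlinarith [norm_nonneg (u z)]
    have e3 : ((c * (z.im / (1 + ‖z‖ ^ 2))) * ‖u z‖) ^ 2 * z.im ≤ N :=
      le_trans (by gcongr) e1
    calc ‖u z‖ ^ 2 * z.im ^ 3
        = (((c * (z.im / (1 + ‖z‖ ^ 2))) * ‖u z‖) ^ 2 * z.im) / c ^ 2 * (1 + ‖z‖ ^ 2) ^ 2 := by
          field_simp
      _ ≤ _ := by gcongr
  have hgu' : ∀ z, sharp g z = sharp u z * realPart G z := fun z => by
    rw [← congrFun (sharp_realPart G) z]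
    simp only [sharp]
    rw [hgu, map_mul]
  have hall : ∀ z : ℂ, ‖u z‖ ^ 2 * |z.im| ^ 3 ≤ N / c ^ 2 * (1 + ‖z‖ ^ 2) ^ 2 := by
    intro z
    rcases lt_trichotomy z.im 0 with h | h | h
    · have := key (sharp g) (sharp u) hg.sharp (normSq_sharp G g) hgu' (conj z) (by simpa using h)
      rwa [norm_sharp_conj, Complex.conj_im, Complex.norm_conj, ← abs_of_neg h] at this
    · rw [h]; simp; positivity
    · rw [abs_of_pos h]
      exact key g u hg rfl hgu z h
  refine ⟨u 0, fun z => ?_⟩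
  rw [hgu z]
  congr 1
  -- With exponent `p = 2` the multiplier contributes `16 ρ⁴ |Im w|⁴`, which absorbs `|Im w|³` and
  -- leaves one factor at most `ρ`. For `ρ ≥ 1` the right side is then at most `64 ρ⁹ N / c²`,
  -- against `(3/4)⁴ ρ⁸` inside, so `|u|²` grows at most linearly. The number `256 / 81` is
  -- `(4/3)⁴`.
  refine eq_const_of_norm_sq_le hu (K := 64 * N / c ^ 2 * (256 / 81)) (fun ρ hρ z hz => ?_) z
  have hρ0 : 0 < ρ := by linarith
  have h := norm_sq_mul_le_of_sphere hu (ρ := ρ) (B := 64 * ρ ^ 9 * (N / c ^ 2)) hρ0 2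
    (fun w hw => ?_) hz
  · have h3 : ‖u z‖ ^ 2 * (81 / 256 * ρ ^ 8) ≤ 64 * N / c ^ 2 * ρ * ρ ^ 8 := by
      calc _ = ‖u z‖ ^ 2 * ((3 * ρ ^ 2 / 4) ^ 2) ^ 2 := by ring
        _ ≤ _ := h
        _ = _ := by ring
    have h4 : (‖u z‖ ^ 2 * (81 / 256)) * ρ ^ 8 ≤ (64 * N / c ^ 2 * ρ) * ρ ^ 8 := by linarith
    have h5 := le_of_mul_le_mul_right h4 (by positivity)
    linarith
  · have h3 := hall w
    have h4 : |w.im| ≤ ρ := hw ▸ Complex.abs_im_le_norm w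
    rw [hw] at h3
    have h5 : (1 + ρ ^ 2) ^ 2 ≤ 4 * ρ ^ 4 := by
      have : 1 + ρ ^ 2 ≤ 2 * ρ ^ 2 := by nlinarith
      calc (1 + ρ ^ 2) ^ 2 ≤ (2 * ρ ^ 2) ^ 2 := by gcongr
        _ = _ := by ring
    calc ‖u w‖ ^ 2 * ((2 * ρ * |w.im|) ^ 2) ^ 2
        = 16 * ρ ^ 4 * |w.im| * (‖u w‖ ^ 2 * |w.im| ^ 3) := by ring
      _ ≤ 16 * ρ ^ 4 * ρ * (N / c ^ 2 * (4 * ρ ^ 4)) := by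
        have h6 : ‖u w‖ ^ 2 * |w.im| ^ 3 ≤ N / c ^ 2 * (4 * ρ ^ 4) := h3.trans (by gcongr)
        exact mul_le_mul (by gcongr) h6 (by positivity) (by positivity)
      _ = _ := by ring

end Liouville


/-! ### Phase derivatives and the diagonal of the kernel. -/

section Phase

/-- By continuity `φ t - φ x` stays in `(-π, π)` near `x`, where it equals minus the principal
argument of `E t / E x`. So `φ` is locally the imaginary part of a logarithm. -/
theorem IsPhaseFunction.hasDerivAt {E : ℂ → ℂ} {φ : ℝ → ℝ} (hφ : IsPhaseFunction E φ)
    (hE : Differentiable ℂ E) (h0 : ∀ x : ℝ, E x ≠ 0) (x : ℝ) :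
    HasDerivAt φ (-(deriv E x / E x).im) x := by
  have h1 : HasDerivAt (fun t : ℝ => E t / E x) (deriv E x / E x) x :=
    ((hE x).hasDerivAt.comp_ofReal).div_const _
  have hone : E x / E x = 1 := div_self (h0 x)
  have h2 : HasDerivAt (fun t : ℝ => Complex.log (E t / E x)) (deriv E x / E x) x := by
    have := h1.clog_real (by rw [hone]; exact Complex.one_mem_slitPlane)
    rwa [hone, div_one] at this
  have h3 : HasDerivAt (fun t : ℝ => (Complex.log (E t / E x)).im) (deriv E x / E x).im x :=
    Complex.imCLM.hasFDerivAt.comp_hasDerivAt x h2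
  refine (h3.neg.add_const (φ x)).congr_of_eventuallyEq ?_
  have hcont : Tendsto (fun t => φ t - φ x) (𝓝 x) (𝓝 0) := by
    have := (hφ.continuous.tendsto x).sub_const (φ x)
    rwa [sub_self] at this
  filter_upwards [hcont.eventually (Ioo_mem_nhds (neg_lt_zero.2 Real.pi_pos) Real.pi_pos)]
    with t ht
  have hr : 0 < ‖E t‖ / ‖E x‖ := div_pos (norm_pos_iff.2 (h0 t)) (norm_pos_iff.2 (h0 x))
  have e1 : E t / E x = ((‖E t‖ / ‖E x‖ : ℝ) : ℂ) *
      (Complex.cos ((-(φ t - φ x) : ℝ) : ℂ) +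
        Complex.sin ((-(φ t - φ x) : ℝ) : ℂ) * Complex.I) := by
    rw [← Complex.exp_mul_I]
    conv_lhs => rw [hφ.eq_norm_mul_exp t, hφ.eq_norm_mul_exp x]
    rw [mul_div_mul_comm, ← Complex.exp_sub]
    push_cast
    congr 2
    ring
  rw [Pi.neg_apply, Complex.log_im, e1, Complex.arg_real_mul _ hr,
    Complex.arg_cos_add_sin_mul_I ⟨by linarith [ht.2], by linarith [ht.1]⟩]
  ring

theorem deriv_sharp_ofReal {G : ℂ → ℂ} (hG : Differentiable ℂ G) (x : ℝ) :
    deriv (sharp G) x = conj (deriv G x) := by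
  have h := HasDerivAt.conj_conj (hG x).hasDerivAt
  rw [Complex.conj_ofReal] at h
  exact h.deriv

/-- The diagonal of the reproducing kernel, through the logarithmic derivative. -/
theorem kernel_ofReal_self {G : ℂ → ℂ} (hG : Differentiable ℂ G) {x : ℝ} (h0 : G x ≠ 0) :
    kernel G x x = ((‖G x‖ ^ 2 * -(deriv G x / G x).im / Real.pi : ℝ) : ℂ) := by
  have h1 : deriv (kernelNum G x) x = conj (G x) * deriv G x - G x * conj (deriv G x) := by
    have := ((hG x).hasDerivAt.const_mul (conj (G x))).sub
      (((differentiable_sharp hG) x).hasDerivAt.const_mul (G x))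
    rw [deriv_sharp_ofReal hG] at this
    exact this.deriv
  have h2 : conj (G x) * deriv G x = ((‖G x‖ ^ 2 : ℝ) : ℂ) * (deriv G x / G x) := by
    rw [← Complex.normSq_eq_norm_sq, ← Complex.mul_conj]
    field_simp
  have h3 : G x * conj (deriv G x) = ((‖G x‖ ^ 2 : ℝ) : ℂ) * conj (deriv G x / G x) := by
    have := congrArg conj h2
    simpa only [map_mul, Complex.conj_conj, Complex.conj_ofReal] using this
  have h4 : ∀ w : ℂ, w - conj w = 2 * w.im * Complex.I := fun w => by
    apply Complex.ext <;> simp; ring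
  rw [kernel_ofReal, dslope_same, h1, h2, h3, ← mul_sub, h4]
  have hpi : (Real.pi : ℂ) ≠ 0 := by exact_mod_cast Real.pi_ne_zero
  have := Complex.I_ne_zero
  push_cast
  field_simp

theorem IsPhaseFunction.kernel_self {E : ℂ → ℂ} {φ : ℝ → ℝ} (hφ : IsPhaseFunction E φ)
    (hE : Differentiable ℂ E) (h0 : ∀ x : ℝ, E x ≠ 0) (x : ℝ) :
    (kernel E x x).re = ‖E x‖ ^ 2 * deriv φ x / Real.pi := by
  rw [kernel_ofReal_self hE (h0 x), (hφ.hasDerivAt hE h0 x).deriv, Complex.ofReal_re]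

theorem IsRegularHB.ofReal_kernel_re {G : ℂ → ℂ} (hG : IsRegularHB G) (x : ℝ) :
    ((kernel G x x).re : ℂ) = kernel G x x := by
  rw [kernel_ofReal_self hG.differentiable (hG.ne_zero x (by simp)), Complex.ofReal_re]

theorem IsRegularHB.mul {E F : ℂ → ℂ} (hE : IsRegularHB E) (hF : IsRegularHB F) :
    IsRegularHB fun z => E z * F z := by
  refine ⟨hE.differentiable.mul hF.differentiable,
    fun z hz => mul_ne_zero (hE.ne_zero z hz) (hF.ne_zero z hz), fun z hz => ?_⟩
  rw [sharp_mul, norm_mul, norm_mul]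
  exact mul_lt_mul'' (hE.norm_lt z hz) (hF.norm_lt z hz) (norm_nonneg _) (norm_nonneg _)

/-- Logarithmic derivatives of a product add, so no phase function of `E F` has to be constructed.
-/
theorem kernel_mul_self {E F : ℂ → ℂ} {φE φF : ℝ → ℝ} (hφE : IsPhaseFunction E φE)
    (hφF : IsPhaseFunction F φF) (hE : IsRegularHB E) (hF : IsRegularHB F) (x : ℝ) :
    (kernel (fun z => E z * F z) x x).re =
      ‖E x‖ ^ 2 * ‖F x‖ ^ 2 * (deriv φE x + deriv φF x) / Real.pi := by
  have hE0 : ∀ x : ℝ, E x ≠ 0 := fun x => hE.ne_zero x (by simp)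
  have hF0 : ∀ x : ℝ, F x ≠ 0 := fun x => hF.ne_zero x (by simp)
  have hG := hE.mul hF
  have hd : deriv (fun z => E z * F z) x / (E x * F x) = deriv E x / E x + deriv F x / F x := by
    rw [deriv_fun_mul (hE.differentiable x) (hF.differentiable x)]
    have := hE0 x
    have := hF0 x
    field_simp
  rw [kernel_ofReal_self hG.differentiable (hG.ne_zero x (by simp)), Complex.ofReal_re, hd,
    (hφE.hasDerivAt hE.differentiable hE0 x).deriv,
    (hφF.hasDerivAt hF.differentiable hF0 x).deriv, norm_mul, Complex.add_im]
  ring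

end Phase

/-! ### Kernel vectors in `L²`, and the embedding of `H(E)` into `H(E F)`. -/

section Diagonal

/-- The element of `L²(ℝ)` associated with an element of a de Branges space. -/
noncomputable def MemDB.toL2 {G g : ℂ → ℂ} (hg : MemDB G g) : L2R :=
  hg.left.memLp.toLp _

theorem MemDB.norm_toL2_sq {G g : ℂ → ℂ} (hg : MemDB G g) : ‖hg.toL2‖ ^ 2 = normSq G g :=
  norm_toLp_sq _

theorem MemDB.coeFn_toL2 {G g : ℂ → ℂ} (hg : MemDB G g) :
    hg.toL2 =ᵐ[volume] fun t : ℝ => g t / G t :=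
  hg.left.memLp.coeFn_toLp

theorem IsRegularHB.inner_kernel {G g : ℂ → ℂ} (hG : IsRegularHB G) (hg : MemDB G g) (x : ℝ) :
    inner ℂ (hG.memDB_kernel x).toL2 hg.toL2 = g x := by
  rw [← hG.integral_conj_kernel_mul hg x]
  exact inner_toLp _ _

theorem IsRegularHB.normSq_kernel {G : ℂ → ℂ} (hG : IsRegularHB G) (x : ℝ) :
    normSq G (kernel G x) = (kernel G x x).re := by
  have h := hG.inner_kernel (hG.memDB_kernel x) x
  rw [inner_self_eq_norm_sq_to_K] at h
  rw [← (hG.memDB_kernel x).norm_toL2_sq, ← h]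
  norm_cast

theorem IsRegularHB.norm_sq_le_kernel_mul {G g : ℂ → ℂ} (hG : IsRegularHB G) (hg : MemDB G g)
    (x : ℝ) : ‖g x‖ ^ 2 ≤ (kernel G x x).re * normSq G g := by
  rw [← hG.inner_kernel hg x, ← hG.normSq_kernel x, ← hg.norm_toL2_sq,
    ← (hG.memDB_kernel x).norm_toL2_sq, ← mul_pow]
  gcongr
  exact norm_inner_le_norm _ _

theorem IsRegularHB.kernel_self_nonneg {G : ℂ → ℂ} (hG : IsRegularHB G) (x : ℝ) :
    0 ≤ (kernel G x x).re :=
  hG.normSq_kernel x ▸ normSq_nonneg _ _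

/-- If the kernel function of `G₁` lies in the space of `G₂` with control of the norm, the
diagonals of the kernels compare. -/
theorem IsRegularHB.kernel_self_le {G₁ G₂ : ℂ → ℂ} (h₁ : IsRegularHB G₁) (h₂ : IsRegularHB G₂)
    {x : ℝ} (hm : MemDB G₂ (kernel G₁ x)) {c : ℝ}
    (hc : normSq G₂ (kernel G₁ x) ≤ c * normSq G₁ (kernel G₁ x)) (hc0 : 0 ≤ c) :
    (kernel G₁ x x).re ≤ c * (kernel G₂ x x).re := by
  have h := h₂.norm_sq_le_kernel_mul hm x
  rw [← h₁.ofReal_kernel_re x, Complex.norm_real, Real.norm_eq_abs, sq_abs] at h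
  rw [h₁.normSq_kernel] at hc
  have p1 := h₁.kernel_self_nonneg x
  have p2 := h₂.kernel_self_nonneg x
  rcases p1.eq_or_lt with h0 | hpos
  · rw [← h0]; positivity
  · have h3 : (kernel G₁ x x).re ^ 2 ≤ (kernel G₂ x x).re * (c * (kernel G₁ x x).re) :=
      h.trans (by gcongr)
    -- One positive factor `K₁(x,x)` is cancelled from both sides.
    nlinarith

/-- At such a point `conj (G x) = -G x`. This identity is the source of both the orthogonality of
the kernels and the simplicity of the zeros of `G + G*`. -/
theorem kernelNum_of_realPart_eq_zero {G : ℂ → ℂ} {x : ℝ} (hx : realPart G x = 0) (z : ℂ) :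
    kernelNum G x z = -G x * realPart G z := by
  rw [realPart, sharp_ofReal] at hx
  rw [kernelNum, realPart, eq_neg_of_add_eq_zero_right hx]
  ring

theorem deriv_realPart_ne_zero {G : ℂ → ℂ} {x : ℝ}
    (hx : realPart G x = 0) (hk : kernel G x x ≠ 0) : deriv (realPart G) x ≠ 0 := by
  intro h
  apply hk
  have h1 : kernelNum G x = fun z => -G x * realPart G z :=
    funext (kernelNum_of_realPart_eq_zero hx)
  rw [kernel_ofReal, dslope_same, h1, deriv_const_mul_field, h]
  simp

theorem kernel_eq_zero_of_ne {G : ℂ → ℂ} {x y : ℝ} (hx : realPart G x = 0)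
    (hy : realPart G y = 0) (hxy : x ≠ y) : kernel G x y = 0 := by
  have h := kernel_mul G x y
  rw [kernelNum_of_realPart_eq_zero hx, hy, mul_zero] at h
  refine (mul_eq_zero.1 h).resolve_right (mul_ne_zero Complex.two_pi_I_ne_zero (sub_ne_zero.2 ?_))
  exact_mod_cast hxy

theorem IsHardy.mul_bounded {h b : ℂ → ℂ} (hh : IsHardy h)
    (hb : ∀ z : ℂ, 0 ≤ z.im → AnalyticAt ℂ b z) {M : ℝ} (hM : ∀ z : ℂ, 0 ≤ z.im → ‖b z‖ ≤ M) :
    IsHardy fun z => h z * b z := by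
  obtain ⟨C, hC⟩ := hh.bound
  have ha : ∀ z : ℂ, 0 ≤ z.im → AnalyticAt ℂ (fun z => h z * b z) z :=
    fun z hz => (hh.analyticAt z hz).mul (hb z hz)
  have hn : ∀ z : ℂ, 0 ≤ z.im → ‖h z * b z‖ ^ 2 ≤ M ^ 2 * ‖h z‖ ^ 2 := fun z hz => by
    rw [norm_mul, mul_pow, mul_comm]
    gcongr
    exact hM z hz
  refine ⟨ha, ?_, M ^ 2 * C, fun z hz => ?_⟩
  · refine (hh.integrable.const_mul (M ^ 2)).mono'
      ((continuous_comp_ofReal ha).norm.pow 2).aestronglyMeasurable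
      (Eventually.of_forall fun t => ?_)
    rw [Real.norm_eq_abs, abs_of_nonneg (by positivity)]
    exact hn t (by simp)
  · calc ‖h z * b z‖ ^ 2 * z.im ≤ M ^ 2 * ‖h z‖ ^ 2 * z.im := by gcongr; exact hn z hz.le
      _ = M ^ 2 * (‖h z‖ ^ 2 * z.im) := by ring
      _ ≤ M ^ 2 * C := by gcongr; exact hC z hz

theorem IsHardy.congr_closed {f g : ℂ → ℂ} (hf : IsHardy f)
    (hg : ∀ z : ℂ, 0 ≤ z.im → AnalyticAt ℂ g z) (h : ∀ z : ℂ, 0 ≤ z.im → f z = g z) :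
    IsHardy g := by
  obtain ⟨C, hC⟩ := hf.bound
  refine ⟨hg, ?_, C, fun z hz => h z hz.le ▸ hC z hz⟩
  refine hf.integrable.congr (Eventually.of_forall fun t => ?_)
  simp only
  rw [h t (by simp)]

theorem IsRegularHB.mul_div_mul {F : ℂ → ℂ} (hF : IsRegularHB F) (f E : ℂ → ℂ) (z : ℂ)
    (hz : 0 ≤ z.im) : f z * F z / (E z * F z) = f z / E z :=
  mul_div_mul_right _ _ (hF.ne_zero z hz)

/-- Multiplication by `F` maps the space of `E` into the space of `E * F`. -/
theorem MemDB.mul_right {E F f : ℂ → ℂ} (hf : MemDB E f) (hE : IsRegularHB E)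
    (hF : IsRegularHB F) : MemDB (fun z => E z * F z) (fun z => f z * F z) := by
  have hG := hE.mul hF
  have hd : Differentiable ℂ fun z => f z * F z := hf.differentiable.mul hF.differentiable
  refine ⟨hd, hf.left.congr_closed (hG.analyticAt_div hd) fun z hz => ?_, ?_⟩
  · exact (hF.mul_div_mul f E z hz).symm
  · refine (hf.right.mul_bounded (hF.analyticAt_theta) hF.norm_theta_le).congr fun z => ?_
    rw [sharp_mul, mul_div_mul_comm]

theorem IsRegularHB.normSq_mul_right {F : ℂ → ℂ} (hF : IsRegularHB F) (E f : ℂ → ℂ) :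
    normSq (fun z => E z * F z) (fun z => f z * F z) = normSq E f := by
  simp only [normSq]
  congr 1
  funext t
  rw [hF.mul_div_mul f E t (by simp)]

end Diagonal


/-! ### A frame bound for an orthonormal system with a one-dimensional defect. -/

section Hilbert

variable {H ι : Type*} [NormedAddCommGroup H] [InnerProductSpace ℂ H] [CompleteSpace H]

/-- The remainder of a vector after subtracting its projection to an orthonormal system. -/
theorem exists_orthogonal_remainder {u : ι → H} (hu : Orthonormal ℂ u) {W : Submodule ℂ H}
    (hW : IsClosed (W : Set H)) (huW : ∀ i, u i ∈ W) {h : H} (hh : h ∈ W) :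
    ∃ r ∈ W, (∀ i, inner ℂ (u i) r = 0) ∧
      (∀ k, (∀ i, inner ℂ (u i) k = 0) → inner ℂ k h = inner ℂ k r) ∧
      ∑' i, ‖inner ℂ (u i) h‖ ^ 2 = ‖h‖ ^ 2 - ‖r‖ ^ 2 := by
  classical
  have hsum : Summable fun i => ‖inner ℂ (u i) h‖ ^ 2 :=
    Orthonormal.inner_products_summable h hu
  have hS : Summable fun i => inner ℂ (u i) h • u i := by
    have h1 := (hu.orthogonalFamily.summable_iff_norm_sq_summable (fun i => inner ℂ (u i) h)).2 hsum
    simpa using h1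
  set s := ∑' i, inner ℂ (u i) h • u i with hs
  have hsW : s ∈ W := by
    refine hW.mem_of_tendsto hS.hasSum (Eventually.of_forall fun F => ?_)
    exact W.sum_mem fun i _ => W.smul_mem _ (huW i)
  have hinner : ∀ k : H, HasSum (fun i => inner ℂ (u i) h * inner ℂ k (u i)) (inner ℂ k s) := by
    intro k
    have h1 := hS.hasSum.mapL (innerSL ℂ k)
    simpa only [innerSL_apply_apply, inner_smul_right] using h1
  have hus : ∀ j, inner ℂ (u j) s = inner ℂ (u j) h := by
    intro j
    refine (hinner (u j)).unique ?_
    convert hasSum_ite_eq j (inner ℂ (u j) h) using 2 with i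
    rw [orthonormal_iff_ite.1 hu j i]
    by_cases hij : j = i
    · subst hij; simp
    · simp [hij, Ne.symm hij]
  have hk0 : ∀ k, (∀ i, inner ℂ (u i) k = 0) → inner ℂ k s = 0 := by
    intro k hk
    refine (hinner k).unique ?_
    convert hasSum_zero using 2 with i
    rw [← inner_conj_symm k (u i), hk, map_zero, mul_zero]
  have hr : ∀ i, inner ℂ (u i) (h - s) = 0 := fun i => by rw [inner_sub_right, hus, sub_self]
  refine ⟨h - s, W.sub_mem hh hsW, hr, fun k hk => ?_, ?_⟩
  · rw [inner_sub_right, hk0 k hk, sub_zero]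
  · have hrs : inner ℂ s (h - s) = 0 := by
      rw [← inner_conj_symm, hk0 _ hr, map_zero]
    have hpyth : ‖h‖ ^ 2 = ‖s‖ ^ 2 + ‖h - s‖ ^ 2 := by
      have := norm_add_sq_eq_norm_sq_add_norm_sq_of_inner_eq_zero s (h - s) hrs
      rw [add_sub_cancel] at this
      simpa only [sq] using this
    have hss : HasSum (fun i => ‖inner ℂ (u i) h‖ ^ 2) (‖s‖ ^ 2) := by
      rw [← Complex.hasSum_ofReal]
      have h1 := hinner s
      rw [inner_self_eq_norm_sq_to_K] at h1
      convert h1 using 1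
      · funext i
        rw [← inner_conj_symm s (u i), hus, Complex.mul_conj, Complex.normSq_eq_norm_sq]
      · simp
    rw [hss.tsum_eq, hpyth]
    ring

/-- A lower frame bound for an orthonormal system whose orthogonal complement in `W` is at most
one-dimensional and not approached by vectors in `S`. -/
theorem exists_le_tsum_norm_inner_sq {u : ι → H} (hu : Orthonormal ℂ u) {W : Submodule ℂ H}
    (hW : IsClosed (W : Set H)) (huW : ∀ i, u i ∈ W) {S : Set H} (hSW : ∀ h ∈ S, h ∈ W)
    (hdim : ∀ k ∈ W, (∀ i, inner ℂ (u i) k = 0) → k ≠ 0 →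
      (∀ r ∈ W, (∀ i, inner ℂ (u i) r = 0) → ∃ c : ℂ, r = c • k) ∧
      ∃ m : H, inner ℂ m k ≠ 0 ∧ ∀ h ∈ S, inner ℂ m h = 0) :
    ∃ A : ℝ, 0 < A ∧ ∀ h ∈ S, A * ‖h‖ ^ 2 ≤ ∑' i, ‖inner ℂ (u i) h‖ ^ 2 := by
  by_cases hex : ∃ k ∈ W, (∀ i, inner ℂ (u i) k = 0) ∧ k ≠ 0
  · obtain ⟨k, hkW, hku, hk0⟩ := hex
    obtain ⟨hmul, m, hmk, hmS⟩ := hdim k hkW hku hk0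
    have hm0 : m ≠ 0 := fun h => hmk (by rw [h, inner_zero_left])
    have hmpos : 0 < ‖m‖ := norm_pos_iff.2 hm0
    have hkpos : 0 < ‖k‖ := norm_pos_iff.2 hk0
    have hmm : (inner ℂ m m : ℂ) ≠ 0 := inner_self_ne_zero.2 hm0
    -- Let `k'` be `k` minus its projection to `m`, so `‖k'‖ < ‖k‖`. Vectors of `S` are orthogonal
    -- to `m` and see no difference between `k` and `k'`. Their component along `k` is therefore at
    -- most the fraction `‖k'‖ / ‖k‖` of their norm. `m` need not lie in `W`.
    set β : ℂ := inner ℂ m k / inner ℂ m m with hβ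
    set k' := k - β • m with hk'
    have hmk' : inner ℂ m k' = 0 := by
      rw [hk', inner_sub_right, inner_smul_right, hβ, div_mul_cancel₀ _ hmm, sub_self]
    have hβ0 : β ≠ 0 := div_ne_zero hmk hmm
    have hpyth : ‖k‖ ^ 2 = ‖β • m‖ ^ 2 + ‖k'‖ ^ 2 := by
      have h0 : inner ℂ (β • m) k' = 0 := by rw [inner_smul_left, hmk', mul_zero]
      have := norm_add_sq_eq_norm_sq_add_norm_sq_of_inner_eq_zero (β • m) k' h0
      rw [hk', add_sub_cancel] at this
      simpa only [sq] using this
    have hlt : ‖k'‖ ^ 2 < ‖k‖ ^ 2 := by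
      have : 0 < ‖β • m‖ := norm_pos_iff.2 (smul_ne_zero hβ0 hm0)
      rw [hpyth]; nlinarith
    refine ⟨1 - ‖k'‖ ^ 2 / ‖k‖ ^ 2, ?_, fun h hh => ?_⟩
    · rw [sub_pos, div_lt_one (by positivity)]
      exact hlt
    · obtain ⟨r, hrW, hru, hkr, hsum⟩ := exists_orthogonal_remainder hu hW huW (hSW h hh)
      obtain ⟨c, rfl⟩ := hmul r hrW hru
      have h1 : ‖c‖ * ‖k‖ ^ 2 ≤ ‖k'‖ * ‖h‖ := by
        have h2 : inner ℂ k' h = c * ((‖k‖ ^ 2 : ℝ) : ℂ) := by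
          rw [hk', inner_sub_left, inner_smul_left, hmS h hh, mul_zero, sub_zero, hkr k hku,
            inner_smul_right, inner_self_eq_norm_sq_to_K]
          norm_cast
        have h3 := norm_inner_le_norm (𝕜 := ℂ) k' h
        rwa [h2, norm_mul, Complex.norm_real, Real.norm_eq_abs, abs_of_nonneg (by positivity)]
          at h3
      have h4 : ‖c • k‖ ^ 2 ≤ ‖k'‖ ^ 2 / ‖k‖ ^ 2 * ‖h‖ ^ 2 := by
        rw [norm_smul, div_mul_eq_mul_div, le_div_iff₀ (by positivity)]
        calc (‖c‖ * ‖k‖) ^ 2 * ‖k‖ ^ 2 = (‖c‖ * ‖k‖ ^ 2) ^ 2 := by ring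
          _ ≤ (‖k'‖ * ‖h‖) ^ 2 := by gcongr
          _ = _ := by ring
      rw [hsum]
      linarith
  · refine ⟨1, one_pos, fun h hh => ?_⟩
    obtain ⟨r, hrW, hru, -, hsum⟩ := exists_orthogonal_remainder hu hW huW (hSW h hh)
    have hr0 : r = 0 := by
      by_contra hne
      exact hex ⟨r, hrW, hru, hne⟩
    rw [hsum, hr0, norm_zero]
    simp

end Hilbert

/-! ### A vector separating the image of `H(E)` from `G + G*`. -/

section Witness

theorem isHardy_mul_inv {b : ℂ → ℂ} (hb : ∀ z : ℂ, 0 ≤ z.im → AnalyticAt ℂ b z) {M : ℝ}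
    (hM : ∀ z : ℂ, 0 ≤ z.im → ‖b z‖ ≤ M) {w : ℂ} (hw : 0 < w.im) :
    IsHardy fun z => b z / (z - conj w) :=
  ((isHardy_inv_sub_conj hw).mul_bounded hb hM).congr fun z => by rw [one_div_mul_eq_div]

theorem norm_inv_sub_conj_le {w : ℂ} (hw : 0 < w.im) {z : ℂ} (hz : 0 ≤ z.im) :
    ‖1 / (z - conj w)‖ ≤ 1 / w.im := by
  rw [norm_div, norm_one]
  gcongr
  have := Complex.abs_im_le_norm (z - conj w)
  rw [Complex.sub_im, Complex.conj_im, sub_neg_eq_add, abs_of_nonneg (by linarith)] at this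
  linarith

theorem analyticAt_inv_sub_conj {w : ℂ} (hw : 0 < w.im) (z : ℂ) (hz : 0 ≤ z.im) :
    AnalyticAt ℂ (fun z => 1 / (z - conj w)) z :=
  analyticAt_const.div (by fun_prop) (sub_conj_ne_zero hw hz)

/-- On the real line the integrand is the conjugate of `u / (z - conj w)`, which has no pole in the
closed upper half-plane. -/
theorem IsHardy.integral_conj_div_eq_zero {u : ℂ → ℂ} (hu : IsHardy u) {w : ℂ} (hw : 0 < w.im) :
    Integrable (fun t : ℝ => conj (u t) / (t - w)) ∧ ∫ t : ℝ, conj (u t) / (t - w) = 0 := by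
  obtain ⟨h1, h2⟩ := hu.integral_div_eq_zero (k := fun z => u z / (z - conj w)) (w := conj w)
    (fun z hz => (hu.analyticAt z hz).div (by fun_prop) (sub_conj_ne_zero hw hz))
    (fun z hz _ => mul_div_cancel₀ _ (sub_conj_ne_zero hw hz))
  have h3 : ∀ t : ℝ, conj (u t) / (t - w) = conj (u t / (t - conj w)) := fun t => by
    rw [map_div₀, map_sub, Complex.conj_conj, Complex.conj_ofReal]
  simp only [h3]
  exact ⟨(Complex.conjLIE.integrable_comp_iff).2 h1, by rw [integral_conj, h2, map_zero]⟩

/-- The quotient `F*/F` has modulus one at `0` and less than one at `i`, so its values at `i` and at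
`s i` differ for small `s`. -/
theorem IsRegularHB.exists_theta_ne {F : ℂ → ℂ} (hF : IsRegularHB F) :
    ∃ w w' : ℂ, 0 < w.im ∧ 0 < w'.im ∧ w ≠ w' ∧ sharp F w / F w ≠ sharp F w' / F w' := by
  have hc : Tendsto (fun s : ℝ => ‖sharp F (s * Complex.I) / F (s * Complex.I)‖) (𝓝[>] 0)
      (𝓝 ‖sharp F ((0 : ℝ) : ℂ) / F ((0 : ℝ) : ℂ)‖) := by
    have h1 : Tendsto (fun s : ℝ => (s : ℂ) * Complex.I) (𝓝[>] 0) (𝓝 ((0 : ℝ) : ℂ)) := by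
      have : Continuous fun s : ℝ => (s : ℂ) * Complex.I := by fun_prop
      simpa using (this.tendsto 0).mono_left nhdsWithin_le_nhds
    exact ((hF.analyticAt_theta ((0 : ℝ) : ℂ) (by simp)).continuousAt.tendsto.comp h1).norm
  have h0 : ‖sharp F ((0 : ℝ) : ℂ) / F ((0 : ℝ) : ℂ)‖ = 1 := by
    rw [norm_div, sharp_ofReal, Complex.norm_conj,
      div_self (norm_ne_zero_iff.2 (hF.ne_zero _ (by simp)))]
  rw [h0] at hc
  obtain ⟨s, hs, hs0⟩ := ((hc.eventually (lt_mem_nhds (hF.norm_theta_lt Complex.I (by simp)))).and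
    self_mem_nhdsWithin).exists
  have hne : sharp F (s * Complex.I) / F (s * Complex.I) ≠ sharp F Complex.I / F Complex.I :=
    fun h => by rw [h] at hs; exact lt_irrefl _ hs
  refine ⟨s * Complex.I, Complex.I, by simpa using hs0, by simp, fun h => hne (by rw [h]), hne⟩

/-- The image of the space of `E` in the space of `E * F` stays away from `G + G*`. -/
theorem exists_orthogonal_inner_realPart_ne_zero {E F : ℂ → ℂ} (hE : IsRegularHB E)
    (hF : IsRegularHB F) (hA : MemDB (fun z => E z * F z) (realPart fun z => E z * F z)) :
    ∃ m : L2R, inner ℂ m hA.toL2 ≠ 0 ∧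
      ∀ f, ∀ hf : MemDB E f, inner ℂ m (hf.mul_right hE hF).toL2 = 0 := by
  obtain ⟨w, w', hw, hw', hww, hΘ⟩ := hF.exists_theta_ne
  set ΘE : ℂ → ℂ := fun z => sharp E z / E z with hΘE
  set ΘF : ℂ → ℂ := fun z => sharp F z / F z with hΘF
  -- The witness is `Θ_E / ((z - conj w')(z - conj w))`. Pairing with it multiplies by `conj Θ_E`.
  -- This makes `f / E` into the conjugate of `f*/E`, and makes `(G + G*)/G = 1 + Θ_E Θ_F` into
  -- `conj Θ_E + Θ_F`.
  have hm : IsHardy fun z => ΘE z / (z - conj w') * (1 / (z - conj w)) :=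
    (isHardy_mul_inv hE.analyticAt_theta hE.norm_theta_le hw').mul_bounded
      (analyticAt_inv_sub_conj hw) fun z hz => norm_inv_sub_conj_le hw hz
  have hne : ∀ {w : ℂ}, 0 < w.im → ∀ t : ℝ, (t : ℂ) - w ≠ 0 := fun hw t => by
    rw [← neg_sub]; exact neg_ne_zero.2 (sub_ofReal_ne_zero hw t)
  have hE0 : ∀ t : ℝ, E t ≠ 0 := fun t => hE.ne_zero t (by simp)
  have hF0 : ∀ t : ℝ, F t ≠ 0 := fun t => hF.ne_zero t (by simp)
  have hE0' : ∀ t : ℝ, conj (E t) ≠ 0 := fun t => (map_ne_zero _).2 (hE0 t)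
  refine ⟨hm.memLp.toLp _, ?_, fun f hf => ?_⟩
  · -- the pairing with `G + G*`
    have hD : IsHardy (dslope ΘF w') := by
      refine IsHardy.of_decay (fun z hz => AnalyticAt.dslope' (hF.analyticAt_theta w' hw'.le)
        (hF.analyticAt_theta z hz)) w' (C := 2) fun z hz => ?_
      have h1 := congrArg norm (sub_smul_dslope ΘF w' z)
      rw [norm_smul, mul_comm] at h1
      rw [h1]
      refine (norm_sub_le _ _).trans ?_
      have := hF.norm_theta_le z hz
      have := hF.norm_theta_le w' hw'.le
      linarith
    obtain ⟨hi1, h1⟩ := hD.integral_div_sub hw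
    -- The constant `Θ_F(w')` is moved from `Θ_F` to `conj Θ_E`. The conjugate part still integrates
    -- to zero, while `Θ_F - Θ_F(w')` loses its pole at `w'`, and Cauchy's formula evaluates its
    -- divided slope at `w`. This is nonzero by the choice of `w` and `w'`.
    obtain ⟨hi2, h2⟩ := (isHardy_mul_inv (b := fun z => ΘE z + conj (ΘF w')) (M := 2)
      (fun z hz => (hE.analyticAt_theta z hz).add analyticAt_const) (fun z hz => by
        refine (norm_add_le _ _).trans ?_
        rw [Complex.norm_conj]
        have := hE.norm_theta_le z hz
        have := hF.norm_theta_le w' hw'.le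
        linarith) hw').integral_conj_div_eq_zero hw
    have hDw : dslope ΘF w' w ≠ 0 := by
      intro h
      have h3 := sub_smul_dslope ΘF w' w
      rw [h, smul_zero] at h3
      exact hΘ (sub_eq_zero.1 h3.symm)
    have hkey : inner ℂ (hm.memLp.toLp _) hA.toL2 = 2 * Real.pi * Complex.I * dslope ΘF w' w := by
      rw [← h1, ← zero_add (∫ t : ℝ, _), ← h2, ← integral_add hi2 hi1]
      refine (inner_toLp _ _).trans (integral_congr_ae (Eventually.of_forall fun t => ?_))
      have h3 := sub_smul_dslope ΘF w' t
      rw [smul_eq_mul] at h3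
      have h4 := hne hw t
      have h5 := hne hw' t
      have h6 : dslope ΘF w' t = (ΘF t - ΘF w') / (t - w') := by
        rw [← h3]; field_simp
      have h7 := hE0 t
      have h8 := hF0 t
      have h9 := hE0' t
      simp only [h6, realPart, sharp_mul]
      simp only [hΘE, hΘF, map_mul, map_div₀, map_add, map_sub, map_one, Complex.conj_conj,
        Complex.conj_ofReal, sharp_ofReal]
      field_simp
      ring
    rw [hkey]
    exact mul_ne_zero Complex.two_pi_I_ne_zero hDw
  -- The integrand is the conjugate of a Hardy function divided by `t - w`, hence integrates to
  -- zero.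
  · have hu : IsHardy fun z => sharp f z / E z * (1 / (z - conj w')) :=
      hf.right.mul_bounded (analyticAt_inv_sub_conj hw') fun z hz => norm_inv_sub_conj_le hw' hz
    rw [← (hu.integral_conj_div_eq_zero hw).2]
    refine (inner_toLp _ _).trans (integral_congr_ae (Eventually.of_forall fun t => ?_))
    have h4 := hne hw t
    have h5 := hne hw' t
    have h7 := hE0 t
    have h8 := hF0 t
    have h9 := hE0' t
    simp only [hΘE, map_mul, map_div₀, map_sub, map_one, Complex.conj_conj,
      Complex.conj_ofReal, sharp_ofReal]
    field_simp

end Witness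


/-! ### Weighted sampling at the zeros of `G + G*`. -/

section Sampling

theorem mem_dbSubmodule_iff {G : ℂ → ℂ} {k : L2R} :
    k ∈ dbSubmodule G ↔ ∃ g, ∃ hg : MemDB G g, k = hg.toL2 := by
  constructor
  · rintro ⟨g, hg, h⟩
    exact ⟨g, hg, Lp.ext (h.trans hg.coeFn_toL2.symm)⟩
  · rintro ⟨g, hg, rfl⟩
    exact ⟨g, hg, hg.coeFn_toL2⟩

theorem MemDB.toL2_eq_smul {G f g : ℂ → ℂ} (hf : MemDB G f) (hg : MemDB G g) {c : ℂ}
    (h : ∀ z, f z = c * g z) : hf.toL2 = c • hg.toL2 := by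
  refine Lp.ext ?_
  filter_upwards [hf.coeFn_toL2, hg.coeFn_toL2, Lp.coeFn_smul c hg.toL2] with t h1 h2 h3
  rw [h1, h3, Pi.smul_apply, h2, h, smul_eq_mul, mul_div_assoc]

theorem realPart_mul (E F : ℂ → ℂ) (z : ℂ) :
    realPart (fun z => E z * F z) z = E z * F z + sharp E z * sharp F z := by
  rw [realPart, sharp_mul]

/-- The orthogonal sampling formula at the zeros of `G + G*`, restricted to the image of the space
of `E` in the space of `G = E * F`. -/
theorem exists_le_tsum_norm_sq_div_kernel {E F : ℂ → ℂ} (hE : IsRegularHB E) (hF : IsRegularHB F)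
    (hpos : ∀ x : ℝ, 0 < (kernel (fun z => E z * F z) x x).re) :
    ∃ A : ℝ, 0 < A ∧ ∀ f, MemDB E f →
      Summable (fun x : {x : ℝ // E (x : ℂ) * F (x : ℂ) + sharp E (x : ℂ) * sharp F (x : ℂ) = 0} =>
        ‖f x‖ ^ 2 * (‖F x‖ ^ 2 / (kernel (fun z => E z * F z) x x).re)) ∧
      A * normSq E f ≤ ∑' x : {x : ℝ // E (x : ℂ) * F (x : ℂ) + sharp E (x : ℂ) * sharp F (x : ℂ) = 0},
        ‖f x‖ ^ 2 * (‖F x‖ ^ 2 / (kernel (fun z => E z * F z) x x).re) ∧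
      ∑' x : {x : ℝ // E (x : ℂ) * F (x : ℂ) + sharp E (x : ℂ) * sharp F (x : ℂ) = 0},
        ‖f x‖ ^ 2 * (‖F x‖ ^ 2 / (kernel (fun z => E z * F z) x x).re) ≤ normSq E f := by
  have hG := hE.mul hF
  set G : ℂ → ℂ := fun z => E z * F z with hGdef
  have hGz : ∀ z, realPart G z = E z * F z + sharp E z * sharp F z := realPart_mul E F
  have hksq : ∀ x : ℝ, ‖(hG.memDB_kernel x).toL2‖ ^ 2 = (kernel G x x).re := fun x => by
    rw [MemDB.norm_toL2_sq, hG.normSq_kernel]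
  have hkne : ∀ x : ℝ, ‖(hG.memDB_kernel x).toL2‖ ≠ 0 := fun x h => by
    have h1 := hpos x
    rw [← hksq x, h] at h1
    simp at h1
  set u : {x : ℝ // E (x : ℂ) * F (x : ℂ) + sharp E (x : ℂ) * sharp F (x : ℂ) = 0} → L2R := fun x =>
    ((‖(hG.memDB_kernel x).toL2‖⁻¹ : ℝ) : ℂ) • (hG.memDB_kernel x).toL2 with hu
  have huinner : ∀ (x : {x : ℝ // E (x : ℂ) * F (x : ℂ) + sharp E (x : ℂ) * sharp F (x : ℂ) = 0}) (g : ℂ → ℂ) (hg : MemDB G g),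
      inner ℂ (u x) hg.toL2 = ((‖(hG.memDB_kernel x).toL2‖⁻¹ : ℝ) : ℂ) * g x := by
    intro x g hg
    rw [hu, inner_smul_left, hG.inner_kernel hg, Complex.conj_ofReal]
  have hzero : ∀ (x : {x : ℝ // E (x : ℂ) * F (x : ℂ) + sharp E (x : ℂ) * sharp F (x : ℂ) = 0}) (g : ℂ → ℂ) (hg : MemDB G g),
      inner ℂ (u x) hg.toL2 = 0 → g x = 0 := by
    intro x g hg h
    rw [huinner] at h
    refine (mul_eq_zero.1 h).resolve_left ?_
    exact_mod_cast inv_ne_zero (hkne x)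
  have horth : Orthonormal ℂ u := by
    refine ⟨fun x => ?_, fun x y hxy => ?_⟩
    · rw [hu, norm_smul, Complex.norm_real, norm_inv, norm_norm, inv_mul_cancel₀ (hkne x)]
    · have h1 := huinner x _ (hG.memDB_kernel y)
      rw [kernel_eq_zero_of_ne ((hGz y).trans y.2) ((hGz x).trans x.2) (fun h => hxy (Subtype.ext h.symm)), mul_zero] at h1
      change inner ℂ (u x) (_ • _) = 0
      rw [inner_smul_right, h1, mul_zero]
  have hsq : ∀ f, ∀ hf : MemDB E f, ∀ x : {x : ℝ // E (x : ℂ) * F (x : ℂ) + sharp E (x : ℂ) * sharp F (x : ℂ) = 0},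
      ‖inner ℂ (u x) (hf.mul_right hE hF).toL2‖ ^ 2 =
        ‖f x‖ ^ 2 * (‖F x‖ ^ 2 / (kernel G x x).re) := by
    intro f hf x
    rw [huinner, ← hksq, norm_mul, norm_mul, Complex.norm_real, norm_inv, norm_norm]
    ring
  have hnorm : ∀ f, ∀ hf : MemDB E f, ‖(hf.mul_right hE hF).toL2‖ ^ 2 = normSq E f := by
    intro f hf
    rw [MemDB.norm_toL2_sq, hF.normSq_mul_right]
  obtain ⟨A, hA0, hA⟩ := exists_le_tsum_norm_inner_sq horth hG.isClosed_dbSubmodule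
    (S := {h | ∃ f, ∃ hf : MemDB E f, h = (hf.mul_right hE hF).toL2})
    (fun x => Submodule.smul_mem _ _ (mem_dbSubmodule_iff.2 ⟨_, hG.memDB_kernel x, rfl⟩))
    (by rintro h ⟨f, hf, rfl⟩; exact mem_dbSubmodule_iff.2 ⟨_, hf.mul_right hE hF, rfl⟩)
    (by
      intro k hk hku hk0
      have hliou : ∀ g, MemDB G g → (∀ x : {x : ℝ // E (x : ℂ) * F (x : ℂ) + sharp E (x : ℂ) * sharp F (x : ℂ) = 0}, g x = 0) →
          ∃ c : ℂ, ∀ z, g z = c * realPart G z := fun g hg h =>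
        hG.eq_const_mul_realPart hg (fun x hx => deriv_realPart_ne_zero hx fun h0 => by
          have := hpos x
          rw [h0] at this
          simp at this) fun x hx => h ⟨x, (hGz x).symm.trans hx⟩
      obtain ⟨g, hg, rfl⟩ := mem_dbSubmodule_iff.1 hk
      obtain ⟨c, hc⟩ := hliou g hg fun x => hzero x g hg (hku x)
      have hc0 : c ≠ 0 := by
        rintro rfl
        apply hk0
        rw [hg.toL2_eq_smul hg (c := 0) (fun z => by rw [hc]; simp), zero_smul]
      -- A nonzero vector orthogonal to the system is a nonzero multiple of `G + G*`, so this
      -- function belongs to the space exactly when the witness is needed.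
      have hA : MemDB G (realPart G) := by
        have h1 := hg.const_mul c⁻¹
        have h2 : (fun z => c⁻¹ * g z) = realPart G := by
          funext z
          rw [hc, inv_mul_cancel_left₀ hc0]
        rwa [h2] at h1
      refine ⟨fun r hr hru => ?_, ?_⟩
      · obtain ⟨g', hg', rfl⟩ := mem_dbSubmodule_iff.1 hr
        obtain ⟨c', hc'⟩ := hliou g' hg' fun x => hzero x g' hg' (hru x)
        refine ⟨c' / c, hg'.toL2_eq_smul hg fun z => ?_⟩
        rw [hc', hc]
        field_simp
      · obtain ⟨m, hm, hm'⟩ := exists_orthogonal_inner_realPart_ne_zero hE hF hA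
        refine ⟨m, ?_, ?_⟩
        · rw [hg.toL2_eq_smul hA hc, inner_smul_right]
          exact mul_ne_zero hc0 hm
        · rintro h ⟨f, hf, rfl⟩
          exact hm' f hf)
  refine ⟨A, hA0, fun f hf => ?_⟩
  have h1 := hA _ ⟨f, hf, rfl⟩
  have h2 := Orthonormal.inner_products_summable (hf.mul_right hE hF).toL2 horth
  have h3 := Orthonormal.tsum_inner_products_le (hf.mul_right hE hF).toL2 horth
  simp only [hsq f hf, hnorm f hf] at h1 h2 h3
  exact ⟨h2, h1, h3⟩

/-- Monotonicity of `φF` gives `0 ≤ φF'`, hence the first bound. The comparison `φF' ≤ C φE'` gives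
the second. -/
theorem kernel_mul_self_bounds {E F : ℂ → ℂ} {φE φF : ℝ → ℝ}
    (hφE : IsPhaseFunction E φE) (hφF : IsPhaseFunction F φF) (hE : IsRegularHB E)
    (hF : IsRegularHB F) {C : ℝ} {x : ℝ} (hC : deriv φF x ≤ C * deriv φE x) :
    ‖F x‖ ^ 2 * (kernel E x x).re ≤ (kernel (fun z => E z * F z) x x).re ∧
      (kernel (fun z => E z * F z) x x).re ≤ (1 + C) * (‖F x‖ ^ 2 * (kernel E x x).re) := by
  have hE0 : ∀ x : ℝ, E x ≠ 0 := fun x => hE.ne_zero x (by simp)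
  rw [kernel_mul_self hφE hφF hE hF, hφE.kernel_self hE.differentiable hE0]
  have h1 : 0 ≤ deriv φF x := hφF.strictMono.monotone.deriv_nonneg
  have hpi := Real.pi_pos
  constructor
  · calc ‖F x‖ ^ 2 * (‖E x‖ ^ 2 * deriv φE x / Real.pi)
        = ‖E x‖ ^ 2 * ‖F x‖ ^ 2 * (deriv φE x + 0) / Real.pi := by ring
      _ ≤ _ := by gcongr
  · calc ‖E x‖ ^ 2 * ‖F x‖ ^ 2 * (deriv φE x + deriv φF x) / Real.pi
        ≤ ‖E x‖ ^ 2 * ‖F x‖ ^ 2 * (deriv φE x + C * deriv φE x) / Real.pi := by gcongr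
      _ = _ := by ring

end Sampling

end DeBranges

/-! ### Removal of the weights and transfer to the space of `E₀`. -/

theorem mainTheorem10 (E₀ E F : ℂ → ℂ)
    (hE₀ : DeBranges.IsHermiteBiehler E₀) (hE : DeBranges.IsHermiteBiehler E)
    (hF : DeBranges.IsHermiteBiehler F)
    (hE₀_real : ∀ x : ℝ, E₀ x ≠ 0) (hE_real : ∀ x : ℝ, E x ≠ 0) (hF_real : ∀ x : ℝ, F x ≠ 0)
    (hsame : DeBranges.SameSpace E₀ E)
    (φE φF : ℝ → ℝ)
    (hφE : DeBranges.IsPhaseFunction E φE) (hφF : DeBranges.IsPhaseFunction F φF)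
    (hφ : ∃ C : ℝ, 0 < C ∧ ∀ x : ℝ, deriv φF x ≤ C * deriv φE x)
    (hK : ∃ a b : ℝ, 0 < a ∧ 0 < b ∧ ∀ x : ℝ,
      a ≤ (DeBranges.kernel E₀ x x).re ∧ (DeBranges.kernel E₀ x x).re ≤ b) :
    (∀ z : ℂ, E z * F z + DeBranges.sharp E z * DeBranges.sharp F z = 0 → z.im = 0) ∧
      DeBranges.IsSamplingSequence E₀
        (fun x : {x : ℝ // E (x : ℂ) * F (x : ℂ) +
          DeBranges.sharp E (x : ℂ) * DeBranges.sharp F (x : ℂ) = 0} => (x : ℝ)) := by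
  have rE₀ := hE₀.isRegularHB hE₀_real
  have rE := hE.isRegularHB hE_real
  have rF := hF.isRegularHB hF_real
  refine ⟨fun z hz => by_contra fun him => (rE.mul rF).realPart_ne_zero him 
    ((DeBranges.realPart_mul E F z).trans hz), ?_⟩
  obtain ⟨C, hC0, hC⟩ := hφ
  obtain ⟨a, b, ha, hb, hab⟩ := hK
  obtain ⟨hspace, p, q, hp, hq, hpq⟩ := hsame
  -- The kernel of `E₀` tested in the space of `E` gives the lower bound, and the kernel of `E`
  -- tested in the space of `E₀` gives the upper one.
  have hKE : ∀ x : ℝ, a ≤ q * (DeBranges.kernel E x x).re ∧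
      p * (DeBranges.kernel E x x).re ≤ b := by
    intro x
    have m₁ := rE₀.kernel_mem_space x
    have m₂ := rE.kernel_mem_space x
    have m₂' : DeBranges.kernel E x ∈ DeBranges.space E₀ := hspace ▸ m₂
    constructor
    · exact (hab x).1.trans (rE₀.kernel_self_le rE (rE.memDB_of_mem_space (hspace ▸ m₁))
        (hpq _ m₁).2 hq.le)
    · have h1 := rE.kernel_self_le rE₀ (rE₀.memDB_of_mem_space m₂') (c := p⁻¹)
        ((le_inv_mul_iff₀ hp).2 (hpq _ m₂').1) (by positivity)
      exact ((le_inv_mul_iff₀ hp).1 h1).trans (hab x).2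
  have hKEpos : ∀ x : ℝ, 0 < (DeBranges.kernel E x x).re := fun x =>
    pos_of_mul_pos_right (ha.trans_le (hKE x).1) hq.le
  have hF2 : ∀ x : ℝ, 0 < ‖F x‖ ^ 2 := fun x => by
    have := norm_pos_iff.2 (hF_real x)
    positivity
  have hGb := fun x : ℝ => DeBranges.kernel_mul_self_bounds hφE hφF rE rF (hC x)
  have hGpos : ∀ x : ℝ, 0 < (DeBranges.kernel (fun z => E z * F z) x x).re := fun x =>
    (mul_pos (hF2 x) (hKEpos x)).trans_le (hGb x).1
  obtain ⟨A, hA0, hA⟩ := DeBranges.exists_le_tsum_norm_sq_div_kernel rE rF hGpos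
  have hw₁ : ∀ x : ℝ, ‖F x‖ ^ 2 / (DeBranges.kernel (fun z => E z * F z) x x).re ≤ q / a := by
    intro x
    rw [div_le_div_iff₀ (hGpos x) ha]
    have h1 := (hKE x).1
    have h2 := (hGb x).1
    have h3 := hF2 x
    calc ‖F x‖ ^ 2 * a ≤ ‖F x‖ ^ 2 * (q * (DeBranges.kernel E x x).re) := by gcongr
      _ = q * (‖F x‖ ^ 2 * (DeBranges.kernel E x x).re) := by ring
      _ ≤ _ := by gcongr
  have hw₂ : ∀ x : ℝ, p / ((1 + C) * b) ≤
      ‖F x‖ ^ 2 / (DeBranges.kernel (fun z => E z * F z) x x).re := by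
    intro x
    rw [div_le_div_iff₀ (by positivity) (hGpos x)]
    have h1 := (hKE x).2
    have h2 := (hGb x).2
    have h3 := hF2 x
    calc p * (DeBranges.kernel (fun z => E z * F z) x x).re
        ≤ p * ((1 + C) * (‖F x‖ ^ 2 * (DeBranges.kernel E x x).re)) := by gcongr
      _ = (1 + C) * ‖F x‖ ^ 2 * (p * (DeBranges.kernel E x x).re) := by ring
      _ ≤ (1 + C) * ‖F x‖ ^ 2 * b := by gcongr
      _ = _ := by ring
  -- The factors `a / q` and `(1 + C) b / p` are the reciprocals of the upper and lower bounds for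
  -- the weights. `A` and `1` are the frame bounds in the space of `E`, and `p`, `q` compare the two
  -- norms.
  refine ⟨a / q * (A * p), (1 + C) * b / p * q, by positivity, by positivity, fun f hf => ?_⟩
  obtain ⟨hS, hlow, hup⟩ := hA f (rE.memDB_of_mem_space (hspace ▸ hf))
  obtain ⟨hn₁, hn₂⟩ := hpq f hf
  have hle : ∀ x : {x : ℝ // E (x : ℂ) * F (x : ℂ) +
      DeBranges.sharp E (x : ℂ) * DeBranges.sharp F (x : ℂ) = 0}, ‖f (x : ℝ)‖ ^ 2 ≤
      (1 + C) * b / p * (‖f (x : ℝ)‖ ^ 2 *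
        (‖F (x : ℝ)‖ ^ 2 / (DeBranges.kernel (fun z => E z * F z) (x : ℝ) (x : ℝ)).re)) := by
    intro x
    calc ‖f (x : ℝ)‖ ^ 2 = (1 + C) * b / p * (‖f (x : ℝ)‖ ^ 2 * (p / ((1 + C) * b))) := by
          field_simp
      _ ≤ _ := mul_le_mul_of_nonneg_left
        (mul_le_mul_of_nonneg_left (hw₂ x) (by positivity)) (by positivity)
  have hle' : ∀ x : {x : ℝ // E (x : ℂ) * F (x : ℂ) +
      DeBranges.sharp E (x : ℂ) * DeBranges.sharp F (x : ℂ) = 0},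
      a / q * (‖f (x : ℝ)‖ ^ 2 *
        (‖F (x : ℝ)‖ ^ 2 / (DeBranges.kernel (fun z => E z * F z) (x : ℝ) (x : ℝ)).re)) ≤
      ‖f (x : ℝ)‖ ^ 2 := by
    intro x
    calc _ ≤ a / q * (‖f (x : ℝ)‖ ^ 2 * (q / a)) := mul_le_mul_of_nonneg_left
          (mul_le_mul_of_nonneg_left (hw₁ x) (by positivity)) (by positivity)
      _ = _ := by field_simp
  have hSf : Summable fun x : {x : ℝ // E (x : ℂ) * F (x : ℂ) +
      DeBranges.sharp E (x : ℂ) * DeBranges.sharp F (x : ℂ) = 0} => ‖f (x : ℝ)‖ ^ 2 :=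
    Summable.of_nonneg_of_le (fun x => by positivity) hle (hS.mul_left _)
  refine ⟨hSf, ?_, ?_⟩
  · calc a / q * (A * p) * DeBranges.normSq E₀ f
        = a / q * (A * (p * DeBranges.normSq E₀ f)) := by ring
      _ ≤ a / q * (A * DeBranges.normSq E f) := by gcongr
      _ ≤ _ := by
        refine (mul_le_mul_of_nonneg_left hlow (by positivity)).trans ?_
        rw [← tsum_mul_left]
        exact Summable.tsum_le_tsum hle' (hS.mul_left _) hSf
  · refine (Summable.tsum_le_tsum hle hSf (hS.mul_left _)).trans ?_
    rw [tsum_mul_left, mul_assoc]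
    gcongr
    exact hup.trans hn₂
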